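/- **Setting.** Let $\{(X_i,Y_{1i},Y_{2i})\}_{i\in\mathbb Z}$ satisfy $Y_{1i}=h_0(Y_{2i})+\epsilon_i$, $E[\epsilon_i\mid X_i]=0$, with $h_0:\mathbb R^d\to\mathbb R$ measurable and $h_0(Y_{2i})\in L^2$. Let $\mathcal F_{i-1}=\sigma(X_i,X_{i-1},\epsilon_{i-1},X_{i-2},\epsilon_{i-2},\dots)$, and let $\delta>0$, $0<p<\gamma\le\gamma_x$. Throughout, $\|\cdot\|$ is the Euclidean norm of a vector and the spectral norm of a matrix, $A^-$ is the Moore–Penrose inverse, $\|f\|_\infty=\sup_{y\in[0,1]^d}|f(y)|\in[0,\infty]$, and $a_n\lesssim b_n$ means $a_n\le Cb_n$ for some finite $C$ and all large $n$. Assume: 1. $\{(X_i,Y_{1i},Y_{2i})\}_{i\in\mathbb Z}$ is strictly stationary; $X_i$ and $Y_{2i}$ have support $[0,1]^d$ and Lebesgue densities that are bounded away from zero and infinity on $[0,1]^d$. 2. $(\epsilon_i,\mathcal F_{i-1})_{i\in\mathbb Z}$ is a strictly stationary martingale difference sequence; $E[\epsilon_i^2\mid\mathcal F_{i-1}]$ is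 bounded away from zero and infinity, uniformly; $E|\epsilon_i|^{2+\delta}<\infty$. 3. For each $J\ge1$, $\psi^J=(\psi_{J1},\dots,\psi_{JJ})'$ consists of functions that are Hölder continuous with smoothness $\gamma$ on $[0,1]^d$, with Hölder norms bounded by $CJ^{\alpha}$ for some $C,\alpha$ not depending on $J$; $\sup_{y\in[0,1]^d}\|\psi^J(y)\|\lesssim\sqrt J$; and $\lambda_{\min}(E[\psi^J(Y_{2i})\psi^J(Y_{2i})'])\ge\underline\lambda>0$ for all $J\ge1$. 4. For each $K\ge1$, $b^K=(b_{K1},\dots,b_{KK})'$ consists of functions that are Hölder continuous with smoothness $\gamma_x$ on $[0,1]^d$; $\sup_{x\in[0,1]^d}\|b^K(x)\|\lesssim\sqrt K$; and $\lambda_{\min}(E[b^K(X_i)b^K(X_i)'])\ge\underline\lambda>0$ for all $K\ge1$. (Smoothness $\gamma$ means: with $k$ the largest integer strictly below $\gamma$, the function is $C^k$ and its $k$-th derivative is Hölder continuous with exponent $\gamma-k$; the Hölder norm bounds the derivatives up to order $k$ and that Hölder constant.) **Estimator.** For sample size $n$ let $B$ and $\Psi$ be the matrices with rows $b^K(X_i)'$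 and $\psi^J(Y_{2i})'$, $i=1,\dots,n$, let $Y=(Y_{11},\dots,Y_{1n})'$, $H_0=(h_0(Y_{21}),\dots,h_0(Y_{2n}))'$, and $$\hat h(y)=\psi^J(y)'[\Psi'B(B'B)^-B'\Psi]^-\Psi'B(B'B)^-B'Y .$$ Put $\tilde b^K=E[b^K(X_i)b^K(X_i)']^{-1/2}b^K$ and $\tilde\psi^J=E[\psi^J(Y_{2i})\psi^J(Y_{2i})']^{-1/2}\psi^J$, let $\tilde B,\tilde\Psi$ be the matrices with rows $\tilde b^K(X_i)'$, $\tilde\psi^J(Y_{2i})'$, and let $S=E[\tilde\psi^J(Y_{2i})\tilde b^K(X_i)']$, $\hat S=\tilde\Psi'\tilde B/n$, $\sigma_{JK}=\lambda_{\min}(SS')^{1/2}$ and $$P_nh_0(y)=\tilde\psi^J(y)'[\hat S(\tilde B'\tilde B/n)^-\hat S']^-\hat S(\tilde B'\tilde B/n)^-\tilde B'H_0/n .$$ **Theorem.** Let $J=J_n\to\infty$ and $K=K_n\to\infty$ as $n\to\infty$ and suppose that, for all large $n$, $\sigma_{JK}>0$ and $J\le K$. Suppose further that (i) $K\lesssim(n/\log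 n)^{\delta/(2+\delta)}$ and $\sigma_{JK}^{-1}\sqrt{K(\log n)/n}\lesssim1$; (ii) $\sigma_{JK}^{-1}\bigl(\|\tilde B'\tilde B/n-I_K\|+\|\hat S-S\|\bigr)$ is both $O_p(\sqrt{(\log n)/K})$ and $o_p(1)$. Then $$\|h_0-\hat h\|_\infty\le\|h_0-P_nh_0\|_\infty+O_p\Bigl(\sigma_{JK}^{-1}\sqrt{K(\log n)/n}\Bigr),$$ that is, the inequality holds for every $n$ with a remainder $R_n$ in place of the last term, where $R_n=O_p(\sigma_{JK}^{-1}\sqrt{K(\log n)/n})$. -/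

import Mathlib

open MeasureTheory ProbabilityTheory Filter Topology
open scoped ENNReal Matrix

noncomputable section

namespace NPIV

/-! ### Matrices -/

/-- The four Penrose equations: `G` is the Moore-Penrose inverse of the real matrix `A`. -/
structure IsMoorePenrose {m n : Type*} [Fintype m] [Fintype n]
    (A : Matrix m n ℝ) (G : Matrix n m ℝ) : Prop where
  mul_mul_left : A * G * A = A
  mul_mul_right : G * A * G = G
  symm_left : (A * G)ᵀ = A * G
  symm_right : (G * A)ᵀ = G * A

theorem IsMoorePenrose.unique {m n : Type*} [Fintype m] [Fintype n]
    {A : Matrix m n ℝ} {G H : Matrix n m ℝ}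
    (hG : IsMoorePenrose A G) (hH : IsMoorePenrose A H) : G = H := by
  have h1 : A * G = A * H := by
    calc A * G = (A * H * A) * G := by rw [hH.mul_mul_left]
      _ = (A * H) * (A * G) := by simp only [Matrix.mul_assoc]
      _ = (A * H)ᵀ * (A * G)ᵀ := by rw [hG.symm_left, hH.symm_left]
      _ = ((A * G) * (A * H))ᵀ := by rw [Matrix.transpose_mul (A * G)]
      _ = ((A * G * A) * H)ᵀ := by simp only [Matrix.mul_assoc]
      _ = A * H := by rw [hG.mul_mul_left, hH.symm_left]
  have h2 : G * A = H * A := by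
    calc G * A = G * (A * H * A) := by rw [hH.mul_mul_left]
      _ = (G * A) * (H * A) := by simp only [Matrix.mul_assoc]
      _ = (G * A)ᵀ * (H * A)ᵀ := by rw [hG.symm_right, hH.symm_right]
      _ = ((H * A) * (G * A))ᵀ := by rw [Matrix.transpose_mul (H * A)]
      _ = (H * (A * G * A))ᵀ := by simp only [Matrix.mul_assoc]
      _ = H * A := by rw [hG.mul_mul_left, hH.symm_right]
  calc G = G * A * G := hG.mul_mul_right.symm
    _ = H * A * G := by rw [h2]
    _ = H * (A * G) := by rw [Matrix.mul_assoc]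
    _ = H * A * H := by rw [h1, Matrix.mul_assoc]
    _ = H := hH.mul_mul_right

theorem exists_isMoorePenrose {m n : Type*} [Fintype m] [Fintype n]
    (A : Matrix m n ℝ) : ∃ G : Matrix n m ℝ, IsMoorePenrose A G := by
  classical
  have hH : (Aᵀ * A).IsHermitian := by
    rw [← Matrix.conjTranspose_eq_transpose_of_trivial]
    exact Matrix.isHermitian_conjTranspose_mul_self A
  have hS : IsSelfAdjoint (Aᵀ * A) := hH
  set P : Matrix n n ℝ := cfc (fun x : ℝ => x⁻¹) (Aᵀ * A) with hP
  have hid : cfc (fun x : ℝ => x) (Aᵀ * A) = Aᵀ * A := cfc_id' ℝ (Aᵀ * A)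
  have hc : ∀ f : ℝ → ℝ, ContinuousOn f (spectrum ℝ (Aᵀ * A)) := fun f =>
    (Matrix.finite_real_spectrum (A := Aᵀ * A)).continuousOn f
  have hPs : Pᵀ = P := by
    have h : IsSelfAdjoint P := cfc_predicate _ _
    have h' : star P = P := h
    rwa [Matrix.star_eq_conjTranspose, Matrix.conjTranspose_eq_transpose_of_trivial] at h'
  have hmul : ∀ f g : ℝ → ℝ, cfc f (Aᵀ * A) * cfc g (Aᵀ * A) = cfc (fun x => f x * g x) (Aᵀ * A) :=
    fun f g => (cfc_mul f g _ (hc f) (hc g)).symm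
  have hcomm : P * (Aᵀ * A) = (Aᵀ * A) * P := by
    have h := (hmul (fun x => x⁻¹) (fun x => x)).trans
      ((congrArg (fun f => cfc f (Aᵀ * A)) (funext fun x => mul_comm _ _)).trans
        (hmul (fun x => x) (fun x => x⁻¹)).symm)
    rwa [hid] at h
  have hHPH : (Aᵀ * A) * P * (Aᵀ * A) = Aᵀ * A := by
    have h : cfc (fun x : ℝ => x) (Aᵀ * A) * cfc (fun x : ℝ => x⁻¹) (Aᵀ * A)
        * cfc (fun x : ℝ => x) (Aᵀ * A) = cfc (fun x : ℝ => x) (Aᵀ * A) := by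
      rw [hmul, hmul]
      exact congrArg (fun f => cfc f (Aᵀ * A)) (funext fun x => mul_inv_mul_cancel x)
    rwa [hid] at h
  have hx : ∀ x : ℝ, x⁻¹ * x * x⁻¹ = x⁻¹ := fun x => by
    simpa only [inv_inv] using mul_inv_mul_cancel x⁻¹
  have hPHP : P * (Aᵀ * A) * P = P := by
    have h : cfc (fun x : ℝ => x⁻¹) (Aᵀ * A) * cfc (fun x : ℝ => x) (Aᵀ * A)
        * cfc (fun x : ℝ => x⁻¹) (Aᵀ * A) = cfc (fun x : ℝ => x⁻¹) (Aᵀ * A) := by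
      rw [hmul, hmul]
      exact congrArg (fun f => cfc f (Aᵀ * A)) (funext hx)
    rwa [hid] at h
  have hHt : (Aᵀ * A)ᵀ = Aᵀ * A := by simp
  refine ⟨P * Aᵀ, ?_, ?_, ?_, ?_⟩
  · have h0 : Aᵀ * A * (P * (Aᵀ * A) - 1) = 0 := by
      rw [Matrix.mul_sub, ← Matrix.mul_assoc, hHPH, Matrix.mul_one, sub_self]
    have h1 : A * (P * (Aᵀ * A) - 1) = 0 := by
      rw [← Matrix.conjTranspose_eq_transpose_of_trivial] at h0 ⊢
      exact (Matrix.conjTranspose_mul_self_mul_eq_zero A _).1 h0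
    rw [Matrix.mul_sub, Matrix.mul_one, sub_eq_zero] at h1
    rw [Matrix.mul_assoc, Matrix.mul_assoc]
    exact h1
  · calc P * Aᵀ * A * (P * Aᵀ) = (P * (Aᵀ * A) * P) * Aᵀ := by simp only [Matrix.mul_assoc]
      _ = P * Aᵀ := by rw [hPHP]
  · simp only [Matrix.transpose_mul, Matrix.transpose_transpose, hPs, Matrix.mul_assoc]
  · rw [Matrix.mul_assoc, Matrix.transpose_mul, hHt, hPs, hcomm]

/-- The Moore-Penrose generalized inverse `A⁻`. -/
def pinv {m n : Type*} [Fintype m] [Fintype n] (A : Matrix m n ℝ) : Matrix n m ℝ :=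
  (exists_isMoorePenrose A).choose

theorem pinv_spec {m n : Type*} [Fintype m] [Fintype n] (A : Matrix m n ℝ) :
    IsMoorePenrose A (pinv A) :=
  (exists_isMoorePenrose A).choose_spec

/-- Smallest eigenvalue of a (real symmetric, nonempty) matrix. -/
def lambdaMin {n : ℕ} (A : Matrix (Fin n) (Fin n) ℝ) : ℝ := sInf (spectrum ℝ A)

open scoped Matrix.Norms.L2Operator in
/-- The spectral norm (largest singular value) of a matrix. -/
def specNorm {m n : ℕ} (A : Matrix (Fin m) (Fin n) ℝ) : ℝ := ‖A‖

/-- `A^{-1/2}`: the inverse of the positive semidefinite square root of a symmetric matrix. -/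
def invSqrt {n : ℕ} (A : Matrix (Fin n) (Fin n) ℝ) : Matrix (Fin n) (Fin n) ℝ :=
  (cfc Real.sqrt A)⁻¹

/-! ### Functions on the unit cube -/

/-- `ℝ^d` with the Euclidean norm. -/
abbrev Pt (d : ℕ) : Type := EuclideanSpace ℝ (Fin d)

/-- `[0,1]^d`. -/
def unitCube (d : ℕ) : Set (Pt d) := {y | ∀ i, y i ∈ Set.Icc (0 : ℝ) 1}

/-- The sup-norm `‖f‖_∞ = sup_{y ∈ [0,1]^d} |f y|`, with values in `[0,∞]`. -/
def supNorm {d : ℕ} (f : Pt d → ℝ) : ℝ≥0∞ := ⨆ y ∈ unitCube d, ‖f y‖ₑ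

/-- For `γ > 0`: `f` is Hölder continuous with smoothness `γ` on `[0,1]^d`, with all constants at
most `M`.  With `k` the largest integer strictly below `γ`, `f` is `k` times continuously
differentiable, its derivatives of order at most `k` are bounded by `M`, and the `k`-th one is
Hölder continuous with exponent `γ - k ∈ (0,1]` and constant `M`. -/
structure IsHolderWith {d : ℕ} (γ M : ℝ) (f : Pt d → ℝ) : Prop where
  contDiffOn : ContDiffOn ℝ ((⌈γ⌉₊ - 1 : ℕ) : ℕ∞) f (unitCube d)
  bound : ∀ j ≤ ⌈γ⌉₊ - 1, ∀ y ∈ unitCube d,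
    ‖iteratedFDerivWithin ℝ j f (unitCube d) y‖ ≤ M
  holder : ∀ y ∈ unitCube d, ∀ z ∈ unitCube d,
    ‖iteratedFDerivWithin ℝ (⌈γ⌉₊ - 1) f (unitCube d) y
        - iteratedFDerivWithin ℝ (⌈γ⌉₊ - 1) f (unitCube d) z‖
      ≤ M * ‖y - z‖ ^ (γ - ((⌈γ⌉₊ - 1 : ℕ) : ℝ))

/-- For each `J`, the `J` basis functions `ψ_{J1}, …, ψ_{JJ}`. -/
abbrev SieveBasis (d : ℕ) : Type := (J : ℕ) → Fin J → Pt d → ℝ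

/-! ### Stochastic orders -/

/-- `T_n = O_p(a_n)`. -/
def IsBigOp {Ω : Type*} [MeasurableSpace Ω] (μ : Measure Ω) (T : ℕ → Ω → ℝ) (a : ℕ → ℝ) : Prop :=
  ∀ η : ℝ≥0∞, 0 < η → ∃ M : ℝ, 0 < M ∧ ∀ᶠ n in atTop, μ {ω | M * a n < |T n ω|} ≤ η

/-- `T_n = o_p(1)`. -/
def IsLittleOpOne {Ω : Type*} [MeasurableSpace Ω] (μ : Measure Ω) (T : ℕ → Ω → ℝ) : Prop :=
  TendstoInMeasure μ T atTop (fun _ => 0)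

/-! ### The model and the assumptions -/

/-- A process indexed by `ℤ` is strictly stationary. -/
def StrictlyStationary {Ω S : Type*} [MeasurableSpace Ω] [MeasurableSpace S] (μ : Measure Ω)
    (Z : ℤ → Ω → S) : Prop :=
  ∀ k : ℤ, IdentDistrib (fun ω (i : ℤ) => Z (i + k) ω) (fun ω (i : ℤ) => Z i ω) μ μ

/-- `ℱ_{i-1} = σ(X_i, X_{i-1}, ε_{i-1}, X_{i-2}, ε_{i-2}, …)`. -/
abbrev past {Ω : Type*} {d : ℕ} (X : ℤ → Ω → Pt d) (ε : ℤ → Ω → ℝ) (i : ℤ) : MeasurableSpace Ω :=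
  (⨆ j : Set.Iic i, MeasurableSpace.comap (X j) inferInstance) ⊔
    (⨆ j : Set.Iio i, MeasurableSpace.comap (ε j) inferInstance)

/-- The model `Y₁ᵢ = h₀(Y₂ᵢ) + εᵢ`, `E[εᵢ | Xᵢ] = 0`. -/
structure Model {Ω : Type*} [MeasurableSpace Ω] {d : ℕ} (μ : Measure Ω)
    (X : ℤ → Ω → Pt d) (Y₁ : ℤ → Ω → ℝ) (Y₂ : ℤ → Ω → Pt d) (ε : ℤ → Ω → ℝ)
    (h₀ : Pt d → ℝ) : Prop where
  measurable_X : ∀ i, Measurable (X i)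
  measurable_Y₁ : ∀ i, Measurable (Y₁ i)
  measurable_Y₂ : ∀ i, Measurable (Y₂ i)
  measurable_ε : ∀ i, Measurable (ε i)
  measurable_h₀ : Measurable h₀
  memLp_h₀ : MemLp (fun ω => h₀ (Y₂ 0 ω)) 2 μ
  eq : ∀ i, ∀ᵐ ω ∂μ, Y₁ i ω = h₀ (Y₂ i ω) + ε i ω
  condExp_eq : ∀ i, μ[ε i | MeasurableSpace.comap (X i) inferInstance] =ᵐ[μ] 0

/-- The law `ν` on `ℝ^d` has support `[0,1]^d` and a Lebesgue density that is uniformly bounded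
away from zero and infinity on `[0,1]^d`. -/
def HasBoundedDensityOnCube {d : ℕ} (ν : Measure (Pt d)) : Prop :=
  ν.support = unitCube d ∧
    ∃ f : Pt d → ℝ, Measurable f ∧ ν = volume.withDensity (fun x => ENNReal.ofReal (f x)) ∧
      ∃ c C : ℝ, 0 < c ∧ ∀ x ∈ unitCube d, c ≤ f x ∧ f x ≤ C

/-- Stationary data, with laws of the instrument and of the regressor as above. -/
structure DataAssumption {Ω : Type*} [MeasurableSpace Ω] {d : ℕ} (μ : Measure Ω)
    (X : ℤ → Ω → Pt d) (Y₁ : ℤ → Ω → ℝ) (Y₂ : ℤ → Ω → Pt d) : Prop where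
  stationary : StrictlyStationary μ (fun i ω => (X i ω, Y₁ i ω, Y₂ i ω))
  density_X : HasBoundedDensityOnCube (μ.map (X 0))
  density_Y₂ : HasBoundedDensityOnCube (μ.map (Y₂ 0))

/-- The errors are a strictly stationary martingale difference sequence, with conditional second
moment bounded away from zero and infinity and with a finite `(2+δ)`-th moment. -/
structure ResidAssumption {Ω : Type*} [MeasurableSpace Ω] {d : ℕ} (μ : Measure Ω)
    (X : ℤ → Ω → Pt d) (ε : ℤ → Ω → ℝ) (δ : ℝ) : Prop where
  stationary : StrictlyStationary μ ε
  integrable : ∀ i, Integrable (ε i) μ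
  condExp_eq : ∀ i, μ[ε i | past X ε i] =ᵐ[μ] 0
  condVar : ∃ c C : ℝ, 0 < c ∧ ∀ i, ∀ᵐ ω ∂μ,
    c ≤ (μ[fun ω => ε i ω ^ 2 | past X ε i]) ω ∧ (μ[fun ω => ε i ω ^ 2 | past X ε i]) ω ≤ C
  moment : ∀ i, Integrable (fun ω => |ε i ω| ^ (2 + δ)) μ

/-- `E[b(X) b(X)']`. -/
def gram {Ω : Type*} [MeasurableSpace Ω] {d K : ℕ} (μ : Measure Ω) (b : Fin K → Pt d → ℝ)
    (X : Ω → Pt d) : Matrix (Fin K) (Fin K) ℝ :=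
  Matrix.of fun k l => ∫ ω, b k (X ω) * b l (X ω) ∂μ

/-- Conditions common to the two sieve bases: `sup_x ‖b^K(x)‖ ≲ √K` and
`λ_min(E[b^K(X) b^K(X)']) ≥ λ > 0` for all `K ≥ 1`. -/
structure SieveBounds {Ω : Type*} [MeasurableSpace Ω] {d : ℕ} (μ : Measure Ω)
    (b : SieveBasis d) (X : Ω → Pt d) : Prop where
  sup_bound : ∃ C : ℝ, ∀ K, ∀ x ∈ unitCube d, √(∑ k, b K k x ^ 2) ≤ C * √(K : ℝ)
  gram_bound : ∃ lam : ℝ, 0 < lam ∧ ∀ K, 1 ≤ K → lam ≤ lambdaMin (gram μ (b K) X)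

/-- The basis `ψ^J` of the space of structural functions: Hölder continuous with smoothness `γ`,
with Hölder constants growing at most polynomially in `J`. -/
structure PsiAssumption {Ω : Type*} [MeasurableSpace Ω] {d : ℕ} (μ : Measure Ω)
    (ψ : SieveBasis d) (Y₂ : Ω → Pt d) (γ : ℝ) : Prop where
  holder : ∃ C α : ℝ, ∀ J, ∀ j : Fin J, IsHolderWith γ (C * (J : ℝ) ^ α) (ψ J j)
  bounds : SieveBounds μ ψ Y₂

/-- The basis `b^K` of the instrument space: Hölder continuous with smoothness `γ`. -/
structure BAssumption {Ω : Type*} [MeasurableSpace Ω] {d : ℕ} (μ : Measure Ω)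
    (b : SieveBasis d) (X : Ω → Pt d) (γ : ℝ) : Prop where
  holder : ∀ K, ∀ k : Fin K, ∃ M : ℝ, IsHolderWith γ M (b K k)
  bounds : SieveBounds μ b X

/-! ### The estimator -/

/-- The orthonormalized basis `b̃(x) = E[b(X) b(X)']^{-1/2} b(x)`. -/
def orthonormalized {Ω : Type*} [MeasurableSpace Ω] {d K : ℕ} (μ : Measure Ω)
    (b : Fin K → Pt d → ℝ) (X : Ω → Pt d) : Fin K → Pt d → ℝ :=
  fun k x => (invSqrt (gram μ b X) *ᵥ fun l => b l x) k

/-- The `n × K` matrix `(b(X_1), …, b(X_n))'`. -/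
def design {Ω : Type*} {d K : ℕ} (n : ℕ) (b : Fin K → Pt d → ℝ) (X : ℤ → Ω → Pt d) (ω : Ω) :
    Matrix (Fin n) (Fin K) ℝ :=
  Matrix.of fun i k => b k (X ((i : ℤ) + 1) ω)

/-- The sieve NPIV estimator
`ĥ(y) = ψ(y)' [Ψ'B(B'B)⁻B'Ψ]⁻ Ψ'B(B'B)⁻B'Y` from the observations `1, …, n`. -/
def hHat {Ω : Type*} {d J K : ℕ} (n : ℕ) (ψ : Fin J → Pt d → ℝ) (b : Fin K → Pt d → ℝ)
    (X : ℤ → Ω → Pt d) (Y₁ : ℤ → Ω → ℝ) (Y₂ : ℤ → Ω → Pt d) (ω : Ω) (y : Pt d) : ℝ :=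
  let Ψ := design n ψ Y₂ ω
  let B := design n b X ω
  let Y : Fin n → ℝ := fun i => Y₁ ((i : ℤ) + 1) ω
  (fun j => ψ j y) ⬝ᵥ
    ((pinv (Ψᵀ * B * pinv (Bᵀ * B) * Bᵀ * Ψ) * (Ψᵀ * B * pinv (Bᵀ * B) * Bᵀ)) *ᵥ Y)

/-- `B̃'B̃/n`. -/
def gramHat {Ω : Type*} [MeasurableSpace Ω] {d K : ℕ} (μ : Measure Ω) (n : ℕ)
    (b : Fin K → Pt d → ℝ) (X : ℤ → Ω → Pt d) (ω : Ω) : Matrix (Fin K) (Fin K) ℝ :=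
  let B := design n (orthonormalized μ b (X 0)) X ω
  (n : ℝ)⁻¹ • (Bᵀ * B)

/-- `S = E[ψ̃(Y₂) b̃(X)']`. -/
def matS {Ω : Type*} [MeasurableSpace Ω] {d J K : ℕ} (μ : Measure Ω)
    (ψ : Fin J → Pt d → ℝ) (b : Fin K → Pt d → ℝ)
    (X : ℤ → Ω → Pt d) (Y₂ : ℤ → Ω → Pt d) : Matrix (Fin J) (Fin K) ℝ :=
  Matrix.of fun j k => ∫ ω, orthonormalized μ ψ (Y₂ 0) j (Y₂ 0 ω)
    * orthonormalized μ b (X 0) k (X 0 ω) ∂μ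

/-- `Ŝ = Ψ̃'B̃/n`. -/
def matSHat {Ω : Type*} [MeasurableSpace Ω] {d J K : ℕ} (μ : Measure Ω) (n : ℕ)
    (ψ : Fin J → Pt d → ℝ) (b : Fin K → Pt d → ℝ)
    (X : ℤ → Ω → Pt d) (Y₂ : ℤ → Ω → Pt d) (ω : Ω) : Matrix (Fin J) (Fin K) ℝ :=
  (n : ℝ)⁻¹ • ((design n (orthonormalized μ ψ (Y₂ 0)) Y₂ ω)ᵀ
    * design n (orthonormalized μ b (X 0)) X ω)

/-- `σ_{JK} = λ_min(SS')^{1/2}`. -/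
def sigmaJK {Ω : Type*} [MeasurableSpace Ω] {d J K : ℕ} (μ : Measure Ω)
    (ψ : Fin J → Pt d → ℝ) (b : Fin K → Pt d → ℝ)
    (X : ℤ → Ω → Pt d) (Y₂ : ℤ → Ω → Pt d) : ℝ :=
  √(lambdaMin (matS μ ψ b X Y₂ * (matS μ ψ b X Y₂)ᵀ))

/-- The empirical projection
`P_n h₀(y) = ψ̃(y)' [Ŝ(B̃'B̃/n)⁻Ŝ']⁻ Ŝ(B̃'B̃/n)⁻B̃'H₀/n`, `H₀ = (h₀(Y₂₁), …, h₀(Y₂ₙ))'`. -/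
def projN {Ω : Type*} [MeasurableSpace Ω] {d J K : ℕ} (μ : Measure Ω) (n : ℕ)
    (ψ : Fin J → Pt d → ℝ) (b : Fin K → Pt d → ℝ)
    (X : ℤ → Ω → Pt d) (Y₂ : ℤ → Ω → Pt d) (h₀ : Pt d → ℝ) (ω : Ω) (y : Pt d) : ℝ :=
  let G := gramHat μ n b X ω
  let S := matSHat μ n ψ b X Y₂ ω
  let B := design n (orthonormalized μ b (X 0)) X ω
  let H₀ : Fin n → ℝ := fun i => h₀ (Y₂ ((i : ℤ) + 1) ω)
  (fun j => orthonormalized μ ψ (Y₂ 0) j y) ⬝ᵥ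
    ((pinv (S * pinv G * Sᵀ) * S * pinv G * Bᵀ) *ᵥ ((n : ℝ)⁻¹ • H₀))

/-- `σ_{JK}^{-1} √(K (log n) / n)`. -/
def rate (σ : ℝ) (K n : ℕ) : ℝ := σ⁻¹ * √((K : ℝ) * Real.log n / n)

/-- `σ_{JK}^{-1} (‖B̃'B̃/n - I_K‖ + ‖Ŝ - S‖)`. -/
def matrixError {Ω : Type*} [MeasurableSpace Ω] {d J K : ℕ} (μ : Measure Ω) (n : ℕ)
    (ψ : Fin J → Pt d → ℝ) (b : Fin K → Pt d → ℝ)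
    (X : ℤ → Ω → Pt d) (Y₂ : ℤ → Ω → Pt d) (ω : Ω) : ℝ :=
  (sigmaJK μ ψ b X Y₂)⁻¹ *
    (specNorm (gramHat μ n b X ω - 1) + specNorm (matSHat μ n ψ b X Y₂ ω - matS μ ψ b X Y₂))

end NPIV

end

/-! The remainder is R_n = ‖ĥ - P_n h₀‖_∞, so the inequality itself is the triangle inequality and
all the work lies in the rate of R_n.

Write Ĝ = B̃'B̃/n, Z = B̃'ε/n and σ = σ_{JK}. Once the matrices involved are invertible, the
two-stage least squares fit does not depend on the choice of bases and is linear in Y = H₀ + ε. The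
H₀ part cancels against P_n h₀, leaving ψ̃(y)'a with ŜĜ⁻¹Ŝ'a = ŜĜ⁻¹Z (`hHat_sub_projN`).

Replacing Ŝ and Ĝ by S and I gives a₀ = (SS')⁻¹SZ. By `perturbation_bound`, |a - a₀| is at most a
constant times σ⁻¹ · `matrixError` · |Z|. A second moment computation gives |Z| = O_p(√(K/n)). With
|ψ̃(y)| ≲ √J ≤ √K and a matrix error of order √(log n / K), this part is O_p(σ⁻¹√(K log n / n))
uniformly in y.

For fixed y, the leading term ψ̃(y)'a₀ is a martingale sum: its weights depend on X_i, which is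
known to ℱ_{i-1}. The errors are truncated at √(n / (K log n)) and recentred conditionally, and a
Bernstein-type bound comes from an exponential supermartingale. That bound needs the sum of squared
weights to be controlled only on an event, and closeness of Ĝ to I supplies it. A union bound over a
grid of polynomial size, plus Hölder continuity of ψ between grid points, makes the estimate uniform
(`measure_exists_gridWeight_le`, `abs_hHat_sub_projN_le_of_grid`). The discarded part of the errors
is bounded in L¹ by the (2+δ)-th moment; here the growth restriction on K is exactly what is needed
(`mul_truncLevel_rpow_le`). `measure_lt_supNorm_le` collects the exceptional events. -/

namespace NPIV

/-! ### Euclidean norms of coordinate vectors -/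

/-- The Euclidean norm of a coordinate vector. -/
noncomputable def euc {n : ℕ} (v : Fin n → ℝ) : ℝ := ‖WithLp.toLp 2 v‖

theorem euc_nonneg {n : ℕ} (v : Fin n → ℝ) : 0 ≤ euc v := norm_nonneg _

theorem euc_sq {n : ℕ} (v : Fin n → ℝ) : euc v ^ 2 = v ⬝ᵥ v := by
  rw [euc, EuclideanSpace.norm_sq_eq]
  simp [dotProduct, sq]

theorem euc_eq_sqrt {n : ℕ} (v : Fin n → ℝ) : euc v = √(∑ i, v i ^ 2) := by
  rw [euc, EuclideanSpace.norm_eq]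
  simp

theorem euc_add_le {n : ℕ} (v w : Fin n → ℝ) : euc (v + w) ≤ euc v + euc w := by
  simpa [euc] using norm_add_le (WithLp.toLp 2 v) (WithLp.toLp 2 w)

theorem euc_sub_le {n : ℕ} (v w : Fin n → ℝ) : euc (v - w) ≤ euc v + euc w := by
  simpa [euc] using norm_sub_le (WithLp.toLp 2 v) (WithLp.toLp 2 w)

theorem euc_neg {n : ℕ} (v : Fin n → ℝ) : euc (-v) = euc v := by
  simp [euc]

theorem euc_zero {n : ℕ} : euc (0 : Fin n → ℝ) = 0 := by
  simp [euc]

theorem eq_zero_of_euc_eq_zero {n : ℕ} {v : Fin n → ℝ} (h : euc v = 0) : v = 0 := by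
  have := norm_eq_zero.1 h
  simpa using this

theorem abs_dotProduct_le {n : ℕ} (v w : Fin n → ℝ) : |v ⬝ᵥ w| ≤ euc v * euc w := by
  have h := abs_real_inner_le_norm (WithLp.toLp 2 w) (WithLp.toLp 2 v)
  rw [EuclideanSpace.inner_eq_star_dotProduct] at h
  simpa [euc, mul_comm] using h

theorem dotProduct_le_euc {n : ℕ} (v w : Fin n → ℝ) : v ⬝ᵥ w ≤ euc v * euc w :=
  (le_abs_self _).trans (abs_dotProduct_le v w)

theorem euc_le_of_sq_le {n m : ℕ} {v : Fin n → ℝ} {w : Fin m → ℝ} {c : ℝ} (hc : 0 ≤ c)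
    (h : v ⬝ᵥ v ≤ c ^ 2 * (w ⬝ᵥ w)) : euc v ≤ c * euc w := by
  refine abs_le_of_sq_le_sq' ?_ (mul_nonneg hc (euc_nonneg _)) |>.2
  rw [mul_pow, euc_sq, euc_sq]
  exact h

open scoped Matrix.Norms.L2Operator in
theorem euc_mulVec_le {m n : ℕ} (A : Matrix (Fin m) (Fin n) ℝ) (v : Fin n → ℝ) :
    euc (A *ᵥ v) ≤ specNorm A * euc v := by
  have h := Matrix.l2_opNorm_mulVec A (WithLp.toLp 2 v)
  exact h

open scoped Matrix.Norms.L2Operator in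
theorem specNorm_nonneg {m n : ℕ} (A : Matrix (Fin m) (Fin n) ℝ) : 0 ≤ specNorm A :=
  norm_nonneg A

theorem dotProduct_mulVec_transpose {m n : ℕ} (A : Matrix (Fin m) (Fin n) ℝ)
    (a : Fin m → ℝ) (z : Fin n → ℝ) : a ⬝ᵥ (A *ᵥ z) = (Aᵀ *ᵥ a) ⬝ᵥ z := by
  rw [Matrix.dotProduct_mulVec, Matrix.mulVec_transpose]

/-- Duality: |A'a|² = a'A(A'a) ≤ |a| c |A'a|, then divide by |A'a|. -/
theorem euc_transpose_mulVec_le {m n : ℕ} {A : Matrix (Fin m) (Fin n) ℝ} {c : ℝ} (hc : 0 ≤ c)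
    (h : ∀ z, euc (A *ᵥ z) ≤ c * euc z) (a : Fin m → ℝ) : euc (Aᵀ *ᵥ a) ≤ c * euc a := by
  have h1 : euc (Aᵀ *ᵥ a) ^ 2 ≤ euc a * (c * euc (Aᵀ *ᵥ a)) := by
    rw [euc_sq, ← dotProduct_mulVec_transpose]
    exact (dotProduct_le_euc _ _).trans (mul_le_mul_of_nonneg_left (h _) (euc_nonneg _))
  rcases (euc_nonneg (Aᵀ *ᵥ a)).eq_or_lt with h0 | h0
  · rw [← h0]
    exact mul_nonneg hc (euc_nonneg _)
  · nlinarith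

/-! ### Symmetric matrices -/

/-- Rayleigh bound: subtracting `lambdaMin A` times the identity shifts the spectrum into [0, ∞), so
the difference is positive semidefinite. -/
theorem lambdaMin_mul_le {n : ℕ} {A : Matrix (Fin n) (Fin n) ℝ} (hA : A.IsHermitian)
    (x : Fin n → ℝ) : lambdaMin A * (x ⬝ᵥ x) ≤ x ⬝ᵥ (A *ᵥ x) := by
  have hl : ∀ i, lambdaMin A ≤ hA.eigenvalues i := fun i => by
    refine csInf_le (Matrix.finite_real_spectrum (A := A)).bddBelow ?_
    rw [hA.spectrum_real_eq_range_eigenvalues]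
    exact ⟨i, rfl⟩
  have hB : (A - lambdaMin A • (1 : Matrix (Fin n) (Fin n) ℝ)).IsHermitian := by
    rw [Matrix.IsHermitian, Matrix.conjTranspose_sub, hA.eq]
    simp
  have hps : (A - lambdaMin A • (1 : Matrix (Fin n) (Fin n) ℝ)).PosSemidef := by
    rw [hB.posSemidef_iff_eigenvalues_nonneg]
    intro i
    have hi : hB.eigenvalues i ∈ spectrum ℝ (A - lambdaMin A • (1 : Matrix (Fin n) (Fin n) ℝ)) := by
      rw [hB.spectrum_real_eq_range_eigenvalues]
      exact ⟨i, rfl⟩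
    have h2 : hB.eigenvalues i + lambdaMin A ∈ spectrum ℝ A := by
      have h3 : A = algebraMap ℝ (Matrix (Fin n) (Fin n) ℝ) (lambdaMin A)
          + (A - lambdaMin A • (1 : Matrix (Fin n) (Fin n) ℝ)) := by
        rw [Algebra.algebraMap_eq_smul_one, add_sub_cancel]
      have h4 := spectrum.add_mem_add_iff (s := lambdaMin A) |>.2 hi
      rwa [← h3] at h4
    rw [hA.spectrum_real_eq_range_eigenvalues] at h2
    obtain ⟨j, hj⟩ := h2
    have := hl j
    simp only [Pi.zero_apply]
    linarith
  have h := hps.dotProduct_mulVec_nonneg x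
  simp only [star_trivial, Matrix.sub_mulVec, Matrix.smul_mulVec, Matrix.one_mulVec,
    dotProduct_sub, dotProduct_smul, smul_eq_mul] at h
  linarith

theorem posDef_of_lambdaMin_pos {n : ℕ} {A : Matrix (Fin n) (Fin n) ℝ} (hA : A.IsHermitian)
    (h : 0 < lambdaMin A) : A.PosDef := by
  rw [Matrix.posDef_iff_dotProduct_mulVec]
  refine ⟨hA, fun x hx => ?_⟩
  have h1 : 0 < x ⬝ᵥ x := by
    have := Matrix.dotProduct_star_self_pos_iff.2 hx
    simpa using this
  simpa using (mul_pos h h1).trans_le (lambdaMin_mul_le hA x)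

theorem sqrt_mul_sqrt_cfc {n : ℕ} {A : Matrix (Fin n) (Fin n) ℝ} (hA : A.PosSemidef) :
    cfc Real.sqrt A * cfc Real.sqrt A = A := by
  have hs : IsSelfAdjoint A := hA.isHermitian
  rw [← cfc_mul Real.sqrt Real.sqrt A]
  conv_rhs => rw [← cfc_id' ℝ A]
  refine cfc_congr fun x hx => ?_
  rw [hA.isHermitian.spectrum_real_eq_range_eigenvalues] at hx
  obtain ⟨i, rfl⟩ := hx
  exact Real.mul_self_sqrt (hA.eigenvalues_nonneg i)

/-- `L` is a symmetric invertible matrix with `L A L = 1`. -/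
structure IsInvSqrt {n : ℕ} (A L : Matrix (Fin n) (Fin n) ℝ) : Prop where
  symm : Lᵀ = L
  isUnit : IsUnit L
  mul_mul : L * A * L = 1

theorem isInvSqrt_invSqrt {n : ℕ} {A : Matrix (Fin n) (Fin n) ℝ} (hA : A.PosDef) :
    IsInvSqrt A (invSqrt A) := by
  have hsq := sqrt_mul_sqrt_cfc hA.posSemidef
  have hsymm : (cfc Real.sqrt A)ᵀ = cfc Real.sqrt A := by
    have h : IsSelfAdjoint (cfc Real.sqrt A) := cfc_predicate _ _
    have h' : star (cfc Real.sqrt A) = cfc Real.sqrt A := h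
    rwa [Matrix.star_eq_conjTranspose, Matrix.conjTranspose_eq_transpose_of_trivial] at h'
  have hu : IsUnit (cfc Real.sqrt A) := by
    have := hA.isUnit
    rw [← hsq, Matrix.isUnit_iff_isUnit_det, Matrix.det_mul] at this
    rw [Matrix.isUnit_iff_isUnit_det]
    exact isUnit_of_mul_isUnit_left this
  have hd := (Matrix.isUnit_iff_isUnit_det _).1 hu
  refine ⟨?_, ?_, ?_⟩
  · rw [invSqrt, Matrix.transpose_nonsing_inv, hsymm]
  · rw [invSqrt, Matrix.isUnit_nonsing_inv_iff]
    exact hu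
  · rw [invSqrt]
    nth_rewrite 2 [← hsq]
    rw [← Matrix.mul_assoc, Matrix.nonsing_inv_mul _ hd, Matrix.one_mul, Matrix.mul_nonsing_inv _ hd]

/-- Apply the lower bound on A to Lx and use (Lx)'A(Lx) = x'x. -/
theorem IsInvSqrt.euc_mulVec_le {n : ℕ} {A L : Matrix (Fin n) (Fin n) ℝ} (h : IsInvSqrt A L)
    {l : ℝ} (hl : 0 < l) (hA : ∀ x : Fin n → ℝ, l * (x ⬝ᵥ x) ≤ x ⬝ᵥ (A *ᵥ x)) (x : Fin n → ℝ) :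
    euc (L *ᵥ x) ≤ √l⁻¹ * euc x := by
  refine euc_le_of_sq_le (Real.sqrt_nonneg _) ?_
  rw [Real.sq_sqrt (inv_nonneg.2 hl.le), ← div_eq_inv_mul, le_div_iff₀ hl, mul_comm]
  refine (hA _).trans_eq ?_
  rw [dotProduct_comm, dotProduct_mulVec_transpose, h.symm, dotProduct_comm, Matrix.mulVec_mulVec,
    Matrix.mulVec_mulVec, h.mul_mul, Matrix.one_mulVec]

/-! ### Invertibility, and pseudo-inverses as inverses. -/

theorem pinv_eq_inv {n : ℕ} {A : Matrix (Fin n) (Fin n) ℝ} (hA : IsUnit A) : pinv A = A⁻¹ := by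
  have hd := (Matrix.isUnit_iff_isUnit_det _).1 hA
  refine (pinv_spec A).unique ⟨?_, ?_, ?_, ?_⟩ <;>
    simp [Matrix.mul_nonsing_inv _ hd, Matrix.nonsing_inv_mul _ hd]

theorem isUnit_of_euc_le {n : ℕ} {A : Matrix (Fin n) (Fin n) ℝ} {c : ℝ} (hc : 0 < c)
    (h : ∀ x, c * euc x ≤ euc (A *ᵥ x)) : IsUnit A := by
  rw [← Matrix.mulVec_injective_iff_isUnit]
  intro x y hxy
  have h1 := h (x - y)
  rw [Matrix.mulVec_sub, sub_eq_zero.2 hxy, euc_zero] at h1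
  refine sub_eq_zero.1 (eq_zero_of_euc_eq_zero (le_antisymm ?_ (euc_nonneg _)))
  nlinarith [euc_nonneg (x - y)]

/-! ### Perturbation of the two-stage least squares coefficients -/

theorem le_dotProduct_mulVec_of_near {K : ℕ} {H : Matrix (Fin K) (Fin K) ℝ} {g : ℝ}
    (hg4 : g ≤ 1 / 4) (hH : ∀ z, euc (H *ᵥ z - z) ≤ 2 * g * euc z) (z : Fin K → ℝ) :
    1 / 2 * euc z ^ 2 ≤ z ⬝ᵥ (H *ᵥ z) := by
  have h1 : z ⬝ᵥ (H *ᵥ z) = euc z ^ 2 + z ⬝ᵥ (H *ᵥ z - z) := by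
    rw [dotProduct_sub, euc_sq]; ring
  have h2 := (abs_le.1 (abs_dotProduct_le z (H *ᵥ z - z))).1
  have h3 := mul_le_mul_of_nonneg_left (hH z) (euc_nonneg z)
  nlinarith [euc_nonneg z, mul_nonneg (euc_nonneg z) (euc_nonneg z)]

theorem euc_mulVec_le_of_near {K : ℕ} {H : Matrix (Fin K) (Fin K) ℝ} {g : ℝ}
    (hg4 : g ≤ 1 / 4) (hH : ∀ z, euc (H *ᵥ z - z) ≤ 2 * g * euc z) (z : Fin K → ℝ) :
    euc (H *ᵥ z) ≤ 2 * euc z := by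
  have h1 := euc_add_le (H *ᵥ z - z) z
  rw [sub_add_cancel] at h1
  nlinarith [hH z, euc_nonneg z]

/-- With x = G⁻¹z, the error G⁻¹z - z is x - Gx, of norm at most g|x|; and |x| ≤ 2|z| because G is
bounded below by 1 - g ≥ 1/2. -/
theorem near_inv {K : ℕ} {G : Matrix (Fin K) (Fin K) ℝ} {g : ℝ} (hg4 : g ≤ 1 / 4)
    (hG : specNorm (G - 1) ≤ g) :
    IsUnit G ∧ ∀ z, euc (G⁻¹ *ᵥ z - z) ≤ 2 * g * euc z := by
  have hx : ∀ x, euc (G *ᵥ x - x) ≤ g * euc x := fun x => by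
    have h := euc_mulVec_le (G - 1) x
    rw [Matrix.sub_mulVec, Matrix.one_mulVec] at h
    exact h.trans (mul_le_mul_of_nonneg_right hG (euc_nonneg x))
  have hg0 : 0 ≤ g := (specNorm_nonneg _).trans hG
  have hlow : ∀ x, 1 / 2 * euc x ≤ euc (G *ᵥ x) := fun x => by
    have h := euc_sub_le (G *ᵥ x) (G *ᵥ x - x)
    rw [sub_sub_cancel] at h
    nlinarith [hx x, euc_nonneg x]
  have hu := isUnit_of_euc_le (by norm_num) hlow
  refine ⟨hu, fun z => ?_⟩
  have hz : G *ᵥ (G⁻¹ *ᵥ z) = z := by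
    rw [Matrix.mulVec_mulVec, Matrix.mul_nonsing_inv _ ((Matrix.isUnit_iff_isUnit_det _).1 hu),
      Matrix.one_mulVec]
  have h1 := hx (G⁻¹ *ᵥ z)
  have h2 := hlow (G⁻¹ *ᵥ z)
  rw [hz] at h1 h2
  rw [← neg_sub, euc_neg]
  nlinarith

section Perturbation

variable {J K : ℕ} {S T : Matrix (Fin J) (Fin K) ℝ} {H : Matrix (Fin K) (Fin K) ℝ} {σ s g : ℝ}

theorem le_euc_transpose_mulVec_of_near (hS : ∀ a, σ * euc a ≤ euc (Sᵀ *ᵥ a))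
    (hTS : specNorm (T - S) ≤ s) (hs : s ≤ σ / 2) (a : Fin J → ℝ) :
    σ / 2 * euc a ≤ euc (Tᵀ *ᵥ a) := by
  have h1 : euc ((T - S)ᵀ *ᵥ a) ≤ s * euc a :=
    euc_transpose_mulVec_le ((specNorm_nonneg _).trans hTS) (fun z => (euc_mulVec_le _ z).trans
      (mul_le_mul_of_nonneg_right hTS (euc_nonneg z))) a
  rw [Matrix.transpose_sub, Matrix.sub_mulVec] at h1
  have h2 := euc_sub_le (Tᵀ *ᵥ a) (Tᵀ *ᵥ a - Sᵀ *ᵥ a)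
  rw [sub_sub_cancel] at h2
  nlinarith [hS a, euc_nonneg a]

/-- The quadratic form satisfies a'THT'a ≥ |T'a|²/2 ≥ σ²|a|²/8, so by Cauchy-Schwarz the matrix is
bounded below. -/
theorem isUnit_mul_mul_transpose_of_near (hσ : 0 < σ) (hS : ∀ a, σ * euc a ≤ euc (Sᵀ *ᵥ a))
    (hTS : specNorm (T - S) ≤ s) (hs : s ≤ σ / 2) (hg4 : g ≤ 1 / 4)
    (hH : ∀ z, euc (H *ᵥ z - z) ≤ 2 * g * euc z) : IsUnit (T * H * Tᵀ) := by
  refine isUnit_of_euc_le (c := σ ^ 2 / 8) (by positivity) fun a => ?_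
  have h1 := le_dotProduct_mulVec_of_near hg4 hH (Tᵀ *ᵥ a)
  rw [← dotProduct_mulVec_transpose, Matrix.mulVec_mulVec, Matrix.mulVec_mulVec] at h1
  have h2 := le_euc_transpose_mulVec_of_near hS hTS hs a
  have h3 := dotProduct_le_euc a ((T * H * Tᵀ) *ᵥ a)
  rcases (euc_nonneg a).eq_or_lt with h0 | h0
  · rw [← h0, mul_zero]; exact euc_nonneg _
  · have h4 : (σ / 2 * euc a) ^ 2 ≤ euc (Tᵀ *ᵥ a) ^ 2 := by gcongr
    nlinarith

/-- The residual of the least squares projection and its coefficients. -/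
theorem projection_bounds (hσ : 0 < σ) (hS : ∀ a, σ * euc a ≤ euc (Sᵀ *ᵥ a))
    {Z : Fin K → ℝ} {a₀ : Fin J → ℝ} (ha₀ : (S * Sᵀ) *ᵥ a₀ = S *ᵥ Z) :
    euc (Z - Sᵀ *ᵥ a₀) ≤ euc Z ∧ euc a₀ ≤ σ⁻¹ * euc Z := by
  have h0 : S *ᵥ (Z - Sᵀ *ᵥ a₀) = 0 := by
    rw [Matrix.mulVec_sub, Matrix.mulVec_mulVec, ha₀, sub_self]
  -- S annihilates the residual, so it is orthogonal to the range of S' and Pythagoras applies.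
  have h1 : (Sᵀ *ᵥ a₀) ⬝ᵥ (Z - Sᵀ *ᵥ a₀) = 0 := by
    rw [← dotProduct_mulVec_transpose, h0, dotProduct_zero]
  have h2 : euc Z ^ 2 = euc (Z - Sᵀ *ᵥ a₀) ^ 2 + euc (Sᵀ *ᵥ a₀) ^ 2 := by
    have hZ : Z = (Z - Sᵀ *ᵥ a₀) + Sᵀ *ᵥ a₀ := (sub_add_cancel _ _).symm
    set r := Z - Sᵀ *ᵥ a₀
    rw [euc_sq, euc_sq, euc_sq, hZ, add_dotProduct, dotProduct_add, dotProduct_add,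
      dotProduct_comm r (Sᵀ *ᵥ a₀), h1]
    ring
  refine ⟨?_, ?_⟩
  · nlinarith [euc_nonneg Z, euc_nonneg (Z - Sᵀ *ᵥ a₀), euc_nonneg (Sᵀ *ᵥ a₀)]
  · have h3 : euc (Sᵀ *ᵥ a₀) ≤ euc Z := by
      nlinarith [euc_nonneg Z, euc_nonneg (Z - Sᵀ *ᵥ a₀), euc_nonneg (Sᵀ *ᵥ a₀)]
    rw [← div_eq_inv_mul, le_div_iff₀ hσ, mul_comm]
    exact (hS a₀).trans h3

/-- Energy estimate for the difference D of the two solutions: test the perturbed normal equations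
against D and work with |T'D|, which dominates σ|D|/2. This gives the size σ⁻¹|Z| of a₀ times the
relative error σ⁻¹(g + s), with no further power of σ⁻¹. -/
theorem perturbation_bound (hσ : 0 < σ) (hS : ∀ a, σ * euc a ≤ euc (Sᵀ *ᵥ a))
    (hS1 : ∀ z, euc (S *ᵥ z) ≤ euc z)
    (hTS : specNorm (T - S) ≤ s) (hs : s ≤ σ / 2) (hg0 : 0 ≤ g) (hg4 : g ≤ 1 / 4)
    (hH : ∀ z, euc (H *ᵥ z - z) ≤ 2 * g * euc z) {Z : Fin K → ℝ} {a a₀ : Fin J → ℝ}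
    (ha : (T * H * Tᵀ) *ᵥ a = (T * H) *ᵥ Z) (ha₀ : (S * Sᵀ) *ᵥ a₀ = S *ᵥ Z) :
    euc (a - a₀) ≤ 24 * σ⁻¹ * (σ⁻¹ * (g + s)) * euc Z := by
  obtain ⟨hr, hb⟩ := projection_bounds hσ hS ha₀
  have hs0 : 0 ≤ s := (specNorm_nonneg _).trans hTS
  have h0 : S *ᵥ (Z - Sᵀ *ᵥ a₀) = 0 := by
    rw [Matrix.mulVec_sub, Matrix.mulVec_mulVec, ha₀, sub_self]
  set r := Z - Sᵀ *ᵥ a₀ with hrdef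
  set D := a - a₀ with hD
  have hTSv : ∀ z, euc ((T - S) *ᵥ z) ≤ s * euc z := fun z => (euc_mulVec_le _ z).trans
      (mul_le_mul_of_nonneg_right hTS (euc_nonneg z))
  have hTSt := euc_transpose_mulVec_le hs0 hTSv a₀
  -- Because Sr = 0, every term on the right carries a factor T - S or H - 1.
  have hkey : (T * H * Tᵀ) *ᵥ D
      = ((T - S) *ᵥ (H *ᵥ r) + S *ᵥ (H *ᵥ r - r)) - T *ᵥ (H *ᵥ ((T - S)ᵀ *ᵥ a₀)) := by
    have e1 : (T * H * Tᵀ) *ᵥ D = T *ᵥ (H *ᵥ (Z - Tᵀ *ᵥ a₀)) := by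
      rw [hD, Matrix.mulVec_sub, ha]
      simp only [Matrix.mulVec_sub, Matrix.mulVec_mulVec, Matrix.mul_assoc]
    have e2 : Z - Tᵀ *ᵥ a₀ = r - (T - S)ᵀ *ᵥ a₀ := by
      rw [hrdef, Matrix.transpose_sub, Matrix.sub_mulVec]
      abel
    rw [e1, e2, Matrix.mulVec_sub, Matrix.mulVec_sub, Matrix.mulVec_sub S, h0, sub_zero,
      Matrix.sub_mulVec T S, sub_add_cancel]
  have h1 := le_dotProduct_mulVec_of_near hg4 hH (Tᵀ *ᵥ D)
  rw [← dotProduct_mulVec_transpose, Matrix.mulVec_mulVec, Matrix.mulVec_mulVec,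
    hkey, dotProduct_sub, dotProduct_mulVec_transpose T] at h1
  have h2 := le_euc_transpose_mulVec_of_near hS hTS hs D
  have hA : D ⬝ᵥ ((T - S) *ᵥ (H *ᵥ r) + S *ᵥ (H *ᵥ r - r)) ≤
      euc D * ((2 * s + 2 * g) * euc Z) := by
    refine (dotProduct_le_euc _ _).trans (mul_le_mul_of_nonneg_left ?_ (euc_nonneg _))
    refine (euc_add_le _ _).trans ?_
    have b1 := (hTSv (H *ᵥ r)).trans
      (mul_le_mul_of_nonneg_left (euc_mulVec_le_of_near hg4 hH r) hs0)
    have b2 := (hS1 (H *ᵥ r - r)).trans (hH r)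
    have b3 : (2 * s + 2 * g) * euc r ≤ (2 * s + 2 * g) * euc Z := by gcongr
    linarith
  -- T is moved onto D: this term already pays σ⁻¹ through |a₀|, and bounding |D| by |T'D| here
  -- would cost a second one.
  have hB : -((Tᵀ *ᵥ D) ⬝ᵥ (H *ᵥ ((T - S)ᵀ *ᵥ a₀))) ≤
      euc (Tᵀ *ᵥ D) * (2 * (s * (σ⁻¹ * euc Z))) := by
    refine (neg_le_abs _).trans ((abs_dotProduct_le _ _).trans
      (mul_le_mul_of_nonneg_left ?_ (euc_nonneg _)))
    refine (euc_mulVec_le_of_near hg4 hH _).trans ?_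
    have : s * euc a₀ ≤ s * (σ⁻¹ * euc Z) := by gcongr
    linarith
  have hDle : euc D ≤ 2 * σ⁻¹ * euc (Tᵀ *ᵥ D) := by
    have h3 : σ⁻¹ * (σ / 2 * euc D) ≤ σ⁻¹ * euc (Tᵀ *ᵥ D) := by gcongr
    have h4 : σ⁻¹ * (σ / 2 * euc D) = euc D / 2 := by field_simp
    linarith
  have hA' : euc D * ((2 * s + 2 * g) * euc Z) ≤
      2 * σ⁻¹ * euc (Tᵀ *ᵥ D) * ((2 * s + 2 * g) * euc Z) := by
    have := euc_nonneg Z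
    gcongr
  set q := euc (Tᵀ *ᵥ D) with hq
  have hq0 : 0 ≤ q := euc_nonneg _
  -- Dividing by q leaves q/2 ≤ (4 + 2)σ⁻¹(g + s)|Z|; passing from q back to |D| doubles 12 to 24.
  have hfin : q ≤ 12 * (σ⁻¹ * (g + s) * euc Z) := by
    have hc : 1 / 2 * q ^ 2 ≤ q * (4 * (σ⁻¹ * (g + s) * euc Z)) + q * (2 * (s * (σ⁻¹ * euc Z))) := by
      linarith
    have hg' : 0 ≤ σ⁻¹ * g * euc Z := by
      have := euc_nonneg Z
      positivity
    rcases hq0.eq_or_lt with h | h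
    · rw [← h]
      have := euc_nonneg Z
      positivity
    · nlinarith
  calc euc D ≤ 2 * σ⁻¹ * q := hDle
    _ ≤ 2 * σ⁻¹ * (12 * (σ⁻¹ * (g + s) * euc Z)) := by gcongr
    _ = _ := by ring

end Perturbation

/-! ### The estimator in orthonormalized coordinates -/

theorem inv_smul_of_ne_zero {n : ℕ} {A : Matrix (Fin n) (Fin n) ℝ} {c : ℝ} (hc : c ≠ 0)
    (hA : IsUnit A) : (c • A)⁻¹ = c⁻¹ • A⁻¹ := by
  refine Matrix.inv_eq_right_inv ?_
  rw [Matrix.smul_mul, Matrix.mul_smul, smul_smul, mul_inv_cancel₀ hc, one_smul,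
    Matrix.mul_nonsing_inv _ ((Matrix.isUnit_iff_isUnit_det _).1 hA)]

/-- Change of basis for two-stage least squares. The Moore-Penrose inverse of a product is not in
general the reversed product, so the invertibility assumptions on G and TG⁻¹T' are what let L and M
cancel. -/
theorem pinv_mul_eq_of_orthonormalized {n J K : ℕ} {Ψ : Matrix (Fin n) (Fin J) ℝ}
    {B : Matrix (Fin n) (Fin K) ℝ} {L : Matrix (Fin J) (Fin J) ℝ} {M : Matrix (Fin K) (Fin K) ℝ}
    (hL : IsUnit L) (hLs : Lᵀ = L) (hM : IsUnit M) (hMs : Mᵀ = M) {c : ℝ} (hc : c ≠ 0)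
    {G : Matrix (Fin K) (Fin K) ℝ} (hG : G = c • ((B * M)ᵀ * (B * M)))
    {T : Matrix (Fin J) (Fin K) ℝ} (hT : T = c • ((Ψ * L)ᵀ * (B * M)))
    (hGu : IsUnit G) (hTu : IsUnit (T * G⁻¹ * Tᵀ)) :
    pinv (Ψᵀ * B * pinv (Bᵀ * B) * Bᵀ * Ψ) * (Ψᵀ * B * pinv (Bᵀ * B) * Bᵀ) =
      c • (L * ((T * G⁻¹ * Tᵀ)⁻¹ * T * G⁻¹ * (B * M)ᵀ)) := by
  have hMd := (Matrix.isUnit_iff_isUnit_det _).1 hM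
  have hLd := (Matrix.isUnit_iff_isUnit_det _).1 hL
  have hG' : G = c • (M * (Bᵀ * B) * M) := by
    rw [hG, Matrix.transpose_mul, hMs]
    simp only [Matrix.mul_assoc]
  have hMBM : M * (Bᵀ * B) * M = c⁻¹ • G := by
    rw [hG', smul_smul, inv_mul_cancel₀ hc, one_smul]
  have hMBMu : IsUnit (M * (Bᵀ * B) * M) := by
    rw [hMBM, Matrix.isUnit_iff_isUnit_det, Matrix.det_smul]
    exact ((IsUnit.mk0 _ (inv_ne_zero hc)).pow _).mul ((Matrix.isUnit_iff_isUnit_det _).1 hGu)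
  -- Invertibility of the raw matrices is read off from that of the orthonormalized ones through
  -- determinants.
  have hBu : IsUnit (Bᵀ * B) := by
    rw [Matrix.isUnit_iff_isUnit_det, Matrix.det_mul, Matrix.det_mul] at hMBMu
    rw [Matrix.isUnit_iff_isUnit_det]
    exact isUnit_of_mul_isUnit_right (isUnit_of_mul_isUnit_left hMBMu)
  have hGi : G⁻¹ = c⁻¹ • (M⁻¹ * (Bᵀ * B)⁻¹ * M⁻¹) := by
    rw [hG', inv_smul_of_ne_zero hc hMBMu, Matrix.mul_inv_rev, Matrix.mul_inv_rev,
      Matrix.mul_assoc]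
  have hTG : T * G⁻¹ = L * (Ψᵀ * B * (Bᵀ * B)⁻¹) * M⁻¹ := by
    rw [hT, hGi, Matrix.smul_mul, Matrix.mul_smul, smul_smul, mul_inv_cancel₀ hc, one_smul,
      Matrix.transpose_mul, hLs]
    calc L * Ψᵀ * (B * M) * (M⁻¹ * (Bᵀ * B)⁻¹ * M⁻¹)
        = L * Ψᵀ * B * (M * M⁻¹) * (Bᵀ * B)⁻¹ * M⁻¹ := by simp only [Matrix.mul_assoc]
      _ = _ := by rw [Matrix.mul_nonsing_inv _ hMd, Matrix.mul_one]; simp only [Matrix.mul_assoc]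
  have hTGB : T * G⁻¹ * (B * M)ᵀ = L * (Ψᵀ * B * (Bᵀ * B)⁻¹ * Bᵀ) := by
    rw [hTG, Matrix.transpose_mul, hMs, Matrix.mul_assoc _ M⁻¹, ← Matrix.mul_assoc M⁻¹,
      Matrix.nonsing_inv_mul _ hMd, Matrix.one_mul]
    simp only [Matrix.mul_assoc]
  have hW : T * G⁻¹ * Tᵀ = c • (L * (Ψᵀ * B * (Bᵀ * B)⁻¹ * Bᵀ * Ψ) * L) := by
    have hTt : Tᵀ = c • ((B * M)ᵀ * (Ψ * L)) := by
      rw [hT, Matrix.transpose_smul, Matrix.transpose_mul, Matrix.transpose_transpose]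
    rw [hTt, Matrix.mul_smul, ← Matrix.mul_assoc, hTGB]
    simp only [Matrix.mul_assoc]
  have hLWL : IsUnit (L * (Ψᵀ * B * (Bᵀ * B)⁻¹ * Bᵀ * Ψ) * L) := by
    rw [hW, Matrix.isUnit_iff_isUnit_det, Matrix.det_smul] at hTu
    rw [Matrix.isUnit_iff_isUnit_det]
    exact isUnit_of_mul_isUnit_right hTu
  have hWu : IsUnit (Ψᵀ * B * (Bᵀ * B)⁻¹ * Bᵀ * Ψ) := by
    rw [Matrix.isUnit_iff_isUnit_det, Matrix.det_mul, Matrix.det_mul] at hLWL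
    rw [Matrix.isUnit_iff_isUnit_det]
    exact isUnit_of_mul_isUnit_right (isUnit_of_mul_isUnit_left hLWL)
  rw [pinv_eq_inv hBu, pinv_eq_inv hWu, Matrix.mul_assoc _ T, Matrix.mul_assoc _ (T * G⁻¹), hTGB, hW,
    inv_smul_of_ne_zero hc hLWL, Matrix.mul_inv_rev, Matrix.mul_inv_rev, Matrix.smul_mul,
    Matrix.mul_smul, smul_smul, mul_inv_cancel₀ hc, one_smul]
  set W := Ψᵀ * B * (Bᵀ * B)⁻¹ * Bᵀ * Ψ
  calc W⁻¹ * (Ψᵀ * B * (Bᵀ * B)⁻¹ * Bᵀ)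
      = (L * L⁻¹) * W⁻¹ * (L⁻¹ * L) * (Ψᵀ * B * (Bᵀ * B)⁻¹ * Bᵀ) := by
        rw [Matrix.mul_nonsing_inv _ hLd, Matrix.nonsing_inv_mul _ hLd, Matrix.one_mul,
          Matrix.mul_one]
    _ = _ := by simp only [Matrix.mul_assoc]

theorem design_orthonormalized {Ω : Type*} [MeasurableSpace Ω] {d K : ℕ} (μ : Measure Ω) (n : ℕ)
    (b : Fin K → Pt d → ℝ) (X : ℤ → Ω → Pt d) (ω : Ω) :
    design n (orthonormalized μ b (X 0)) X ω =
      design n b X ω * (invSqrt (gram μ b (X 0)))ᵀ := by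
  ext i k
  simp [design, orthonormalized, Matrix.mul_apply, Matrix.mulVec, dotProduct, mul_comm]

/-- The coefficient vector `B̃'e/n`. -/
noncomputable def score {Ω : Type*} [MeasurableSpace Ω] {d K : ℕ} (μ : Measure Ω) (n : ℕ)
    (b : Fin K → Pt d → ℝ) (X : ℤ → Ω → Pt d) (ω : Ω) (e : Fin n → ℝ) : Fin K → ℝ :=
  (n : ℝ)⁻¹ • ((design n (orthonormalized μ b (X 0)) X ω)ᵀ *ᵥ e)

/-- In orthonormalized coordinates ĥ and P_n h₀ apply the same linear map to Y and to H₀, so only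
the errors survive. The coefficients are given by their normal equations, the form in which
`perturbation_bound` takes them. -/
theorem hHat_sub_projN {Ω : Type*} [MeasurableSpace Ω] {d J K : ℕ} (μ : Measure Ω) {n : ℕ}
    (hn : n ≠ 0) (ψ : Fin J → Pt d → ℝ) (b : Fin K → Pt d → ℝ)
    (X : ℤ → Ω → Pt d) (Y₁ : ℤ → Ω → ℝ) (Y₂ : ℤ → Ω → Pt d) (h₀ : Pt d → ℝ) (ω : Ω)
    (e : Fin n → ℝ) (he : ∀ i : Fin n, Y₁ ((i : ℤ) + 1) ω = h₀ (Y₂ ((i : ℤ) + 1) ω) + e i)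
    (hψ : IsInvSqrt (gram μ ψ (Y₂ 0)) (invSqrt (gram μ ψ (Y₂ 0))))
    (hb : IsInvSqrt (gram μ b (X 0)) (invSqrt (gram μ b (X 0))))
    (hG : IsUnit (gramHat μ n b X ω))
    (hT : IsUnit (matSHat μ n ψ b X Y₂ ω * (gramHat μ n b X ω)⁻¹ * (matSHat μ n ψ b X Y₂ ω)ᵀ)) :
    ∃ a : Fin J → ℝ,
      (matSHat μ n ψ b X Y₂ ω * (gramHat μ n b X ω)⁻¹ * (matSHat μ n ψ b X Y₂ ω)ᵀ) *ᵥ a =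
        (matSHat μ n ψ b X Y₂ ω * (gramHat μ n b X ω)⁻¹) *ᵥ score μ n b X ω e ∧
      ∀ y, hHat n ψ b X Y₁ Y₂ ω y - projN μ n ψ b X Y₂ h₀ ω y =
        (fun j => orthonormalized μ ψ (Y₂ 0) j y) ⬝ᵥ a := by
  have hc : (n : ℝ)⁻¹ ≠ 0 := inv_ne_zero (Nat.cast_ne_zero.2 hn)
  have key := pinv_mul_eq_of_orthonormalized (Ψ := design n ψ Y₂ ω) (B := design n b X ω)
    hψ.isUnit hψ.symm hb.isUnit hb.symm hc (G := gramHat μ n b X ω) (T := matSHat μ n ψ b X Y₂ ω)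
    (by rw [gramHat, design_orthonormalized, hb.symm])
    (by rw [matSHat, design_orthonormalized, design_orthonormalized, hb.symm, hψ.symm]) hG hT
  have hD : design n b X ω * invSqrt (gram μ b (X 0))
      = design n (orthonormalized μ b (X 0)) X ω := by
    rw [design_orthonormalized, hb.symm]
  rw [hD] at key
  set T := matSHat μ n ψ b X Y₂ ω
  set G := gramHat μ n b X ω
  set W := T * G⁻¹ * Tᵀ
  set D := design n (orthonormalized μ b (X 0)) X ω with hDdef
  refine ⟨(W⁻¹ * (T * G⁻¹)) *ᵥ score μ n b X ω e, ?_, fun y => ?_⟩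
  · rw [Matrix.mulVec_mulVec, ← Matrix.mul_assoc,
      Matrix.mul_nonsing_inv _ ((Matrix.isUnit_iff_isUnit_det _).1 hT), Matrix.one_mul]
  have hY : (fun i : Fin n => Y₁ ((i : ℤ) + 1) ω)
      = (fun i : Fin n => h₀ (Y₂ ((i : ℤ) + 1) ω)) + e := funext he
  have hψy : (fun j => orthonormalized μ ψ (Y₂ 0) j y)
      = invSqrt (gram μ ψ (Y₂ 0)) *ᵥ fun j => ψ j y := rfl
  have h1 : hHat n ψ b X Y₁ Y₂ ω y = (fun j => orthonormalized μ ψ (Y₂ 0) j y) ⬝ᵥ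
      ((W⁻¹ * T * G⁻¹ * Dᵀ) *ᵥ ((n : ℝ)⁻¹ • ((fun i : Fin n => h₀ (Y₂ ((i : ℤ) + 1) ω)) + e))) := by
    simp only [hHat]
    rw [key, hY, hψy, Matrix.smul_mulVec, Matrix.mulVec_smul, ← Matrix.mulVec_mulVec,
      dotProduct_smul, dotProduct_smul, dotProduct_mulVec_transpose, hψ.symm]
  have h2 : projN μ n ψ b X Y₂ h₀ ω y = (fun j => orthonormalized μ ψ (Y₂ 0) j y) ⬝ᵥ
      ((W⁻¹ * T * G⁻¹ * Dᵀ) *ᵥ ((n : ℝ)⁻¹ • (fun i : Fin n => h₀ (Y₂ ((i : ℤ) + 1) ω)))) := by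
    simp only [projN]
    rw [pinv_eq_inv hG, pinv_eq_inv hT]
  rw [h1, h2, ← dotProduct_sub, ← Matrix.mulVec_sub, smul_add, add_sub_cancel_left, score,
    ← hDdef, ← Matrix.mulVec_smul, Matrix.mulVec_mulVec]
  simp only [Matrix.mul_assoc]

/-! ### An exponential inequality for weighted martingale differences -/

section Martingale

variable {Ω : Type*} {mΩ : MeasurableSpace Ω} {μ : Measure Ω} [IsProbabilityMeasure μ]

theorem integral_mul_condExp_of_stronglyMeasurable {m : MeasurableSpace Ω} (hm : m ≤ mΩ)
    {g f : Ω → ℝ} (hg : StronglyMeasurable[m] g) (hgf : Integrable (g * f) μ)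
    (hf : Integrable f μ) : ∫ ω, g ω * f ω ∂μ = ∫ ω, g ω * (μ[f | m]) ω ∂μ := by
  rw [← integral_condExp hm (f := fun ω => g ω * f ω)]
  exact integral_congr_ae (condExp_mul_of_stronglyMeasurable_left hg hgf hf)

theorem integrable_of_ae_abs_le {f : Ω → ℝ} {B : ℝ} (hf : AEStronglyMeasurable f μ)
    (hB : ∀ᵐ ω ∂μ, |f ω| ≤ B) : Integrable f μ :=
  Integrable.of_bound hf B hB

theorem exp_le_one_add_add_sq {x : ℝ} (hx : |x| ≤ 1) : Real.exp x ≤ 1 + x + x ^ 2 := by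
  have := (abs_le.1 (Real.abs_exp_sub_one_sub_id_le hx)).2
  linarith

/-- A sequence of uniformly bounded martingale differences with bounded conditional variance. -/
structure IsBoundedMDS (μ : Measure Ω) (m : ℕ → MeasurableSpace Ω) (ξ : ℕ → Ω → ℝ) (B C : ℝ) :
    Prop where
  le : ∀ i, m i ≤ mΩ
  mono : Monotone m
  meas : ∀ i, StronglyMeasurable[m (i + 1)] (ξ i)
  bound : ∀ i, ∀ᵐ ω ∂μ, |ξ i ω| ≤ B
  condExp_eq : ∀ i, μ[ξ i | m i] =ᵐ[μ] 0
  condExp_sq_le : ∀ i, ∀ᵐ ω ∂μ, (μ[fun ω => ξ i ω ^ 2 | m i]) ω ≤ C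

/-- Exponential supermartingale: with x = lwξ and |x| ≤ 1, e^x ≤ 1 + x + x² has conditional mean at
most 1 + l²Cw² ≤ exp(l²Cw²), which the compensator cancels. The first two conclusions are carried
through the induction for measurability and integrability. -/
theorem IsBoundedMDS.integral_exp_le_one {m : ℕ → MeasurableSpace Ω} {ξ w : ℕ → Ω → ℝ}
    {B C b l : ℝ} (h : IsBoundedMDS μ m ξ B C) (hC : 0 ≤ C)
    (hw : ∀ i, StronglyMeasurable[m i] (w i)) (hwb : ∀ i ω, |w i ω| ≤ b)
    (hl : |l| * b * B ≤ 1) (n : ℕ) :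
    StronglyMeasurable[m n]
        (fun ω => Real.exp (∑ i ∈ Finset.range n, (l * w i ω * ξ i ω - l ^ 2 * C * w i ω ^ 2))) ∧
      (∀ᵐ ω ∂μ, |Real.exp (∑ i ∈ Finset.range n,
        (l * w i ω * ξ i ω - l ^ 2 * C * w i ω ^ 2))| ≤ Real.exp n) ∧
      ∫ ω, Real.exp (∑ i ∈ Finset.range n, (l * w i ω * ξ i ω - l ^ 2 * C * w i ω ^ 2)) ∂μ ≤ 1 := by
  have hx : ∀ i, ∀ᵐ ω ∂μ, |l * w i ω * ξ i ω| ≤ 1 := fun i => by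
    filter_upwards [h.bound i] with ω hω
    rw [abs_mul, abs_mul]
    refine le_trans ?_ hl
    have hb0 : 0 ≤ b := (abs_nonneg _).trans (hwb i ω)
    gcongr
    exact hwb i ω
  induction n with
  | zero =>
    refine ⟨?_, by simp, by simp⟩
    simp only [Finset.range_zero, Finset.sum_empty]
    exact stronglyMeasurable_const
  | succ n ih =>
    obtain ⟨ih1, ih2, ih3⟩ := ih
    set U : Ω → ℝ := fun ω => Real.exp (∑ i ∈ Finset.range n,
      (l * w i ω * ξ i ω - l ^ 2 * C * w i ω ^ 2)) with hU
    have hUint : Integrable U μ :=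
      integrable_of_ae_abs_le (ih1.mono (h.le n)).aestronglyMeasurable ih2
    have hsum : ∀ ω, Real.exp (∑ i ∈ Finset.range (n + 1),
        (l * w i ω * ξ i ω - l ^ 2 * C * w i ω ^ 2)) =
        U ω * Real.exp (-(l ^ 2 * C * w n ω ^ 2)) * Real.exp (l * w n ω * ξ n ω) := fun ω => by
      rw [Finset.sum_range_succ, hU, mul_assoc, ← Real.exp_add, ← Real.exp_add]
      congr 1
      ring
    simp only [hsum]
    have hwm := hw n
    have hwξ : StronglyMeasurable[m (n + 1)] fun ω => Real.exp (l * w n ω * ξ n ω) :=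
      Real.continuous_exp.comp_stronglyMeasurable
        ((stronglyMeasurable_const.mul (hwm.mono (h.mono n.le_succ))).mul (h.meas n))
    have hEm : StronglyMeasurable[m n] fun ω => Real.exp (-(l ^ 2 * C * w n ω ^ 2)) :=
      Real.continuous_exp.comp_stronglyMeasurable
        (stronglyMeasurable_const.mul (hwm.pow 2)).neg
    have hE1 : ∀ ω, Real.exp (-(l ^ 2 * C * w n ω ^ 2)) ≤ 1 := fun ω => by
      rw [Real.exp_le_one_iff]
      have : 0 ≤ l ^ 2 * C * w n ω ^ 2 := by positivity
      linarith
    -- V includes the new compensator but not yet the new increment, so it is measurable at time n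
    -- and can be pulled out of the conditional expectation.
    set V : Ω → ℝ := fun ω => U ω * Real.exp (-(l ^ 2 * C * w n ω ^ 2)) with hV
    have hVm : StronglyMeasurable[m n] V := ih1.mul hEm
    have hV0 : ∀ ω, 0 ≤ V ω := fun ω => mul_nonneg (Real.exp_pos _).le (Real.exp_pos _).le
    have hVU : ∀ ω, V ω ≤ U ω := fun ω => mul_le_of_le_one_right (Real.exp_pos _).le (hE1 ω)
    have hVb : ∀ᵐ ω ∂μ, |V ω| ≤ Real.exp n := by
      filter_upwards [ih2] with ω hω
      rw [abs_of_nonneg (hV0 ω)]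
      exact (hVU ω).trans ((le_abs_self _).trans hω)
    have hVint : Integrable V μ :=
      integrable_of_ae_abs_le (hVm.mono (h.le n)).aestronglyMeasurable hVb
    have hprodm : StronglyMeasurable[m (n + 1)] fun ω => V ω * Real.exp (l * w n ω * ξ n ω) :=
      (hVm.mono (h.mono n.le_succ)).mul hwξ
    have hprodb : ∀ᵐ ω ∂μ, |V ω * Real.exp (l * w n ω * ξ n ω)| ≤ Real.exp (n + 1 : ℕ) := by
      filter_upwards [hVb, hx n] with ω h1 h2
      rw [abs_mul, Real.abs_exp, Nat.cast_succ, Real.exp_add]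
      gcongr
      exact (le_abs_self _).trans h2
    refine ⟨hprodm, hprodb, ?_⟩
    have hξsm : AEStronglyMeasurable (ξ n) μ := ((h.meas n).mono (h.le _)).aestronglyMeasurable
    have hwsm : AEStronglyMeasurable (w n) μ := (hwm.mono (h.le _)).aestronglyMeasurable
    have hVsm : AEStronglyMeasurable V μ := (hVm.mono (h.le _)).aestronglyMeasurable
    have hξint : Integrable (ξ n) μ := integrable_of_ae_abs_le hξsm (h.bound n)
    have hξ2int : Integrable (fun ω => ξ n ω ^ 2) μ := by
      refine integrable_of_ae_abs_le (B := B ^ 2) (hξsm.pow 2) ?_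
      filter_upwards [h.bound n] with ω hω
      rw [abs_pow]
      gcongr
    have hi1 : Integrable ((fun ω => V ω * (l * w n ω)) * ξ n) μ := by
      refine integrable_of_ae_abs_le (B := Real.exp n)
        ((hVsm.mul (aestronglyMeasurable_const.mul hwsm)).mul hξsm) ?_
      filter_upwards [hVb, hx n] with ω h1 h2
      simp only [Pi.mul_apply]
      rw [mul_assoc, abs_mul]
      nlinarith [abs_nonneg (V ω), abs_nonneg (l * w n ω * ξ n ω)]
    have hi2 : Integrable ((fun ω => V ω * (l * w n ω) ^ 2) * fun ω => ξ n ω ^ 2) μ := by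
      refine integrable_of_ae_abs_le (B := Real.exp n)
        ((hVsm.mul ((aestronglyMeasurable_const.mul hwsm).pow 2)).mul (hξsm.pow 2)) ?_
      filter_upwards [hVb, hx n] with ω h1 h2
      simp only [Pi.mul_apply]
      rw [mul_assoc, ← mul_pow, abs_mul, abs_pow]
      have h3 : |l * w n ω * ξ n ω| ^ 2 ≤ 1 := pow_le_one₀ (abs_nonneg _) h2
      nlinarith [abs_nonneg (V ω), sq_nonneg (|l * w n ω * ξ n ω|)]
    have hi3 : Integrable (fun ω => V ω * (l * w n ω) ^ 2) μ := by
      refine integrable_of_ae_abs_le (B := Real.exp n * (|l| * b) ^ 2)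
        (hVsm.mul ((aestronglyMeasurable_const.mul hwsm).pow 2)) ?_
      filter_upwards [hVb] with ω h1
      rw [abs_mul, abs_pow, abs_mul l]
      gcongr
      exact hwb n ω
    have hm1 : StronglyMeasurable[m n] fun ω => V ω * (l * w n ω) :=
      hVm.mul (stronglyMeasurable_const.mul hwm)
    have hm2 : StronglyMeasurable[m n] fun ω => V ω * (l * w n ω) ^ 2 :=
      hVm.mul ((stronglyMeasurable_const.mul hwm).pow 2)
    have e1 : ∫ ω, V ω * (l * w n ω) * ξ n ω ∂μ = 0 := by
      rw [integral_mul_condExp_of_stronglyMeasurable (h.le n) hm1 hi1 hξint]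
      refine (integral_congr_ae ?_).trans (integral_zero _ _)
      filter_upwards [h.condExp_eq n] with ω hω
      rw [hω]
      simp
    have e2 : ∫ ω, V ω * (l * w n ω) ^ 2 * ξ n ω ^ 2 ∂μ ≤ ∫ ω, V ω * (l * w n ω) ^ 2 * C ∂μ := by
      rw [integral_mul_condExp_of_stronglyMeasurable (h.le n) hm2 hi2 hξ2int]
      refine integral_mono_of_nonneg ?_ (hi3.mul_const C) ?_
      · filter_upwards [condExp_nonneg (μ := μ) (m := m n)
          (Eventually.of_forall fun ω => sq_nonneg (ξ n ω))] with ω hω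
        exact mul_nonneg (mul_nonneg (hV0 ω) (sq_nonneg _)) hω
      · filter_upwards [h.condExp_sq_le n] with ω hω
        exact mul_le_mul_of_nonneg_left hω (mul_nonneg (hV0 ω) (sq_nonneg _))
    calc ∫ ω, V ω * Real.exp (l * w n ω * ξ n ω) ∂μ
        ≤ ∫ ω, V ω + V ω * (l * w n ω) * ξ n ω + V ω * (l * w n ω) ^ 2 * ξ n ω ^ 2 ∂μ := by
          refine integral_mono_ae (integrable_of_ae_abs_le
            (hprodm.mono (h.le _)).aestronglyMeasurable hprodb) ((hVint.add hi1).add hi2) ?_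
          filter_upwards [hx n] with ω hω
          refine (mul_le_mul_of_nonneg_left (exp_le_one_add_add_sq hω) (hV0 ω)).trans_eq ?_
          ring
      _ = ∫ ω, V ω ∂μ + ∫ ω, V ω * (l * w n ω) * ξ n ω ∂μ
            + ∫ ω, V ω * (l * w n ω) ^ 2 * ξ n ω ^ 2 ∂μ := by
          refine (integral_add (hVint.add hi1) hi2).trans ?_
          exact congrArg (· + _) (integral_add hVint hi1)
      _ ≤ ∫ ω, V ω ∂μ + ∫ ω, V ω * (l * w n ω) ^ 2 * C ∂μ := by
          rw [e1, add_zero]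
          exact add_le_add_right e2 _
      _ = ∫ ω, V ω + V ω * (l * w n ω) ^ 2 * C ∂μ := (integral_add hVint (hi3.mul_const C)).symm
      _ ≤ ∫ ω, U ω ∂μ := by
          refine integral_mono (hVint.add (hi3.mul_const C)) hUint fun ω => ?_
          have h1 : U ω = V ω * Real.exp (l ^ 2 * C * w n ω ^ 2) := by
            rw [hV, mul_assoc, ← Real.exp_add, neg_add_cancel, Real.exp_zero, mul_one]
          have h2 := Real.add_one_le_exp (l ^ 2 * C * w n ω ^ 2)
          rw [h1]
          nlinarith [hV0 ω]
      _ ≤ 1 := ih3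

/-- Markov's inequality for the supermartingale. Since the compensator is random, the bound on the
sum of squared weights may be part of the event instead of an assumption. -/
theorem IsBoundedMDS.measure_lt_sum_le {m : ℕ → MeasurableSpace Ω} {ξ w : ℕ → Ω → ℝ}
    {B C b l : ℝ} (h : IsBoundedMDS μ m ξ B C) (hC : 0 ≤ C)
    (hw : ∀ i, StronglyMeasurable[m i] (w i)) (hwb : ∀ i ω, |w i ω| ≤ b)
    (hl : |l| * b * B ≤ 1) (n : ℕ) (t v : ℝ) :
    μ {ω | t ≤ ∑ i ∈ Finset.range n, l * w i ω * ξ i ω ∧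
        ∑ i ∈ Finset.range n, w i ω ^ 2 ≤ v} ≤
      ENNReal.ofReal (Real.exp (l ^ 2 * C * v - t)) := by
  obtain ⟨h1, h2, h3⟩ := h.integral_exp_le_one hC hw hwb hl n
  have hint := integrable_of_ae_abs_le (h1.mono (h.le n)).aestronglyMeasurable h2
  have hM := mul_meas_ge_le_integral_of_nonneg (Eventually.of_forall fun ω => (Real.exp_pos _).le)
    hint (Real.exp (t - l ^ 2 * C * v))
  have hsub : {ω | t ≤ ∑ i ∈ Finset.range n, l * w i ω * ξ i ω ∧
        ∑ i ∈ Finset.range n, w i ω ^ 2 ≤ v} ⊆ {ω | Real.exp (t - l ^ 2 * C * v) ≤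
        Real.exp (∑ i ∈ Finset.range n, (l * w i ω * ξ i ω - l ^ 2 * C * w i ω ^ 2))} := by
    rintro ω ⟨ha, hb⟩
    simp only [Set.mem_ofPred_eq, Real.exp_le_exp]
    rw [Finset.sum_sub_distrib, ← Finset.mul_sum]
    have : l ^ 2 * C * ∑ i ∈ Finset.range n, w i ω ^ 2 ≤ l ^ 2 * C * v := by gcongr
    linarith
  refine (measure_mono hsub).trans ?_
  rw [← ofReal_measureReal]
  refine ENNReal.ofReal_le_ofReal ?_
  have hp := Real.exp_pos (t - l ^ 2 * C * v)
  have e : Real.exp (l ^ 2 * C * v - t) = (Real.exp (t - l ^ 2 * C * v))⁻¹ := by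
    rw [← Real.exp_neg]; congr 1; ring
  rw [e, ← one_div, le_div_iff₀ hp, mul_comm]
  exact hM.trans h3

theorem IsBoundedMDS.measure_lt_abs_sum_le {m : ℕ → MeasurableSpace Ω} {ξ w : ℕ → Ω → ℝ}
    {B C b l : ℝ} (h : IsBoundedMDS μ m ξ B C) (hC : 0 ≤ C)
    (hw : ∀ i, StronglyMeasurable[m i] (w i)) (hwb : ∀ i ω, |w i ω| ≤ b)
    (hl0 : 0 ≤ l) (hl : l * b * B ≤ 1) (n : ℕ) (t v : ℝ) :
    μ {ω | t < |∑ i ∈ Finset.range n, w i ω * ξ i ω| ∧ ∑ i ∈ Finset.range n, w i ω ^ 2 ≤ v} ≤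
      2 * ENNReal.ofReal (Real.exp (l ^ 2 * C * v - l * t)) := by
  have h1 := h.measure_lt_sum_le hC hw hwb (l := l) (by rwa [abs_of_nonneg hl0]) n (l * t) v
  have h2 := h.measure_lt_sum_le hC hw hwb (l := -l)
    (by rwa [abs_neg, abs_of_nonneg hl0]) n (l * t) v
  rw [neg_sq] at h2
  rw [two_mul]
  refine (measure_mono ?_).trans ((measure_union_le _ _).trans (add_le_add h1 h2))
  rintro ω ⟨ha, hb⟩
  rcases lt_abs.1 ha with h3 | h3
  · refine Or.inl ⟨?_, hb⟩
    simp only [mul_assoc]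
    rw [← Finset.mul_sum]
    gcongr
  · refine Or.inr ⟨?_, hb⟩
    simp only [mul_assoc]
    rw [← Finset.mul_sum, neg_mul, ← mul_neg]
    gcongr

/-- Square integrable martingale differences with bounded conditional variance. -/
structure IsMDS (μ : Measure Ω) (m : ℕ → MeasurableSpace Ω) (e : ℕ → Ω → ℝ) (C : ℝ) : Prop where
  le : ∀ i, m i ≤ mΩ
  mono : Monotone m
  meas : ∀ i, StronglyMeasurable[m (i + 1)] (e i)
  memLp : ∀ i, MemLp (e i) 2 μ
  condExp_eq : ∀ i, μ[e i | m i] =ᵐ[μ] 0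
  condExp_sq_le : ∀ i, ∀ᵐ ω ∂μ, (μ[fun ω => e i ω ^ 2 | m i]) ω ≤ C

theorem IsMDS.integrable {m : ℕ → MeasurableSpace Ω} {e : ℕ → Ω → ℝ} {C : ℝ}
    (h : IsMDS μ m e C) (i : ℕ) : Integrable (e i) μ :=
  (h.memLp i).integrable (by norm_num)

/-! ### Truncation -/

/-- `f` where `|f| ≤ M`, and zero elsewhere. -/
noncomputable def trunc (f : Ω → ℝ) (M : ℝ) (ω : Ω) : ℝ := if |f ω| ≤ M then f ω else 0

theorem abs_trunc_le {f : Ω → ℝ} {M : ℝ} (hM : 0 ≤ M) (ω : Ω) : |trunc f M ω| ≤ M := by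
  unfold trunc
  split_ifs with h
  · exact h
  · simpa using hM

theorem trunc_sq_le {f : Ω → ℝ} {M : ℝ} (ω : Ω) : trunc f M ω ^ 2 ≤ f ω ^ 2 := by
  unfold trunc
  split_ifs with h
  · exact le_rfl
  · simpa using sq_nonneg (f ω)

theorem stronglyMeasurable_trunc {m : MeasurableSpace Ω} {f : Ω → ℝ}
    (hf : StronglyMeasurable[m] f) (M : ℝ) : StronglyMeasurable[m] (trunc f M) := by
  refine StronglyMeasurable.ite ?_ hf stronglyMeasurable_const
  exact hf.norm.measurableSet_le stronglyMeasurable_const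

/-- Only |f| > M contributes, and there |f|^(-(1+δ)) ≤ M^(-(1+δ)). -/
theorem abs_sub_trunc_le {f : Ω → ℝ} {M δ : ℝ} (hM : 0 < M) (hδ : 0 < δ) (ω : Ω) :
    |f ω - trunc f M ω| ≤ M ^ (-(1 + δ)) * |f ω| ^ (2 + δ) := by
  unfold trunc
  split_ifs with h
  · rw [sub_self, abs_zero]
    positivity
  · push Not at h
    have h0 : 0 < |f ω| := hM.trans h
    rw [sub_zero]
    have h1 : |f ω| ^ (-(1 + δ)) ≤ M ^ (-(1 + δ)) :=
      Real.rpow_le_rpow_of_nonpos hM h.le (by linarith)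
    calc |f ω| = |f ω| ^ (-(1 + δ)) * |f ω| ^ (2 + δ) := by
          rw [← Real.rpow_add h0]
          ring_nf
          rw [Real.rpow_one]
      _ ≤ _ := by gcongr

/-- The centered truncation. -/
noncomputable def ctrunc (μ : Measure Ω) (m : MeasurableSpace Ω) (f : Ω → ℝ) (M : ℝ) (ω : Ω) : ℝ :=
  trunc f M ω - (μ[trunc f M | m]) ω

/-- Recentring restores the martingale property at the price of doubling the bound; the variance
bound C persists, since a conditional variance is at most the conditional second moment and
truncation decreases squares. -/
theorem IsMDS.isBoundedMDS_ctrunc {m : ℕ → MeasurableSpace Ω} {e : ℕ → Ω → ℝ} {C M : ℝ}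
    (h : IsMDS μ m e C) (hM : 0 ≤ M) :
    IsBoundedMDS μ m (fun i => ctrunc μ (m i) (e i) M) (2 * M) C := by
  have hint : ∀ i, Integrable (trunc (e i) M) μ := fun i =>
    integrable_of_ae_abs_le (B := M)
      ((stronglyMeasurable_trunc (h.meas i) M).mono (h.le _)).aestronglyMeasurable
      (Eventually.of_forall fun ω => abs_trunc_le hM ω)
  have hint2 : ∀ i, Integrable (fun ω => trunc (e i) M ω ^ 2) μ := fun i =>
    integrable_of_ae_abs_le (B := M ^ 2)
      (((stronglyMeasurable_trunc (h.meas i) M).pow 2).mono (h.le _)).aestronglyMeasurable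
      (Eventually.of_forall fun ω => by
        rw [abs_pow]
        have := abs_trunc_le (f := e i) hM ω
        gcongr)
  refine ⟨h.le, h.mono, fun i => ?_, fun i => ?_, fun i => ?_, fun i => ?_⟩
  · exact (stronglyMeasurable_trunc (h.meas i) M).sub
      (stronglyMeasurable_condExp.mono (h.mono i.le_succ))
  · have hb := ae_bdd_abs_condExp_of_ae_bdd_abs (m := m i) (R := M) (f := trunc (e i) M)
      (μ := μ) (Eventually.of_forall fun ω => abs_trunc_le hM ω)
    filter_upwards [hb] with ω hω
    have h1 := abs_trunc_le (f := e i) hM ω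
    have h2 : |(μ[trunc (e i) M | m i]) ω| ≤ M := hω
    unfold ctrunc
    linarith [abs_sub (trunc (e i) M ω) ((μ[trunc (e i) M | m i]) ω)]
  · have h1 := condExp_sub (hint i) (integrable_condExp (f := trunc (e i) M) (m := m i)) (m i)
    have h2 := condExp_of_stronglyMeasurable (h.le i)
      (stronglyMeasurable_condExp (f := trunc (e i) M) (m := m i) (μ := μ)) integrable_condExp
    filter_upwards [h1] with ω hω
    refine hω.trans ?_
    simp only [Pi.sub_apply, h2, sub_self, Pi.zero_apply]
  · have hL : MemLp (trunc (e i) M) 2 μ := (memLp_two_iff_integrable_sq (hint i).1).2 (hint2 i)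
    have h1 := condVar_ae_le_condExp_sq (h.le i) hL
    have h2 : μ[fun ω => trunc (e i) M ω ^ 2 | m i] ≤ᵐ[μ] μ[fun ω => e i ω ^ 2 | m i] :=
      condExp_mono (hint2 i) (h.memLp i).integrable_sq
        (Eventually.of_forall fun ω => trunc_sq_le ω)
    filter_upwards [h1, h2, h.condExp_sq_le i] with ω a1 a2 a3
    exact a1.trans (a2.trans a3)

/-- As e has conditional mean zero, the discarded part is the tail e - trunc e minus its own
conditional mean; conditional expectation contracts L¹, hence the factor 2. -/
theorem IsMDS.integral_abs_sub_ctrunc_le {m : ℕ → MeasurableSpace Ω} {e : ℕ → Ω → ℝ} {C M δ : ℝ}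
    (h : IsMDS μ m e C) (hM : 0 < M) (hδ : 0 < δ) (i : ℕ)
    (hmom : Integrable (fun ω => |e i ω| ^ (2 + δ)) μ) :
    Integrable (fun ω => |e i ω - ctrunc μ (m i) (e i) M ω|) μ ∧
    ∫ ω, |e i ω - ctrunc μ (m i) (e i) M ω| ∂μ ≤
      2 * (M ^ (-(1 + δ)) * ∫ ω, |e i ω| ^ (2 + δ) ∂μ) := by
  have hint : Integrable (trunc (e i) M) μ :=
    integrable_of_ae_abs_le (B := M)
      ((stronglyMeasurable_trunc (h.meas i) M).mono (h.le _)).aestronglyMeasurable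
      (Eventually.of_forall fun ω => abs_trunc_le hM.le ω)
  have hr : Integrable (fun ω => e i ω - trunc (e i) M ω) μ := (h.integrable i).sub hint
  have hc : Integrable (μ[fun ω => e i ω - trunc (e i) M ω | m i]) μ := integrable_condExp
  have heq : (fun ω => |e i ω - ctrunc μ (m i) (e i) M ω|) =ᵐ[μ] fun ω =>
      |(e i ω - trunc (e i) M ω) - (μ[fun ω => e i ω - trunc (e i) M ω | m i]) ω| := by
    filter_upwards [condExp_sub (h.integrable i) hint (m i), h.condExp_eq i] with ω h1 h2
    have h3 : (μ[fun ω => e i ω - trunc (e i) M ω | m i]) ω = - (μ[trunc (e i) M | m i]) ω := by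
      refine h1.trans ?_
      rw [Pi.sub_apply, h2]
      simp
    rw [h3, ctrunc]
    congr 1
    ring
  refine ⟨(hr.sub hc).abs.congr heq.symm, ?_⟩
  rw [integral_congr_ae heq]
  have h1 : ∫ ω, |e i ω - trunc (e i) M ω| ∂μ ≤ M ^ (-(1 + δ)) * ∫ ω, |e i ω| ^ (2 + δ) ∂μ := by
    rw [← integral_const_mul]
    exact integral_mono hr.abs (hmom.const_mul _) fun ω => abs_sub_trunc_le hM hδ ω
  have h2 : ∫ ω, |(μ[fun ω => e i ω - trunc (e i) M ω | m i]) ω| ∂μ ≤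
      ∫ ω, |e i ω - trunc (e i) M ω| ∂μ := integral_abs_condExp_le _
  calc _ ≤ ∫ ω, |e i ω - trunc (e i) M ω| + |(μ[fun ω => e i ω - trunc (e i) M ω | m i]) ω| ∂μ :=
        integral_mono (hr.sub hc).abs (hr.abs.add hc.abs) fun ω => abs_sub _ _
    _ = _ := integral_add hr.abs hc.abs
    _ ≤ _ := by linarith

/-! ### Second moments -/

/-- Orthogonality of martingale increments: the cross term vanishes because w and the partial sum
are known before the new error. -/
theorem IsMDS.integral_sum_sq_le {m : ℕ → MeasurableSpace Ω} {e w : ℕ → Ω → ℝ} {C b : ℝ}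
    (h : IsMDS μ m e C) (hw : ∀ i, StronglyMeasurable[m i] (w i)) (hwb : ∀ i ω, |w i ω| ≤ b)
    (n : ℕ) :
    StronglyMeasurable[m n] (fun ω => ∑ i ∈ Finset.range n, w i ω * e i ω) ∧
    MemLp (fun ω => ∑ i ∈ Finset.range n, w i ω * e i ω) 2 μ ∧
    ∫ ω, (∑ i ∈ Finset.range n, w i ω * e i ω) ^ 2 ∂μ ≤
      C * ∑ i ∈ Finset.range n, ∫ ω, w i ω ^ 2 ∂μ := by
  induction n with
  | zero =>
    refine ⟨?_, ?_, by simp⟩ <;> simp only [Finset.range_zero, Finset.sum_empty]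
    · exact stronglyMeasurable_const
    · exact memLp_const 0
  | succ n ih =>
    obtain ⟨ih1, ih2, ih3⟩ := ih
    simp only [Finset.sum_range_succ]
    set U : Ω → ℝ := fun ω => ∑ i ∈ Finset.range n, w i ω * e i ω with hU
    have hwm := hw n
    have hwsm : AEStronglyMeasurable (w n) μ := (hwm.mono (h.le _)).aestronglyMeasurable
    have hwe : MemLp (fun ω => w n ω * e n ω) 2 μ := by
      refine (h.memLp n).of_le_mul (c := b) (hwsm.mul (h.memLp n).1) (Eventually.of_forall fun ω => ?_)
      rw [norm_mul]
      gcongr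
      exact hwb n ω
    have hwU : MemLp (fun ω => w n ω * U ω) 2 μ := by
      refine ih2.of_le_mul (c := b) (hwsm.mul ih2.1) (Eventually.of_forall fun ω => ?_)
      rw [norm_mul]
      gcongr
      exact hwb n ω
    have hw2 : Integrable (fun ω => w n ω ^ 2) μ := by
      refine integrable_of_ae_abs_le (B := b ^ 2) (hwsm.pow 2) (Eventually.of_forall fun ω => ?_)
      rw [abs_pow]
      have := hwb n ω
      gcongr
    refine ⟨((ih1.mono (h.mono n.le_succ)).add
      ((hwm.mono (h.mono n.le_succ)).mul (h.meas n))), ih2.add hwe, ?_⟩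
    have hi1 : Integrable ((fun ω => w n ω * U ω) * e n) μ := hwU.integrable_mul (h.memLp n)
    have hi2 : Integrable ((fun ω => w n ω ^ 2) * fun ω => e n ω ^ 2) μ := by
      refine hwe.integrable_sq.congr (Eventually.of_forall fun ω => ?_)
      simp only [Pi.mul_apply]
      ring
    have hm1 : StronglyMeasurable[m n] fun ω => w n ω * U ω := hwm.mul ih1
    have hm2 : StronglyMeasurable[m n] fun ω => w n ω ^ 2 := hwm.pow 2
    have e1 : ∫ ω, w n ω * U ω * e n ω ∂μ = 0 := by
      rw [integral_mul_condExp_of_stronglyMeasurable (h.le n) hm1 hi1 (h.integrable n)]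
      refine (integral_congr_ae ?_).trans (integral_zero _ _)
      filter_upwards [h.condExp_eq n] with ω hω
      rw [hω]
      simp
    have e2 : ∫ ω, w n ω ^ 2 * e n ω ^ 2 ∂μ ≤ C * ∫ ω, w n ω ^ 2 ∂μ := by
      rw [integral_mul_condExp_of_stronglyMeasurable (h.le n) hm2 hi2 (h.memLp n).integrable_sq, mul_comm,
        ← integral_mul_const]
      refine integral_mono_of_nonneg ?_ (hw2.mul_const C) ?_
      · filter_upwards [condExp_nonneg (μ := μ) (m := m n)
          (Eventually.of_forall fun ω => sq_nonneg (e n ω))] with ω hω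
        exact mul_nonneg (sq_nonneg _) hω
      · filter_upwards [h.condExp_sq_le n] with ω hω
        exact mul_le_mul_of_nonneg_left hω (sq_nonneg _)
    calc ∫ ω, (U ω + w n ω * e n ω) ^ 2 ∂μ
        = ∫ ω, U ω ^ 2 + 2 * (w n ω * U ω * e n ω) + w n ω ^ 2 * e n ω ^ 2 ∂μ := by
          congr 1
          ext ω
          ring
      _ = ∫ ω, U ω ^ 2 ∂μ + 2 * ∫ ω, w n ω * U ω * e n ω ∂μ + ∫ ω, w n ω ^ 2 * e n ω ^ 2 ∂μ := by
          refine (integral_add (ih2.integrable_sq.add (hi1.const_mul 2)) hi2).trans ?_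
          refine congrArg (· + _) ((integral_add ih2.integrable_sq (hi1.const_mul 2)).trans ?_)
          exact congrArg (_ + ·) (integral_const_mul _ _)
      _ ≤ _ := by
          rw [e1, mul_zero, add_zero, mul_add]
          exact add_le_add ih3 e2

end Martingale

/-! ### The unit cube -/

theorem isClosed_unitCube (d : ℕ) : IsClosed (unitCube d) := by
  have : unitCube d = ⋂ i, {y : Pt d | y i ∈ Set.Icc (0 : ℝ) 1} := by
    ext y; simp [unitCube]
  rw [this]
  refine isClosed_iInter fun i => isClosed_Icc.preimage ?_
  fun_prop

theorem measurableSet_unitCube (d : ℕ) : MeasurableSet (unitCube d) :=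
  (isClosed_unitCube d).measurableSet

theorem convex_unitCube (d : ℕ) : Convex ℝ (unitCube d) := by
  intro x hx y hy a b ha hb hab i
  exact convex_Icc (0 : ℝ) 1 (hx i) (hy i) ha hb hab

theorem uniqueDiffOn_unitCube (d : ℕ) : UniqueDiffOn ℝ (unitCube d) := by
  refine uniqueDiffOn_convex (convex_unitCube d) ?_
  have hopen : IsOpen (⋂ i, {y : Pt d | y i ∈ Set.Ioo (0 : ℝ) 1}) := by
    refine isOpen_iInter_of_finite fun i => isOpen_Ioo.preimage ?_
    fun_prop
  have hsub : (⋂ i, {y : Pt d | y i ∈ Set.Ioo (0 : ℝ) 1}) ⊆ unitCube d := fun y hy i =>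
    Set.Ioo_subset_Icc_self (Set.mem_iInter.1 hy i)
  refine ⟨WithLp.toLp 2 fun _ => 1 / 2, interior_maximal hsub hopen (Set.mem_iInter.2 fun i => ?_)⟩
  simp only [Set.mem_ofPred_eq, Set.mem_Ioo]
  norm_num

/-- For γ ≤ 1 the controlled derivative has order zero, so this is the Hölder condition on f. For γ
> 1 the first derivative is bounded, and the mean value inequality on the convex cube gives a
Lipschitz bound. -/
theorem IsHolderWith.abs_sub_le {d : ℕ} {γ M : ℝ} {f : Pt d → ℝ} (h : IsHolderWith γ M f)
    {y z : Pt d} (hy : y ∈ unitCube d) (hz : z ∈ unitCube d) :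
    |f y - f z| ≤ M * ‖y - z‖ ^ min γ 1 := by
  rcases le_or_gt γ 1 with h1 | h1
  · have hk : ⌈γ⌉₊ - 1 = 0 := by
      have : ⌈γ⌉₊ ≤ 1 := Nat.ceil_le.2 (by simpa using h1)
      omega
    have h2 := h.holder y hy z hz
    rw [hk, iteratedFDerivWithin_zero_eq_comp, Function.comp_apply, Function.comp_apply,
      ← map_sub, LinearIsometryEquiv.norm_map] at h2
    rw [min_eq_left h1]
    simpa using h2
  · rw [min_eq_right h1.le, Real.rpow_one]
    have hk : 1 ≤ ⌈γ⌉₊ - 1 := by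
      have : 1 < ⌈γ⌉₊ := Nat.lt_ceil.2 (by simpa using h1)
      omega
    refine (convex_unitCube d).norm_image_sub_le_of_norm_fderivWithin_le (𝕜 := ℝ)
      (h.contDiffOn.differentiableOn ?_) (fun x hx => ?_) hz hy
    · have : (⌈γ⌉₊ - 1 : ℕ) ≠ 0 := by omega
      exact_mod_cast this
    · rw [← norm_iteratedFDerivWithin_one f (uniqueDiffOn_unitCube d x hx)]
      exact h.bound 1 hk x hx

theorem IsHolderWith.continuousOn {d : ℕ} {γ M : ℝ} {f : Pt d → ℝ} (h : IsHolderWith γ M f) :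
    ContinuousOn f (unitCube d) := h.contDiffOn.continuousOn

/-- The point of the grid of mesh `1 / N` with integer coordinates `k`. -/
noncomputable def gridPt {d : ℕ} (N : ℕ) (k : Fin d → Fin (N + 1)) : Pt d :=
  WithLp.toLp 2 fun i => (k i : ℝ) / N

theorem gridPt_mem {d N : ℕ} (k : Fin d → Fin (N + 1)) : gridPt N k ∈ unitCube d := fun i => by
  refine ⟨by simp only [gridPt]; positivity, ?_⟩
  refine div_le_one_of_le₀ ?_ N.cast_nonneg
  exact_mod_cast Nat.lt_succ_iff.1 (k i).2

theorem exists_gridPt_near {d N : ℕ} (hN : 0 < N) {y : Pt d} (hy : y ∈ unitCube d) :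
    ∃ k : Fin d → Fin (N + 1), ‖y - gridPt N k‖ ≤ √d / N := by
  have hN' : (0 : ℝ) < N := Nat.cast_pos.2 hN
  -- The coordinate y i = 1 has floor N, which is why the grid has N + 1 values per axis.
  have hf : ∀ i, ⌊y i * N⌋₊ < N + 1 := fun i => by
    rw [Nat.lt_succ_iff]
    refine Nat.floor_le_of_le ?_
    nlinarith [(hy i).2]
  refine ⟨fun i => ⟨⌊y i * N⌋₊, hf i⟩, ?_⟩
  rw [EuclideanSpace.norm_eq]
  have hle : ∑ i, ‖(y - gridPt N fun i => ⟨⌊y i * N⌋₊, hf i⟩) i‖ ^ 2 ≤ d * (1 / N : ℝ) ^ 2 := by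
    have : ∀ i ∈ Finset.univ, ‖(y - gridPt N fun i => ⟨⌊y i * N⌋₊, hf i⟩) i‖ ^ 2
        ≤ (1 / N : ℝ) ^ 2 := fun i _ => by
      refine pow_le_pow_left₀ (norm_nonneg _) ?_ 2
      have h1 := Nat.floor_le (mul_nonneg (hy i).1 hN'.le)
      have h2 := Nat.lt_floor_add_one (y i * N)
      have h3 : (y - gridPt N fun i => ⟨⌊y i * N⌋₊, hf i⟩) i = y i - (⌊y i * N⌋₊ : ℝ) / N := rfl
      rw [h3, Real.norm_eq_abs, abs_le]
      constructor
      · rw [neg_le_sub_iff_le_add, div_le_iff₀ hN', add_mul, one_div, inv_mul_cancel₀ hN'.ne']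
        linarith
      · rw [sub_le_iff_le_add, ← add_div, le_div_iff₀ hN']
        linarith
    simpa using Finset.sum_le_sum this
  refine (Real.sqrt_le_sqrt hle).trans_eq ?_
  rw [Real.sqrt_mul d.cast_nonneg, Real.sqrt_sq (by positivity)]
  ring

/-- Basis functions are arbitrary off the cube; replacing them by zero there gives a measurable
function and changes nothing almost surely. -/
theorem aestronglyMeasurable_comp_of_continuousOn {Ω : Type*} {mΩ : MeasurableSpace Ω}
    {μ : Measure Ω} {d : ℕ} {X : Ω → Pt d} {f : Pt d → ℝ} (hX : Measurable X)
    (hXc : ∀ᵐ ω ∂μ, X ω ∈ unitCube d) (hf : ContinuousOn f (unitCube d)) :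
    AEStronglyMeasurable (fun ω => f (X ω)) μ := by
  classical
  have hm : Measurable ((unitCube d).piecewise f 0) :=
    hf.measurable_piecewise continuousOn_const (measurableSet_unitCube d)
  refine ((hm.comp hX).aestronglyMeasurable).congr ?_
  filter_upwards [hXc] with ω hω
  exact Set.piecewise_eq_of_mem _ _ _ hω

/-! ### Orthonormalized bases -/

/-- The properties of a basis of fixed dimension that are used below. -/
structure IsGoodBasis {Ω : Type*} [MeasurableSpace Ω] {d K : ℕ} (μ : Measure Ω)
    (b : Fin K → Pt d → ℝ) (X : Ω → Pt d) (l c : ℝ) : Prop where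
  meas : Measurable X
  mem : ∀ᵐ ω ∂μ, X ω ∈ unitCube d
  cont : ∀ k, ContinuousOn (b k) (unitCube d)
  pos : 0 < l
  le_lambdaMin : l ≤ lambdaMin (gram μ b X)
  bound : ∀ x ∈ unitCube d, euc (fun k => b k x) ≤ c

section Basis

variable {Ω : Type*} [MeasurableSpace Ω] {d K : ℕ} {μ : Measure Ω}
  {b : Fin K → Pt d → ℝ} {X : Ω → Pt d} {l c : ℝ}

theorem gram_isHermitian : (gram μ b X).IsHermitian := by
  rw [Matrix.IsHermitian, Matrix.conjTranspose_eq_transpose_of_trivial]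
  ext i j
  simp only [gram, Matrix.transpose_apply, Matrix.of_apply, mul_comm]

theorem IsGoodBasis.isInvSqrt (h : IsGoodBasis μ b X l c) :
    IsInvSqrt (gram μ b X) (invSqrt (gram μ b X)) :=
  isInvSqrt_invSqrt (posDef_of_lambdaMin_pos gram_isHermitian (h.pos.trans_le h.le_lambdaMin))

theorem IsGoodBasis.euc_invSqrt_mulVec_le (h : IsGoodBasis μ b X l c) (v : Fin K → ℝ) :
    euc (invSqrt (gram μ b X) *ᵥ v) ≤ √l⁻¹ * euc v := by
  refine h.isInvSqrt.euc_mulVec_le h.pos (fun x => ?_) v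
  refine le_trans ?_ (lambdaMin_mul_le gram_isHermitian x)
  refine mul_le_mul_of_nonneg_right h.le_lambdaMin ?_
  rw [← euc_sq]
  positivity

theorem IsGoodBasis.euc_orthonormalized_le (h : IsGoodBasis μ b X l c) {x : Pt d}
    (hx : x ∈ unitCube d) : euc (fun k => orthonormalized μ b X k x) ≤ √l⁻¹ * c :=
  (h.euc_invSqrt_mulVec_le _).trans (mul_le_mul_of_nonneg_left (h.bound x hx) (Real.sqrt_nonneg _))

theorem continuousOn_orthonormalized (hb : ∀ k, ContinuousOn (b k) (unitCube d)) (k : Fin K) :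
    ContinuousOn (orthonormalized μ b X k) (unitCube d) := by
  unfold orthonormalized Matrix.mulVec dotProduct
  exact continuousOn_finsetSum _ fun i _ => continuousOn_const.mul (hb i)

theorem abs_le_euc (v : Fin K → ℝ) (k : Fin K) : |v k| ≤ euc v := by
  have := PiLp.norm_apply_le (WithLp.toLp 2 v) k
  simpa [euc] using this

theorem IsGoodBasis.integrable_mul [IsProbabilityMeasure μ] {d' K' : ℕ}
    {b' : Fin K' → Pt d' → ℝ} {X' : Ω → Pt d'} {l' c' : ℝ} (h : IsGoodBasis μ b X l c) (h' : IsGoodBasis μ b' X' l' c') (k : Fin K)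
    (k' : Fin K') : Integrable (fun ω => b k (X ω) * b' k' (X' ω)) μ := by
  refine integrable_of_ae_abs_le (B := c * c')
    ((aestronglyMeasurable_comp_of_continuousOn h.meas h.mem (h.cont k)).mul
      (aestronglyMeasurable_comp_of_continuousOn h'.meas h'.mem (h'.cont k'))) ?_
  filter_upwards [h.mem, h'.mem] with ω h1 h2
  rw [abs_mul]
  have a1 := (abs_le_euc (fun k => b k (X ω)) k).trans (h.bound _ h1)
  have a2 := (abs_le_euc (fun k => b' k (X' ω)) k').trans (h'.bound _ h2)
  have := (abs_nonneg _).trans a1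
  gcongr

theorem IsGoodBasis.integrable_mul_orthonormalized [IsProbabilityMeasure μ] {d' K' : ℕ} {b' : Fin K' → Pt d' → ℝ}
    {X' : Ω → Pt d'} {l' c' : ℝ} (h : IsGoodBasis μ b X l c) (h' : IsGoodBasis μ b' X' l' c')
    (k : Fin K) (k' : Fin K') :
    Integrable (fun ω => orthonormalized μ b X k (X ω) * orthonormalized μ b' X' k' (X' ω)) μ := by
  refine integrable_of_ae_abs_le (B := (√l⁻¹ * c) * (√l'⁻¹ * c'))
    ((aestronglyMeasurable_comp_of_continuousOn h.meas h.mem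
      (continuousOn_orthonormalized h.cont k)).mul
      (aestronglyMeasurable_comp_of_continuousOn h'.meas h'.mem
        (continuousOn_orthonormalized h'.cont k'))) ?_
  filter_upwards [h.mem, h'.mem] with ω h1 h2
  rw [abs_mul]
  have a1 := (abs_le_euc (fun k => orthonormalized μ b X k (X ω)) k).trans
    (h.euc_orthonormalized_le h1)
  have a2 := (abs_le_euc (fun k => orthonormalized μ b' X' k (X' ω)) k').trans
    (h'.euc_orthonormalized_le h2)
  have := (abs_nonneg _).trans a1
  gcongr

theorem integral_dotProduct_mul_dotProduct {J : ℕ} {f : Fin J → Ω → ℝ} {g : Fin K → Ω → ℝ}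
    (h : ∀ j k, Integrable (fun ω => f j ω * g k ω) μ) (a : Fin J → ℝ) (z : Fin K → ℝ) :
    Integrable (fun ω => (a ⬝ᵥ fun j => f j ω) * (z ⬝ᵥ fun k => g k ω)) μ ∧
    ∫ ω, (a ⬝ᵥ fun j => f j ω) * (z ⬝ᵥ fun k => g k ω) ∂μ =
      a ⬝ᵥ (Matrix.of (fun j k => ∫ ω, f j ω * g k ω ∂μ) *ᵥ z) := by
  have e : (fun ω => (a ⬝ᵥ fun j => f j ω) * (z ⬝ᵥ fun k => g k ω)) =
      fun ω => ∑ j, ∑ k, (a j * z k) * (f j ω * g k ω) := by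
    ext ω
    simp only [dotProduct, Finset.sum_mul_sum]
    refine Finset.sum_congr rfl fun j _ => Finset.sum_congr rfl fun k _ => by ring
  rw [e]
  refine ⟨integrable_finsetSum _ fun j _ => integrable_finsetSum _ fun k _ =>
    (h j k).const_mul _, ?_⟩
  rw [integral_finsetSum _ fun j _ => integrable_finsetSum _ fun k _ => (h j k).const_mul _]
  simp only [dotProduct, Matrix.mulVec, Matrix.of_apply, Finset.mul_sum]
  refine Finset.sum_congr rfl fun j _ => ?_
  rw [integral_finsetSum _ fun k _ => (h j k).const_mul _]
  refine Finset.sum_congr rfl fun k _ => ?_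
  rw [integral_const_mul]
  ring

/-- Orthonormality of the transformed basis, as an isometry of coefficients into L². -/
theorem IsGoodBasis.integral_sq [IsProbabilityMeasure μ] (h : IsGoodBasis μ b X l c) (z : Fin K → ℝ) :
    Integrable (fun ω => (z ⬝ᵥ fun k => orthonormalized μ b X k (X ω)) ^ 2) μ ∧
    ∫ ω, (z ⬝ᵥ fun k => orthonormalized μ b X k (X ω)) ^ 2 ∂μ = z ⬝ᵥ z := by
  have e : ∀ ω, (z ⬝ᵥ fun k => orthonormalized μ b X k (X ω)) =
      (invSqrt (gram μ b X) *ᵥ z) ⬝ᵥ fun k => b k (X ω) := fun ω => by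
    have : (fun k => orthonormalized μ b X k (X ω))
        = invSqrt (gram μ b X) *ᵥ fun k => b k (X ω) := rfl
    rw [this, dotProduct_mulVec_transpose, h.isInvSqrt.symm]
  obtain ⟨h1, h2⟩ := integral_dotProduct_mul_dotProduct (fun j k => h.integrable_mul h j k)
    (invSqrt (gram μ b X) *ᵥ z) (invSqrt (gram μ b X) *ᵥ z)
  simp only [e, sq]
  refine ⟨h1, h2.trans ?_⟩
  have : (Matrix.of fun j k => ∫ ω, b j (X ω) * b k (X ω) ∂μ) = gram μ b X := rfl
  rw [this, dotProduct_comm, dotProduct_mulVec_transpose, h.isInvSqrt.symm, dotProduct_comm,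
    Matrix.mulVec_mulVec, Matrix.mulVec_mulVec, h.isInvSqrt.mul_mul, Matrix.one_mulVec]

end Basis

/-- S is a cross-moment of two orthonormal systems, hence a contraction: with a = Sz, |a|² =
E[(a'ψ̃)(z'b̃)], and 2uv ≤ u² + v² yields 2|a|² ≤ |a|² + |z|². -/
theorem euc_matS_mulVec_le {Ω : Type*} [MeasurableSpace Ω] {d J K : ℕ} {μ : Measure Ω}
    [IsProbabilityMeasure μ] {ψ : Fin J → Pt d → ℝ} {b : Fin K → Pt d → ℝ}
    {X Y₂ : ℤ → Ω → Pt d} {l c l' c' : ℝ}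
    (hψ : IsGoodBasis μ ψ (Y₂ 0) l c) (hb : IsGoodBasis μ b (X 0) l' c') (z : Fin K → ℝ) :
    euc (matS μ ψ b X Y₂ *ᵥ z) ≤ euc z := by
  set a := matS μ ψ b X Y₂ *ᵥ z with ha
  obtain ⟨i1, e1⟩ := integral_dotProduct_mul_dotProduct
    (fun j k => hψ.integrable_mul_orthonormalized hb j k) a z
  obtain ⟨i2, e2⟩ := hψ.integral_sq a
  obtain ⟨i3, e3⟩ := hb.integral_sq z
  have hS : (Matrix.of fun j k => ∫ ω, orthonormalized μ ψ (Y₂ 0) j (Y₂ 0 ω)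
    * orthonormalized μ b (X 0) k (X 0 ω) ∂μ) = matS μ ψ b X Y₂ := rfl
  rw [hS, ← ha] at e1
  have hle := integral_mono (i1.const_mul 2) (i2.add i3) fun ω =>
    ((mul_assoc _ _ _).symm.trans_le (two_mul_le_add_sq
      (a ⬝ᵥ fun k => orthonormalized μ ψ (Y₂ 0) k (Y₂ 0 ω))
      (z ⬝ᵥ fun k => orthonormalized μ b (X 0) k (X 0 ω))))
  rw [integral_const_mul, e1] at hle
  have h4 := hle.trans_eq (integral_add i2 i3)
  rw [e2, e3, ← euc_sq, ← euc_sq] at h4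
  nlinarith [euc_nonneg a, euc_nonneg z]

theorem sigmaJK_mul_euc_le {Ω : Type*} [MeasurableSpace Ω] {d J K : ℕ} {μ : Measure Ω}
    {ψ : Fin J → Pt d → ℝ} {b : Fin K → Pt d → ℝ}
    {X Y₂ : ℤ → Ω → Pt d} (hσ : 0 < sigmaJK μ ψ b X Y₂) (a : Fin J → ℝ) :
    sigmaJK μ ψ b X Y₂ * euc a ≤ euc ((matS μ ψ b X Y₂)ᵀ *ᵥ a) := by
  set S := matS μ ψ b X Y₂ with hS
  have hher : (S * Sᵀ).IsHermitian := by
    rw [← Matrix.conjTranspose_eq_transpose_of_trivial]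
    exact Matrix.isHermitian_mul_conjTranspose_self S
  have h1 := lambdaMin_mul_le hher a
  have h0 : 0 < lambdaMin (S * Sᵀ) := Real.sqrt_pos.1 hσ
  rw [← Matrix.mulVec_mulVec, dotProduct_mulVec_transpose, ← euc_sq, ← euc_sq] at h1
  refine abs_le_of_sq_le_sq' ?_ (euc_nonneg _) |>.2
  rw [mul_pow, sigmaJK, ← hS, Real.sq_sqrt h0.le]
  exact h1

/-! ### Consequences of the model -/

theorem measurable_past_X {Ω : Type*} {d : ℕ} {X : ℤ → Ω → Pt d} {ε : ℤ → Ω → ℝ} {i j : ℤ}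
    (h : j ≤ i) : Measurable[past X ε i] (X j) := by
  rw [measurable_iff_comap_le]
  exact le_sup_of_le_left (le_iSup_of_le (⟨j, h⟩ : Set.Iic i) le_rfl)

theorem measurable_past_eps {Ω : Type*} {d : ℕ} {X : ℤ → Ω → Pt d} {ε : ℤ → Ω → ℝ} {i j : ℤ}
    (h : j < i) : Measurable[past X ε i] (ε j) := by
  rw [measurable_iff_comap_le]
  exact le_sup_of_le_right (le_iSup_of_le (⟨j, h⟩ : Set.Iio i) le_rfl)

theorem past_mono {Ω : Type*} {d : ℕ} {X : ℤ → Ω → Pt d} {ε : ℤ → Ω → ℝ} {i j : ℤ} (h : i ≤ j) :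
    past X ε i ≤ past X ε j := by
  refine sup_le (iSup_le fun k => ?_) (iSup_le fun k => ?_)
  · exact (measurable_past_X (k.2.trans h)).comap_le
  · exact (measurable_past_eps (lt_of_lt_of_le k.2 h)).comap_le

section Model

variable {Ω : Type*} [MeasurableSpace Ω] {d : ℕ} {μ : Measure Ω}
  {X Y₂ : ℤ → Ω → Pt d} {Y₁ ε : ℤ → Ω → ℝ} {h₀ : Pt d → ℝ}

theorem StrictlyStationary.identDistrib {S : Type*} [MeasurableSpace S] {Z : ℤ → Ω → S}
    (h : StrictlyStationary μ Z) (i : ℤ) : IdentDistrib (Z i) (Z 0) μ μ := by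
  have h1 := (h i).comp (u := fun z : ℤ → S => z 0) (measurable_pi_apply 0)
  have e : (fun z : ℤ → S => z 0) ∘ (fun ω (j : ℤ) => Z (j + i) ω) = Z i := by
    ext ω
    simp
  rw [e] at h1
  exact h1

theorem past_le (hX : ∀ i, Measurable (X i)) (hε : ∀ i, Measurable (ε i)) (i : ℤ) :
    past X ε i ≤ ‹MeasurableSpace Ω› :=
  sup_le (iSup_le fun k => (hX k).comap_le) (iSup_le fun k => (hε k).comap_le)

theorem sq_le_one_add_rpow {δ : ℝ} (hδ : 0 < δ) (x : ℝ) : x ^ 2 ≤ 1 + |x| ^ (2 + δ) := by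
  rw [← sq_abs]
  rcases le_total |x| 1 with h | h
  · have h1 : |x| ^ 2 ≤ 1 := pow_le_one₀ (abs_nonneg x) h
    have h2 : 0 ≤ |x| ^ (2 + δ) := by positivity
    linarith
  · have h1 : |x| ^ (2 : ℝ) ≤ |x| ^ (2 + δ) := Real.rpow_le_rpow_of_exponent_le h (by linarith)
    rw [Real.rpow_two] at h1
    linarith

/-- The shift by one matches observations 1, …, n with sums over `Finset.range n`. The σ-field at
index i contains X_{i+1} but errors only up to ε_i, so weights depending on X_{i+1} are predictable.
-/
theorem exists_isMDS [IsProbabilityMeasure μ] {δ : ℝ} (hδ : 0 < δ) (hM : Model μ X Y₁ Y₂ ε h₀) (hR : ResidAssumption μ X ε δ) :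
    ∃ C, 0 ≤ C ∧ IsMDS μ (fun i : ℕ => past X ε ((i : ℤ) + 1)) (fun i => ε ((i : ℤ) + 1)) C := by
  obtain ⟨c, C, -, hC⟩ := hR.condVar
  refine ⟨max C 0, le_max_right _ _, ⟨fun i => past_le hM.measurable_X hM.measurable_ε _,
    fun i j hij => past_mono (by simpa using hij), fun i => ?_, fun i => ?_,
    fun i => hR.condExp_eq _, fun i => ?_⟩⟩
  · refine Measurable.stronglyMeasurable (measurable_past_eps ?_)
    push_cast
    linarith
  · have hm := (hM.measurable_ε ((i : ℤ) + 1)).aestronglyMeasurable (μ := μ)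
    rw [memLp_two_iff_integrable_sq hm]
    refine ((integrable_const (1 : ℝ)).add (hR.moment ((i : ℤ) + 1))).mono' (hm.pow 2)
      (Eventually.of_forall fun ω => ?_)
    rw [Real.norm_eq_abs, abs_of_nonneg (sq_nonneg _)]
    exact sq_le_one_add_rpow hδ _
  · filter_upwards [hC ((i : ℤ) + 1)] with ω hω
    exact hω.2.trans (le_max_left _ _)

theorem ResidAssumption.integral_moment_eq {δ : ℝ} (hR : ResidAssumption μ X ε δ) (i : ℤ) :
    ∫ ω, |ε i ω| ^ (2 + δ) ∂μ = ∫ ω, |ε 0 ω| ^ (2 + δ) ∂μ := by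
  have h := (hR.stationary.identDistrib i).comp (u := fun x : ℝ => |x| ^ (2 + δ))
    (by fun_prop)
  exact h.integral_eq

theorem HasBoundedDensityOnCube.ae_mem {ν : Measure (Pt d)} (h : HasBoundedDensityOnCube ν) :
    ∀ᵐ x ∂ν, x ∈ unitCube d := by
  have := Measure.support_mem_ae (μ := ν)
  rw [h.1] at this
  exact this

theorem ae_mem_unitCube {Z : ℤ → Ω → Pt d} (hZ : ∀ i, IdentDistrib (Z i) (Z 0) μ μ)
    (h : HasBoundedDensityOnCube (μ.map (Z 0))) : ∀ᵐ ω ∂μ, ∀ i, Z i ω ∈ unitCube d := by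
  rw [ae_all_iff]
  intro i
  have h1 := h.ae_mem
  rw [← (hZ i).map_eq] at h1
  exact ae_of_ae_map (hZ i).aemeasurable_fst h1

theorem DataAssumption.ae_mem (h : DataAssumption μ X Y₁ Y₂) :
    ∀ᵐ ω ∂μ, ∀ i, X i ω ∈ unitCube d ∧ Y₂ i ω ∈ unitCube d := by
  have h1 := ae_mem_unitCube (fun i => (h.stationary.identDistrib i).comp measurable_fst) h.density_X
  have h2 := ae_mem_unitCube (fun i => (h.stationary.identDistrib i).comp
    (measurable_snd.comp measurable_snd)) h.density_Y₂
  filter_upwards [h1, h2] with ω a b i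
  exact ⟨a i, b i⟩

theorem SieveBounds.exists_isGoodBasis {b : SieveBasis d} {Z : Ω → Pt d} (h : SieveBounds μ b Z)
    (hZ : Measurable Z) (hZc : ∀ᵐ ω ∂μ, Z ω ∈ unitCube d)
    (hc : ∀ K k, ContinuousOn (b K k) (unitCube d)) :
    ∃ l c : ℝ, 0 < l ∧ 0 < c ∧ ∀ K, 1 ≤ K → IsGoodBasis μ (b K) Z l (c * √K) := by
  obtain ⟨C, hC⟩ := h.sup_bound
  obtain ⟨l, hl, hg⟩ := h.gram_bound
  refine ⟨l, max C 1, hl, by positivity, fun K hK => ⟨hZ, hZc, hc K, hl, hg K hK, fun x hx => ?_⟩⟩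
  rw [euc_eq_sqrt]
  refine (hC K x hx).trans ?_
  gcongr
  exact le_max_left _ _

end Model

/-! ### Tail bounds at a fixed sample size -/

section Tail

variable {Ω : Type*} {mΩ : MeasurableSpace Ω} {μ : Measure Ω} [IsProbabilityMeasure μ]

theorem IsBoundedMDS.measure_exists_lt_abs_sum_le {ι : Type*} [Fintype ι]
    {m : ℕ → MeasurableSpace Ω} {ξ : ℕ → Ω → ℝ} {w : ι → ℕ → Ω → ℝ}
    {B C b l : ℝ} (h : IsBoundedMDS μ m ξ B C) (hC : 0 ≤ C)
    (hw : ∀ k i, StronglyMeasurable[m i] (w k i)) (hwb : ∀ k i ω, |w k i ω| ≤ b)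
    (hl0 : 0 ≤ l) (hl : l * b * B ≤ 1) (n : ℕ) (t v : ℝ) :
    μ {ω | ∃ k, t < |∑ i ∈ Finset.range n, w k i ω * ξ i ω| ∧
        ∑ i ∈ Finset.range n, w k i ω ^ 2 ≤ v} ≤
      Fintype.card ι * (2 * ENNReal.ofReal (Real.exp (l ^ 2 * C * v - l * t))) := by
  have e : {ω | ∃ k, t < |∑ i ∈ Finset.range n, w k i ω * ξ i ω| ∧
        ∑ i ∈ Finset.range n, w k i ω ^ 2 ≤ v} =
      ⋃ k ∈ (Finset.univ : Finset ι), {ω | t < |∑ i ∈ Finset.range n, w k i ω * ξ i ω| ∧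
        ∑ i ∈ Finset.range n, w k i ω ^ 2 ≤ v} := by
    ext ω
    simp
  rw [e]
  refine (measure_biUnion_finset_le _ _).trans ((Finset.sum_le_sum fun k _ =>
    h.measure_lt_abs_sum_le hC (hw k) (hwb k) hl0 hl n t v).trans_eq ?_)
  rw [Finset.sum_const, nsmul_eq_mul, Finset.card_univ]

/-- Markov's inequality in L¹. Bounding the sum of absolute values makes the estimate uniform over
all bounded weights at once, with no union bound. -/
theorem IsMDS.measure_le_sum_abs_sub_ctrunc_le {m : ℕ → MeasurableSpace Ω} {e : ℕ → Ω → ℝ}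
    {C M δ Q s : ℝ} (h : IsMDS μ m e C) (hM : 0 < M) (hδ : 0 < δ)
    (hmom : ∀ i, Integrable (fun ω => |e i ω| ^ (2 + δ)) μ)
    (hQ : ∀ i, ∫ ω, |e i ω| ^ (2 + δ) ∂μ ≤ Q) (hs : 0 < s) (n : ℕ) :
    μ {ω | s ≤ ∑ i ∈ Finset.range n, |e i ω - ctrunc μ (m i) (e i) M ω|} ≤
      ENNReal.ofReal (n * (2 * (M ^ (-(1 + δ)) * Q)) / s) := by
  have hi := fun i => h.integral_abs_sub_ctrunc_le hM hδ i (hmom i)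
  have hle : ∫ ω, ∑ i ∈ Finset.range n, |e i ω - ctrunc μ (m i) (e i) M ω| ∂μ ≤
      n * (2 * (M ^ (-(1 + δ)) * Q)) := by
    rw [integral_finsetSum _ fun i _ => (hi i).1]
    refine (Finset.sum_le_card_nsmul _ _ (2 * (M ^ (-(1 + δ)) * Q)) fun i _ =>
      (hi i).2.trans ?_).trans_eq (by simp)
    have := hQ i
    gcongr
  have hM := mul_meas_ge_le_integral_of_nonneg (μ := μ)
    (Eventually.of_forall fun ω => Finset.sum_nonneg fun i (_ : i ∈ Finset.range n) =>
      abs_nonneg (e i ω - ctrunc μ (m i) (e i) M ω))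
    (integrable_finsetSum _ fun i _ => (hi i).1) s
  rw [← ofReal_measureReal]
  refine ENNReal.ofReal_le_ofReal ?_
  rw [le_div_iff₀ hs, mul_comm]
  exact hM.trans hle

end Tail

section Score

variable {Ω : Type*} [MeasurableSpace Ω] {d K : ℕ} {μ : Measure Ω}
  {b : Fin K → Pt d → ℝ} {X : ℤ → Ω → Pt d} {l c : ℝ}

theorem dotProduct_score (n : ℕ) (ω : Ω) (e : ℕ → ℝ) (v : Fin K → ℝ) :
    v ⬝ᵥ score μ n b X ω (fun i => e i) = (n : ℝ)⁻¹ * ∑ i ∈ Finset.range n,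
      (v ⬝ᵥ fun k => orthonormalized μ b (X 0) k (X ((i : ℤ) + 1) ω)) * e i := by
  rw [score, dotProduct_smul, smul_eq_mul, Matrix.dotProduct_mulVec, Matrix.vecMul_transpose,
    ← Fin.sum_univ_eq_sum_range (fun i : ℕ =>
      (v ⬝ᵥ fun k => orthonormalized μ b (X 0) k (X ((i : ℤ) + 1) ω)) * e i)]
  congr 1
  refine Finset.sum_congr rfl fun i _ => ?_
  congr 1
  exact dotProduct_comm _ _

theorem sum_dotProduct_sq {n : ℕ} (hn : n ≠ 0) (ω : Ω) (v : Fin K → ℝ) :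
    ∑ i ∈ Finset.range n,
      (v ⬝ᵥ fun k => orthonormalized μ b (X 0) k (X ((i : ℤ) + 1) ω)) ^ 2 =
    n * (v ⬝ᵥ (gramHat μ n b X ω *ᵥ v)) := by
  have hn' : (n : ℝ) ≠ 0 := Nat.cast_ne_zero.2 hn
  simp only [gramHat]
  rw [Matrix.smul_mulVec, dotProduct_smul, smul_eq_mul, ← mul_assoc, mul_inv_cancel₀ hn', one_mul,
    ← Matrix.mulVec_mulVec, dotProduct_mulVec_transpose, Matrix.transpose_transpose,
    ← Fin.sum_univ_eq_sum_range (fun i : ℕ =>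
      (v ⬝ᵥ fun k => orthonormalized μ b (X 0) k (X ((i : ℤ) + 1) ω)) ^ 2)]
  refine Finset.sum_congr rfl fun i _ => ?_
  have : v ⬝ᵥ (fun k => orthonormalized μ b (X 0) k (X ((i : ℤ) + 1) ω)) =
      (design n (orthonormalized μ b (X 0)) X ω *ᵥ v) i := dotProduct_comm _ _
  rw [this, sq]

/-- The sum is n v'Ĝv, so closeness of Ĝ to I controls the squared weights for all v simultaneously.
-/
theorem sum_dotProduct_sq_le {n : ℕ} (hn : n ≠ 0) (ω : Ω)
    (hG : specNorm (gramHat μ n b X ω - 1) ≤ 1) (v : Fin K → ℝ) :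
    ∑ i ∈ Finset.range n,
      (v ⬝ᵥ fun k => orthonormalized μ b (X 0) k (X ((i : ℤ) + 1) ω)) ^ 2 ≤
    2 * n * euc v ^ 2 := by
  rw [sum_dotProduct_sq hn]
  have h1 := euc_mulVec_le (gramHat μ n b X ω - 1) v
  have h2 := dotProduct_le_euc v ((gramHat μ n b X ω - 1) *ᵥ v)
  have h3 : (gramHat μ n b X ω) *ᵥ v = (gramHat μ n b X ω - 1) *ᵥ v + v := by
    rw [Matrix.sub_mulVec, Matrix.one_mulVec, sub_add_cancel]
  have h0 := euc_nonneg v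
  have h4 : euc ((gramHat μ n b X ω - 1) *ᵥ v) ≤ euc v := by nlinarith
  rw [h3, dotProduct_add, ← euc_sq]
  have h5 : v ⬝ᵥ ((gramHat μ n b X ω - 1) *ᵥ v) ≤ euc v ^ 2 := by nlinarith
  have hn0 : (0 : ℝ) ≤ n := n.cast_nonneg
  nlinarith

/-- The weight `v'b̃(x)`, set to zero outside the cube. -/
noncomputable def weight (μ : Measure Ω) (b : Fin K → Pt d → ℝ) (Z : Ω → Pt d) (v : Fin K → ℝ) :
    Pt d → ℝ :=
  (unitCube d).indicator fun x => v ⬝ᵥ fun k => orthonormalized μ b Z k x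

theorem weight_of_mem {Z : Ω → Pt d} (v : Fin K → ℝ) {x : Pt d} (hx : x ∈ unitCube d) :
    weight μ b Z v x = v ⬝ᵥ fun k => orthonormalized μ b Z k x :=
  Set.indicator_of_mem hx _

theorem measurable_weight {Z : Ω → Pt d} (hb : ∀ k, ContinuousOn (b k) (unitCube d))
    (v : Fin K → ℝ) : Measurable (weight μ b Z v) := by
  classical
  rw [weight, ← Set.piecewise_eq_indicator]
  refine ContinuousOn.measurable_piecewise ?_ continuousOn_const (measurableSet_unitCube d)
  unfold dotProduct
  exact continuousOn_finsetSum _ fun i _ =>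
    continuousOn_const.mul (continuousOn_orthonormalized hb i)

theorem IsGoodBasis.abs_weight_le {Z : Ω → Pt d} (h : IsGoodBasis μ b Z l c) (hc : 0 ≤ c)
    (v : Fin K → ℝ) (x : Pt d) : |weight μ b Z v x| ≤ euc v * (√l⁻¹ * c) := by
  by_cases hx : x ∈ unitCube d
  · rw [weight_of_mem v hx]
    exact (abs_dotProduct_le _ _).trans
      (mul_le_mul_of_nonneg_left (h.euc_orthonormalized_le hx) (euc_nonneg v))
  · rw [weight, Set.indicator_of_notMem hx, abs_zero]
    have := euc_nonneg v
    positivity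

/-- Chebyshev: summing the martingale second moments over coordinates gives E|Z|² ≤ C sup|b̃|²/n. -/
theorem IsGoodBasis.measure_lt_euc_score_le [IsProbabilityMeasure μ] {ε : ℤ → Ω → ℝ} {C q : ℝ}
    (h : IsGoodBasis μ b (X 0) l c) (hc : 0 ≤ c) (hC : 0 ≤ C)
    (hmds : IsMDS μ (fun i : ℕ => past X ε ((i : ℤ) + 1)) (fun i => ε ((i : ℤ) + 1)) C)
    (hX : ∀ᵐ ω ∂μ, ∀ i, X i ω ∈ unitCube d) {n : ℕ} (hn : n ≠ 0) (hq : 0 < q) :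
    μ {ω | q ≤ euc (score μ n b X ω fun i => ε ((i : ℤ) + 1) ω)} ≤
      ENNReal.ofReal (C * (√l⁻¹ * c) ^ 2 / (n * q ^ 2)) := by
  have hn' : (0 : ℝ) < n := Nat.cast_pos.2 (Nat.pos_of_ne_zero hn)
  set w : Fin K → ℕ → Ω → ℝ := fun k i ω => weight μ b (X 0) (Pi.single k 1) (X ((i : ℤ) + 1) ω)
    with hw
  have hwm : ∀ k (i : ℕ), StronglyMeasurable[past X ε ((i : ℤ) + 1)] (w k i) := fun k i =>
    ((measurable_weight h.cont _).comp (measurable_past_X le_rfl)).stronglyMeasurable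
  have hwb : ∀ k i ω, |w k i ω| ≤ euc (Pi.single k 1 : Fin K → ℝ) * (√l⁻¹ * c) := fun k i ω =>
    h.abs_weight_le hc _ _
  have hmain := fun k => hmds.integral_sum_sq_le (hwm k)
    (b := euc (Pi.single k 1 : Fin K → ℝ) * (√l⁻¹ * c)) (hwb k) n
  have hw2 : ∀ k (i : ℕ), Integrable (fun ω => w k i ω ^ 2) μ := fun k i => by
    refine integrable_of_ae_abs_le (B := (euc (Pi.single k 1 : Fin K → ℝ) * (√l⁻¹ * c)) ^ 2)
      (((hwm k i).mono (hmds.le i)).pow 2).aestronglyMeasurable (Eventually.of_forall fun ω => ?_)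
    rw [abs_pow]
    exact pow_le_pow_left₀ (abs_nonneg _) (hwb k i ω) 2
  have hsq : ∀ x ∈ unitCube d, ∑ k, weight μ b (X 0) (Pi.single k 1) x ^ 2 =
      euc (fun k => orthonormalized μ b (X 0) k x) ^ 2 := fun x hx => by
    rw [euc_sq]
    refine Finset.sum_congr rfl fun k _ => ?_
    rw [weight_of_mem _ hx, single_dotProduct, one_mul, sq]
  have hwsum : ∀ i, ∑ k, ∫ ω, w k i ω ^ 2 ∂μ ≤ (√l⁻¹ * c) ^ 2 := fun i => by
    rw [← integral_finsetSum _ fun k _ => hw2 k i]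
    have : ∫ _ : Ω, (√l⁻¹ * c) ^ 2 ∂μ = (√l⁻¹ * c) ^ 2 := by simp
    rw [← this]
    refine integral_mono_ae (integrable_finsetSum _ fun k _ => hw2 k i) (integrable_const _) ?_
    filter_upwards [hX] with ω hω
    refine (hsq _ (hω _)).trans_le ?_
    exact pow_le_pow_left₀ (euc_nonneg _) (h.euc_orthonormalized_le (hω _)) 2
  have hae : ∀ᵐ ω ∂μ, euc (score μ n b X ω fun i => ε ((i : ℤ) + 1) ω) ^ 2 =
      (n : ℝ)⁻¹ ^ 2 * ∑ k, (∑ i ∈ Finset.range n, w k i ω * ε ((i : ℤ) + 1) ω) ^ 2 := by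
    filter_upwards [hX] with ω hω
    rw [euc_sq, Finset.mul_sum]
    refine Finset.sum_congr rfl fun k _ => ?_
    have h1 := dotProduct_score (μ := μ) (b := b) (X := X) n ω (fun i => ε ((i : ℤ) + 1) ω)
      (Pi.single k 1)
    rw [single_dotProduct, one_mul] at h1
    rw [h1, ← sq, mul_pow]
    refine congrArg (fun x => (n : ℝ)⁻¹ ^ 2 * x ^ 2) (Finset.sum_congr rfl fun i _ => ?_)
    rw [← weight_of_mem _ (hω _)]
  have hint : Integrable (fun ω => (n : ℝ)⁻¹ ^ 2 *
      ∑ k, (∑ i ∈ Finset.range n, w k i ω * ε ((i : ℤ) + 1) ω) ^ 2) μ :=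
    (integrable_finsetSum _ fun k _ => (hmain k).2.1.integrable_sq).const_mul _
  have hle : ∫ ω, (n : ℝ)⁻¹ ^ 2 *
      ∑ k, (∑ i ∈ Finset.range n, w k i ω * ε ((i : ℤ) + 1) ω) ^ 2 ∂μ ≤
      C * (√l⁻¹ * c) ^ 2 / n := by
    rw [integral_const_mul, integral_finsetSum _ fun k _ => (hmain k).2.1.integrable_sq]
    have h1 : ∑ k, ∫ ω, (∑ i ∈ Finset.range n, w k i ω * ε ((i : ℤ) + 1) ω) ^ 2 ∂μ ≤
        C * (n * (√l⁻¹ * c) ^ 2) := by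
      refine (Finset.sum_le_sum fun k _ => (hmain k).2.2).trans ?_
      rw [← Finset.mul_sum, Finset.sum_comm]
      refine mul_le_mul_of_nonneg_left ?_ hC
      refine (Finset.sum_le_card_nsmul _ _ _ fun i _ => hwsum i).trans_eq (by simp)
    calc _ ≤ (n : ℝ)⁻¹ ^ 2 * (C * (n * (√l⁻¹ * c) ^ 2)) := by gcongr
      _ = _ := by field_simp
  have hmark := mul_meas_ge_le_integral_of_nonneg (μ := μ) (Eventually.of_forall fun ω => by
    have : 0 ≤ ∑ k, (∑ i ∈ Finset.range n, w k i ω * ε ((i : ℤ) + 1) ω) ^ 2 :=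
      Finset.sum_nonneg fun k _ => sq_nonneg _
    show (0 : ℝ) ≤ _
    exact mul_nonneg (sq_nonneg _) this) hint (q ^ 2)
  have hmono : μ {ω | q ≤ euc (score μ n b X ω fun i => ε ((i : ℤ) + 1) ω)} ≤
      μ {ω | q ^ 2 ≤ (n : ℝ)⁻¹ ^ 2 *
        ∑ k, (∑ i ∈ Finset.range n, w k i ω * ε ((i : ℤ) + 1) ω) ^ 2} := by
    refine measure_mono_ae ?_
    filter_upwards [hae] with ω hω hq'
    refine le_of_le_of_eq ?_ hω
    exact pow_le_pow_left₀ hq.le hq' 2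
  refine hmono.trans ?_
  rw [← ofReal_measureReal]
  refine ENNReal.ofReal_le_ofReal ?_
  rw [← div_div, le_div_iff₀ (by positivity), mul_comm]
  exact hmark.trans hle

end Score

/-! ### Linearization of the estimation error -/

section Linearization

variable {Ω : Type*} [MeasurableSpace Ω] {d J K : ℕ} {μ : Measure Ω}
  {ψ : Fin J → Pt d → ℝ} {b : Fin K → Pt d → ℝ}
  {X Y₂ : ℤ → Ω → Pt d} {Y₁ ε : ℤ → Ω → ℝ} {h₀ : Pt d → ℝ} {l c l' c' : ℝ}

open scoped Matrix.Norms.L2Operator in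
theorem specNorm_zero {m n : ℕ} : specNorm (0 : Matrix (Fin m) (Fin n) ℝ) = 0 :=
  norm_zero

/-- The matrix `S'(SS')⁻¹`. -/
noncomputable def loading (μ : Measure Ω) (ψ : Fin J → Pt d → ℝ) (b : Fin K → Pt d → ℝ)
    (X : ℤ → Ω → Pt d) (Y₂ : ℤ → Ω → Pt d) : Matrix (Fin K) (Fin J) ℝ :=
  ((matS μ ψ b X Y₂ * (matS μ ψ b X Y₂)ᵀ)⁻¹ * matS μ ψ b X Y₂)ᵀ

theorem matS_mul_transpose_mulVec_loading (hσ : 0 < sigmaJK μ ψ b X Y₂) (z : Fin K → ℝ) :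
    (matS μ ψ b X Y₂ * (matS μ ψ b X Y₂)ᵀ) *ᵥ ((loading μ ψ b X Y₂)ᵀ *ᵥ z) =
      matS μ ψ b X Y₂ *ᵥ z := by
  have hu := isUnit_mul_mul_transpose_of_near (T := matS μ ψ b X Y₂) (S := matS μ ψ b X Y₂)
    (H := 1) (s := 0) (g := 0) hσ (sigmaJK_mul_euc_le hσ)
    (by rw [sub_self, specNorm_zero]) (by positivity) (by norm_num)
    (fun z => by rw [Matrix.one_mulVec, sub_self, euc_zero]; simp)
  rw [Matrix.mul_one] at hu
  rw [loading, Matrix.transpose_transpose, Matrix.mulVec_mulVec, ← Matrix.mul_assoc,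
    Matrix.mul_nonsing_inv _ ((Matrix.isUnit_iff_isUnit_det _).1 hu), Matrix.one_mul]

/-- (SS')⁻¹S returns least squares coefficients, so its norm is at most σ⁻¹ and not the σ⁻² of
(SS')⁻¹ alone. -/
theorem euc_loading_transpose_mulVec_le (hσ : 0 < sigmaJK μ ψ b X Y₂) (z : Fin K → ℝ) :
    euc ((loading μ ψ b X Y₂)ᵀ *ᵥ z) ≤ (sigmaJK μ ψ b X Y₂)⁻¹ * euc z :=
  (projection_bounds hσ (sigmaJK_mul_euc_le hσ) (matS_mul_transpose_mulVec_loading hσ z)).2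

theorem euc_loading_mulVec_le (hσ : 0 < sigmaJK μ ψ b X Y₂) (a : Fin J → ℝ) :
    euc (loading μ ψ b X Y₂ *ᵥ a) ≤ (sigmaJK μ ψ b X Y₂)⁻¹ * euc a := by
  have := euc_transpose_mulVec_le (inv_nonneg.2 hσ.le) (euc_loading_transpose_mulVec_le hσ) a
  rwa [Matrix.transpose_transpose] at this

/-- S' is a contraction bounded below by σ. Consequently a small `matrixError`, which carries a
factor σ⁻¹, also makes the unscaled matrix errors small. -/
theorem sigmaJK_le_one [IsProbabilityMeasure μ]
    (hψ : IsGoodBasis μ ψ (Y₂ 0) l c) (hb : IsGoodBasis μ b (X 0) l' c')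
    (hJ : 0 < J) (hσ : 0 < sigmaJK μ ψ b X Y₂) : sigmaJK μ ψ b X Y₂ ≤ 1 := by
  set a : Fin J → ℝ := Pi.single ⟨0, hJ⟩ 1 with ha
  have h1 : euc a = 1 := by
    rw [← pow_eq_one_iff_of_nonneg (euc_nonneg a) two_ne_zero, euc_sq, ha]
    simp
  have h2 := sigmaJK_mul_euc_le hσ a
  have h3 := euc_transpose_mulVec_le zero_le_one
    (fun z => (euc_matS_mulVec_le hψ hb z).trans_eq (one_mul _).symm) a
  rw [h1] at h2 h3
  linarith

theorem specNorm_add_specNorm_eq (hσ : 0 < sigmaJK μ ψ b X Y₂) (n : ℕ) (ω : Ω) :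
    specNorm (gramHat μ n b X ω - 1) + specNorm (matSHat μ n ψ b X Y₂ ω - matS μ ψ b X Y₂) =
      sigmaJK μ ψ b X Y₂ * matrixError μ n ψ b X Y₂ ω := by
  rw [matrixError, ← mul_assoc, mul_inv_cancel₀ hσ.ne', one_mul]

theorem specNorm_gramHat_sub_one_le [IsProbabilityMeasure μ]
    (hψ : IsGoodBasis μ ψ (Y₂ 0) l c)
    (hb : IsGoodBasis μ b (X 0) l' c') (hJ : 0 < J) (hσ : 0 < sigmaJK μ ψ b X Y₂) {n : ℕ} {ω : Ω}
    (hme : matrixError μ n ψ b X Y₂ ω ≤ 1 / 4) : specNorm (gramHat μ n b X ω - 1) ≤ 1 / 4 := by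
  have h1 := specNorm_add_specNorm_eq hσ n ω
  have h2 := specNorm_nonneg (matSHat μ n ψ b X Y₂ ω - matS μ ψ b X Y₂)
  have h3 := sigmaJK_le_one hψ hb hJ hσ
  nlinarith

theorem abs_hHat_sub_projN_le [IsProbabilityMeasure μ]
    (hψ : IsGoodBasis μ ψ (Y₂ 0) l c)
    (hb : IsGoodBasis μ b (X 0) l' c') (hJ : 0 < J) (hσ : 0 < sigmaJK μ ψ b X Y₂) {n : ℕ}
    (hn : n ≠ 0) {ω : Ω} (hme : matrixError μ n ψ b X Y₂ ω ≤ 1 / 4)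
    (hY : ∀ i, Y₁ i ω = h₀ (Y₂ i ω) + ε i ω) (y : Pt d) :
    |hHat n ψ b X Y₁ Y₂ ω y - projN μ n ψ b X Y₂ h₀ ω y| ≤
      |(loading μ ψ b X Y₂ *ᵥ fun j => orthonormalized μ ψ (Y₂ 0) j y) ⬝ᵥ
        score μ n b X ω fun i => ε ((i : ℤ) + 1) ω| +
      euc (fun j => orthonormalized μ ψ (Y₂ 0) j y) *
        (24 * (sigmaJK μ ψ b X Y₂)⁻¹ * matrixError μ n ψ b X Y₂ ω *
          euc (score μ n b X ω fun i => ε ((i : ℤ) + 1) ω)) := by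
  set σ := sigmaJK μ ψ b X Y₂ with hσdef
  set Z := score μ n b X ω fun i => ε ((i : ℤ) + 1) ω
  have hg4 := specNorm_gramHat_sub_one_le hψ hb hJ hσ hme
  have hsum := specNorm_add_specNorm_eq hσ n ω
  have hs : specNorm (matSHat μ n ψ b X Y₂ ω - matS μ ψ b X Y₂) ≤ σ / 2 := by
    have h2 := specNorm_nonneg (gramHat μ n b X ω - 1)
    nlinarith
  obtain ⟨hGu, hGz⟩ := near_inv hg4 le_rfl
  have hTu := isUnit_mul_mul_transpose_of_near hσ (sigmaJK_mul_euc_le hσ) le_rfl hs hg4 hGz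
  obtain ⟨a, ha, hay⟩ := hHat_sub_projN μ hn ψ b X Y₁ Y₂ h₀ ω (fun i => ε ((i : ℤ) + 1) ω)
    (fun i => hY _) hψ.isInvSqrt hb.isInvSqrt hGu hTu
  have hpert := perturbation_bound hσ (sigmaJK_mul_euc_le hσ) (euc_matS_mulVec_le hψ hb) le_rfl hs
    (specNorm_nonneg _) hg4 hGz ha (matS_mul_transpose_mulVec_loading hσ Z)
  rw [hsum, ← mul_assoc σ⁻¹, inv_mul_cancel₀ hσ.ne', one_mul] at hpert
  rw [hay]
  have e : (fun j => orthonormalized μ ψ (Y₂ 0) j y) ⬝ᵥ a =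
      (loading μ ψ b X Y₂ *ᵥ fun j => orthonormalized μ ψ (Y₂ 0) j y) ⬝ᵥ Z +
      (fun j => orthonormalized μ ψ (Y₂ 0) j y) ⬝ᵥ (a - (loading μ ψ b X Y₂)ᵀ *ᵥ Z) := by
    rw [dotProduct_sub, dotProduct_mulVec_transpose, Matrix.transpose_transpose]
    ring
  rw [e]
  refine (abs_add_le _ _).trans (add_le_add le_rfl ?_)
  exact (abs_dotProduct_le _ _).trans (mul_le_mul_of_nonneg_left hpert (euc_nonneg _))

end Linearization

/-! ### Sup-norms -/

theorem supNorm_sub_le {d : ℕ} (f g h : Pt d → ℝ) :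
    supNorm (fun y => f y - g y) ≤ supNorm (fun y => f y - h y) + supNorm (fun y => g y - h y) := by
  refine iSup₂_le fun y hy => ?_
  have h1 : ‖f y - g y‖ₑ ≤ ‖f y - h y‖ₑ + ‖g y - h y‖ₑ := by
    have e : f y - g y = (f y - h y) - (g y - h y) := by ring
    rw [e]
    exact enorm_sub_le
  exact h1.trans (add_le_add (le_iSup₂ (f := fun y (_ : y ∈ unitCube d) => ‖f y - h y‖ₑ) y hy)
    (le_iSup₂ (f := fun y (_ : y ∈ unitCube d) => ‖g y - h y‖ₑ) y hy))

theorem supNorm_le_of_forall_abs_le {d : ℕ} {f : Pt d → ℝ} {M : ℝ}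
    (h : ∀ y ∈ unitCube d, |f y| ≤ M) : supNorm f ≤ ENNReal.ofReal M := by
  refine iSup₂_le fun y hy => ?_
  rw [Real.enorm_eq_ofReal_abs]
  exact ENNReal.ofReal_le_ofReal (h y hy)

/-- The remainder is real-valued and the inequality is claimed at every n and ω, so finiteness is
needed even where the matrices are singular. Both functions are finite linear combinations of
bounded ones. -/
theorem supNorm_hHat_sub_projN_ne_top {Ω : Type*} [MeasurableSpace Ω] {d J K : ℕ} {μ : Measure Ω}
    {ψ : Fin J → Pt d → ℝ} {b : Fin K → Pt d → ℝ}
    {X Y₂ : ℤ → Ω → Pt d} {Y₁ : ℤ → Ω → ℝ} {h₀ : Pt d → ℝ} {c : ℝ}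
    (hψ : ∀ y ∈ unitCube d, euc (fun j => ψ j y) ≤ c) (n : ℕ) (ω : Ω) :
    supNorm (fun y => hHat n ψ b X Y₁ Y₂ ω y - projN μ n ψ b X Y₂ h₀ ω y) ≠ ⊤ := by
  have key : ∃ a₁ a₂ : Fin J → ℝ, ∀ y, hHat n ψ b X Y₁ Y₂ ω y - projN μ n ψ b X Y₂ h₀ ω y =
      (fun j => ψ j y) ⬝ᵥ a₁ - (invSqrt (gram μ ψ (Y₂ 0)) *ᵥ fun j => ψ j y) ⬝ᵥ a₂ :=
    ⟨_, _, fun y => rfl⟩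
  obtain ⟨a₁, a₂, hk⟩ := key
  simp only [hk]
  refine ((supNorm_le_of_forall_abs_le (M := c * euc a₁ +
    specNorm (invSqrt (gram μ ψ (Y₂ 0))) * c * euc a₂) fun y hy => ?_).trans_lt
    ENNReal.ofReal_lt_top).ne
  refine (abs_sub _ _).trans (add_le_add ((abs_dotProduct_le _ _).trans ?_)
    ((abs_dotProduct_le _ _).trans ?_))
  · exact mul_le_mul_of_nonneg_right (hψ y hy) (euc_nonneg _)
  · refine mul_le_mul_of_nonneg_right ((euc_mulVec_le _ _).trans ?_) (euc_nonneg _)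
    exact mul_le_mul_of_nonneg_left (hψ y hy) (specNorm_nonneg _)

/-! ### The uniform bound on a good event -/

theorem euc_le_sqrt_mul {J : ℕ} {v : Fin J → ℝ} {r : ℝ} (hr : 0 ≤ r) (h : ∀ j, |v j| ≤ r) :
    euc v ≤ √J * r := by
  rw [euc_eq_sqrt]
  have : ∑ j, v j ^ 2 ≤ J * r ^ 2 := by
    have h1 : ∀ j ∈ Finset.univ, v j ^ 2 ≤ r ^ 2 := fun j _ => by
      rw [← sq_abs]
      exact pow_le_pow_left₀ (abs_nonneg _) (h j) 2
    simpa using Finset.sum_le_sum h1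
  refine (Real.sqrt_le_sqrt this).trans_eq ?_
  rw [Real.sqrt_mul J.cast_nonneg, Real.sqrt_sq hr]

section Uniform

variable {Ω : Type*} [MeasurableSpace Ω] {d J K : ℕ} {μ : Measure Ω}
  {ψ : Fin J → Pt d → ℝ} {b : Fin K → Pt d → ℝ}
  {X Y₂ : ℤ → Ω → Pt d} {Y₁ ε : ℤ → Ω → ℝ} {h₀ : Pt d → ℝ} {l c l' c' : ℝ}

theorem IsGoodBasis.euc_orthonormalized_sub_le {Z : Ω → Pt d} (h : IsGoodBasis μ ψ Z l c)
    {γ M : ℝ} (hM : ∀ j, IsHolderWith γ M (ψ j)) (hM0 : 0 ≤ M) {y z : Pt d} (hy : y ∈ unitCube d)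
    (hz : z ∈ unitCube d) :
    euc ((fun j => orthonormalized μ ψ Z j y) - fun j => orthonormalized μ ψ Z j z) ≤
      √l⁻¹ * (√J * (M * ‖y - z‖ ^ min γ 1)) := by
  have e : ((fun j => orthonormalized μ ψ Z j y) - fun j => orthonormalized μ ψ Z j z) =
      invSqrt (gram μ ψ Z) *ᵥ ((fun j => ψ j y) - fun j => ψ j z) :=
    (Matrix.mulVec_sub _ _ _).symm
  rw [e]
  refine (h.euc_invSqrt_mulVec_le _).trans (mul_le_mul_of_nonneg_left ?_ (Real.sqrt_nonneg _))
  exact euc_le_sqrt_mul (by positivity) fun j => (hM j).abs_sub_le hy hz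

/-- The weights of the errors in the linearized estimation error at a point of the grid. -/
noncomputable def gridWeight (μ : Measure Ω) (ψ : Fin J → Pt d → ℝ) (b : Fin K → Pt d → ℝ)
    (X : ℤ → Ω → Pt d) (Y₂ : ℤ → Ω → Pt d) (N : ℕ) (k : Fin d → Fin (N + 1)) (i : ℕ) (ω : Ω) : ℝ :=
  weight μ b (X 0)
    (loading μ ψ b X Y₂ *ᵥ fun j => orthonormalized μ ψ (Y₂ 0) j (gridPt N k)) (X ((i : ℤ) + 1) ω)

theorem euc_loading_orthonormalized_le (hψ : IsGoodBasis μ ψ (Y₂ 0) l c)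
    (hσ : 0 < sigmaJK μ ψ b X Y₂) {y : Pt d} (hy : y ∈ unitCube d) :
    euc (loading μ ψ b X Y₂ *ᵥ fun j => orthonormalized μ ψ (Y₂ 0) j y) ≤
      (sigmaJK μ ψ b X Y₂)⁻¹ * (√l⁻¹ * c) :=
  (euc_loading_mulVec_le hσ _).trans
    (mul_le_mul_of_nonneg_left (hψ.euc_orthonormalized_le hy) (inv_nonneg.2 hσ.le))

theorem abs_gridWeight_le (hψ : IsGoodBasis μ ψ (Y₂ 0) l c) (hb : IsGoodBasis μ b (X 0) l' c')
    (hc' : 0 ≤ c') (hσ : 0 < sigmaJK μ ψ b X Y₂) (N : ℕ) (k : Fin d → Fin (N + 1)) (i : ℕ) (ω : Ω) :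
    |gridWeight μ ψ b X Y₂ N k i ω| ≤
      (sigmaJK μ ψ b X Y₂)⁻¹ * (√l⁻¹ * c) * (√l'⁻¹ * c') := by
  refine (hb.abs_weight_le hc' _ _).trans (mul_le_mul_of_nonneg_right
    (euc_loading_orthonormalized_le hψ hσ (gridPt_mem k)) (by positivity))

/-- The deterministic part of the argument. The three summands are the linear term at the nearest
grid point (truncated sum plus discarded errors), the discretization error, and the error of
linearization. -/
theorem abs_hHat_sub_projN_le_of_grid [IsProbabilityMeasure μ] (hψ : IsGoodBasis μ ψ (Y₂ 0) l c)
    (hb : IsGoodBasis μ b (X 0) l' c') (hc : 0 ≤ c) (hc' : 0 ≤ c') (hJ : 0 < J)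
    (hσ : 0 < sigmaJK μ ψ b X Y₂) {n : ℕ} (hn : n ≠ 0) {ω : Ω}
    (hme : matrixError μ n ψ b X Y₂ ω ≤ 1 / 4) {em : ℝ} (hme' : matrixError μ n ψ b X Y₂ ω ≤ em)
    (hem : 0 ≤ em)
    (hY : ∀ i, Y₁ i ω = h₀ (Y₂ i ω) + ε i ω) (hX : ∀ i, X i ω ∈ unitCube d)
    {γ M : ℝ} (hγ : 0 < γ) (hM : ∀ j, IsHolderWith γ M (ψ j)) (hM0 : 0 ≤ M)
    {q s t : ℝ} (hq : euc (score μ n b X ω fun i => ε ((i : ℤ) + 1) ω) ≤ q)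
    {ξ : ℕ → Ω → ℝ} (hs : ∑ i ∈ Finset.range n, |ε ((i : ℤ) + 1) ω - ξ i ω| ≤ s)
    {N : ℕ} (hN : 0 < N)
    (ht : ∀ k, ∑ i ∈ Finset.range n, gridWeight μ ψ b X Y₂ N k i ω ^ 2 ≤
        2 * n * ((sigmaJK μ ψ b X Y₂)⁻¹ * (√l⁻¹ * c)) ^ 2 →
      |∑ i ∈ Finset.range n, gridWeight μ ψ b X Y₂ N k i ω * ξ i ω| ≤ t)
    {y : Pt d} (hy : y ∈ unitCube d) :
    |hHat n ψ b X Y₁ Y₂ ω y - projN μ n ψ b X Y₂ h₀ ω y| ≤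
      (n : ℝ)⁻¹ * (t + (sigmaJK μ ψ b X Y₂)⁻¹ * (√l⁻¹ * c) * (√l'⁻¹ * c') * s) +
      √l⁻¹ * (√J * (M * (√d / N) ^ min γ 1)) * ((sigmaJK μ ψ b X Y₂)⁻¹ * q) +
      √l⁻¹ * c * (24 * (sigmaJK μ ψ b X Y₂)⁻¹ * em * q) := by
  set σ := sigmaJK μ ψ b X Y₂ with hσdef
  set Z := score μ n b X ω fun i => ε ((i : ℤ) + 1) ω with hZ
  set P := loading μ ψ b X Y₂
  have hσ0 : 0 ≤ σ⁻¹ := inv_nonneg.2 hσ.le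
  have hq0 : 0 ≤ q := (euc_nonneg _).trans hq
  refine (abs_hHat_sub_projN_le hψ hb hJ hσ hn hme hY y).trans (add_le_add ?_ ?_)
  · obtain ⟨k, hk⟩ := exists_gridPt_near hN hy
    set z := gridPt N k with hz
    have hzc : z ∈ unitCube d := gridPt_mem k
    have e : (P *ᵥ fun j => orthonormalized μ ψ (Y₂ 0) j y) ⬝ᵥ Z =
        (P *ᵥ fun j => orthonormalized μ ψ (Y₂ 0) j z) ⬝ᵥ Z +
        (P *ᵥ ((fun j => orthonormalized μ ψ (Y₂ 0) j y) -
          fun j => orthonormalized μ ψ (Y₂ 0) j z)) ⬝ᵥ Z := by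
      rw [Matrix.mulVec_sub, sub_dotProduct]
      ring
    rw [e]
    refine (abs_add_le _ _).trans (add_le_add ?_ ?_)
    · set v := P *ᵥ fun j => orthonormalized μ ψ (Y₂ 0) j z with hv
      have hw : ∀ i : ℕ, (v ⬝ᵥ fun k => orthonormalized μ b (X 0) k (X ((i : ℤ) + 1) ω)) =
          gridWeight μ ψ b X Y₂ N k i ω := fun i => (weight_of_mem v (hX _)).symm
      rw [hZ, dotProduct_score n ω (fun i => ε ((i : ℤ) + 1) ω) v, abs_mul,
        abs_of_nonneg (by positivity : (0 : ℝ) ≤ (n : ℝ)⁻¹)]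
      refine mul_le_mul_of_nonneg_left ?_ (by positivity)
      have hsq := sum_dotProduct_sq_le (b := b) hn ω
        ((specNorm_gramHat_sub_one_le hψ hb hJ hσ hme).trans (by norm_num)) v
      simp only [hw] at hsq ⊢
      have hvle : euc v ≤ σ⁻¹ * (√l⁻¹ * c) := euc_loading_orthonormalized_le hψ hσ hzc
      -- Closeness of Ĝ to I discharges the condition on the squared weights.
      have h1 := ht k (hsq.trans (by
        have := pow_le_pow_left₀ (euc_nonneg v) hvle 2
        gcongr))
      have e2 : ∑ i ∈ Finset.range n, gridWeight μ ψ b X Y₂ N k i ω * ε ((i : ℤ) + 1) ω =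
          ∑ i ∈ Finset.range n, gridWeight μ ψ b X Y₂ N k i ω * ξ i ω +
          ∑ i ∈ Finset.range n, gridWeight μ ψ b X Y₂ N k i ω * (ε ((i : ℤ) + 1) ω - ξ i ω) := by
        rw [← Finset.sum_add_distrib]
        exact Finset.sum_congr rfl fun i _ => by ring
      rw [e2]
      refine (abs_add_le _ _).trans (add_le_add h1 ?_)
      refine (Finset.abs_sum_le_sum_abs _ _).trans ?_
      refine le_trans ?_ (mul_le_mul_of_nonneg_left hs (by positivity))
      rw [Finset.mul_sum]
      refine Finset.sum_le_sum fun i _ => ?_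
      rw [abs_mul]
      exact mul_le_mul_of_nonneg_right (abs_gridWeight_le hψ hb hc' hσ N k i ω) (abs_nonneg _)
    · refine (abs_dotProduct_le _ _).trans ?_
      have h1 := euc_loading_mulVec_le hσ ((fun j => orthonormalized μ ψ (Y₂ 0) j y) -
          fun j => orthonormalized μ ψ (Y₂ 0) j z)
      have h2 := hψ.euc_orthonormalized_sub_le hM hM0 hy hzc
      have h3 : ‖y - z‖ ^ min γ 1 ≤ (√d / N) ^ min γ 1 :=
        Real.rpow_le_rpow (norm_nonneg _) hk (by positivity)
      have h4 : √l⁻¹ * (√J * (M * ‖y - z‖ ^ min γ 1)) ≤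
        √l⁻¹ * (√J * (M * (√d / N) ^ min γ 1)) := by gcongr
      have h5 := mul_le_mul (h1.trans (mul_le_mul_of_nonneg_left (h2.trans h4) hσ0)) hq
        (euc_nonneg _) (by positivity)
      exact h5.trans_eq (by ring)
  · have h1 := hψ.euc_orthonormalized_le hy
    have h2 : 24 * σ⁻¹ * matrixError μ n ψ b X Y₂ ω * euc Z ≤ 24 * σ⁻¹ * em * q := by
      have := euc_nonneg Z
      gcongr
    exact (mul_le_mul_of_nonneg_left h2 (euc_nonneg _)).trans
      (mul_le_mul_of_nonneg_right h1 (by positivity))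

end Uniform

/-! ### Growth of the dimensions -/

theorem eventually_one_le_log : ∀ᶠ n : ℕ in atTop, 1 ≤ Real.log n :=
  (Real.tendsto_log_atTop.comp tendsto_natCast_atTop_atTop).eventually_ge_atTop 1

theorem exists_le_rpow_of_isBigO {K : ℕ → ℕ} {θ : ℝ}
    (h : (fun n : ℕ => (K n : ℝ)) =O[atTop] fun n : ℕ => ((n : ℝ) / Real.log n) ^ θ) :
    ∃ C : ℝ, 0 < C ∧ ∀ᶠ n : ℕ in atTop, (K n : ℝ) ≤ C * ((n : ℝ) / Real.log n) ^ θ := by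
  obtain ⟨C, hC, hb⟩ := h.exists_pos
  refine ⟨C, hC, ?_⟩
  filter_upwards [hb.bound, eventually_one_le_log] with n hn hl
  rw [Real.norm_of_nonneg (Nat.cast_nonneg _), Real.norm_of_nonneg (by positivity)] at hn
  exact hn

theorem eventually_le_of_le_rpow {K : ℕ → ℕ} {θ C : ℝ} (hθ0 : 0 ≤ θ) (hθ : θ < 1)
    (h : ∀ᶠ n : ℕ in atTop, (K n : ℝ) ≤ C * ((n : ℝ) / Real.log n) ^ θ) :
    ∀ᶠ n : ℕ in atTop, K n ≤ n := by
  have ht : Tendsto (fun n : ℕ => (n : ℝ) ^ (1 - θ)) atTop atTop :=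
    (tendsto_rpow_atTop (by linarith)).comp tendsto_natCast_atTop_atTop
  filter_upwards [h, eventually_one_le_log, ht.eventually_ge_atTop C, eventually_gt_atTop 0] with
    n h1 h2 h3 h4
  have hn : (0 : ℝ) < n := Nat.cast_pos.2 h4
  have h5 : ((n : ℝ) / Real.log n) ^ θ ≤ (n : ℝ) ^ θ :=
    Real.rpow_le_rpow (by positivity) (div_le_self hn.le h2) hθ0
  have h6 : (K n : ℝ) ≤ n := by
    calc (K n : ℝ) ≤ C * ((n : ℝ) / Real.log n) ^ θ := h1
      _ ≤ (n : ℝ) ^ (1 - θ) * (n : ℝ) ^ θ := by gcongr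
      _ = n := by rw [← Real.rpow_add hn, sub_add_cancel, Real.rpow_one]
  exact_mod_cast h6

/-- The truncation level `√(n / (K log n))`. -/
noncomputable def truncLevel (n K : ℕ) : ℝ := √(n / (K * Real.log n))

/-- With x = K log n / n the truncation level is x^(-1/2), so the left side is K x^(δ/2) √x. The
growth bound on K, raised to the power 1 + δ/2, says precisely that K x^(δ/2) is bounded. -/
theorem mul_truncLevel_rpow_le {n K : ℕ} {δ C : ℝ} (hδ : 0 < δ) (hC : 0 ≤ C) (hn : 0 < n)
    (hK : 0 < K) (hl : 1 ≤ Real.log n)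
    (h : (K : ℝ) ≤ C * ((n : ℝ) / Real.log n) ^ (δ / (2 + δ))) :
    K * truncLevel n K ^ (-(1 + δ)) ≤ C ^ (1 + δ / 2) * √(K * Real.log n / n) := by
  have hn' : (0 : ℝ) < n := Nat.cast_pos.2 hn
  have hK' : (0 : ℝ) < K := Nat.cast_pos.2 hK
  set L : ℝ := n / Real.log n with hL
  have hL0 : 0 < L := by positivity
  set x : ℝ := K * Real.log n / n with hx
  have hx0 : 0 < x := by positivity
  have hxL : x = K / L := by rw [hx, hL]; field_simp
  have e1 : truncLevel n K ^ (-(1 + δ)) = x ^ ((1 + δ) / 2) := by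
    have : (n : ℝ) / (K * Real.log n) = x⁻¹ := by rw [hx, inv_div]
    rw [truncLevel, this, Real.sqrt_inv, Real.inv_rpow (Real.sqrt_nonneg _), Real.rpow_neg
      (Real.sqrt_nonneg _), inv_inv, Real.sqrt_eq_rpow, ← Real.rpow_mul hx0.le]
    congr 1
    ring
  have e2 : x ^ ((1 + δ) / 2) = x ^ (δ / 2) * √x := by
    rw [Real.sqrt_eq_rpow, ← Real.rpow_add hx0]
    congr 1
    ring
  have h3 : (K : ℝ) ^ (1 + δ / 2) ≤ C ^ (1 + δ / 2) * L ^ (δ / 2) := by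
    refine (Real.rpow_le_rpow hK'.le h (by positivity)).trans_eq ?_
    rw [Real.mul_rpow hC (by positivity), ← Real.rpow_mul hL0.le]
    congr 2
    field_simp
  have h4 : K * x ^ (δ / 2) ≤ C ^ (1 + δ / 2) := by
    rw [hxL, Real.div_rpow hK'.le hL0.le, ← mul_div_assoc, div_le_iff₀ (by positivity)]
    rwa [Real.rpow_add hK', Real.rpow_one] at h3
  rw [e1, e2, ← mul_assoc]
  exact mul_le_mul_of_nonneg_right h4 (Real.sqrt_nonneg _)

/-- The grid has at most 2^d n^(md) points; the extra 1 in md + 1 leaves a probability of order 1/n.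
-/
theorem card_grid_mul_exp_le {n : ℕ} (hn : 0 < n) (m d : ℕ) :
    (Fintype.card (Fin d → Fin (n ^ m + 1)) : ℝ≥0∞) *
      (2 * ENNReal.ofReal (Real.exp (-((m * d + 1 : ℕ) * Real.log n)))) ≤
    ENNReal.ofReal (2 ^ (d + 1) / n) := by
  have hn' : (0 : ℝ) < n := Nat.cast_pos.2 hn
  have e1 : Real.exp (-((m * d + 1 : ℕ) * Real.log n)) = ((n : ℝ) ^ (m * d + 1))⁻¹ := by
    rw [Real.exp_neg, Real.exp_nat_mul, Real.exp_log hn']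
  have e2 : (Fintype.card (Fin d → Fin (n ^ m + 1)) : ℝ≥0∞) =
      ENNReal.ofReal (((n : ℝ) ^ m + 1) ^ d) := by
    rw [Fintype.card_fun, Fintype.card_fin, Fintype.card_fin, ← ENNReal.ofReal_natCast]
    push_cast
    rfl
  have e3 : (2 : ℝ≥0∞) = ENNReal.ofReal 2 := by simp
  rw [e1, e2, e3, ← ENNReal.ofReal_mul (by norm_num), ← ENNReal.ofReal_mul (by positivity)]
  refine ENNReal.ofReal_le_ofReal ?_
  have h1 : (1 : ℝ) ≤ (n : ℝ) ^ m := one_le_pow₀ (by exact_mod_cast hn)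
  have h2 : ((n : ℝ) ^ m + 1) ^ d ≤ 2 ^ d * (n : ℝ) ^ (m * d) := by
    rw [pow_mul, ← mul_pow]
    refine pow_le_pow_left₀ (by positivity) (by linarith) d
  calc ((n : ℝ) ^ m + 1) ^ d * (2 * ((n : ℝ) ^ (m * d + 1))⁻¹)
      ≤ 2 ^ d * (n : ℝ) ^ (m * d) * (2 * ((n : ℝ) ^ (m * d + 1))⁻¹) := by gcongr
    _ = 2 ^ (d + 1) / n := by
      rw [pow_succ, pow_succ]
      field_simp

/-- A mesh n^(-m) absorbs the polynomial growth of the Hölder constants: the power of n that remains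
is 1/2 + |α| - mg ≤ 0. -/
theorem holder_grid_bound {n J m d : ℕ} {C α g : ℝ} (hn : 0 < n) (hJ : 0 < J) (hJn : J ≤ n)
    (hg : 0 < g) (hm : (1 / 2 + |α|) / g ≤ m) :
    √J * (|C| * (J : ℝ) ^ |α| * (√d / (n ^ m : ℕ)) ^ g) ≤ |C| * √d ^ g := by
  have hn' : (0 : ℝ) < n := Nat.cast_pos.2 hn
  have hn1 : (1 : ℝ) ≤ n := by exact_mod_cast hn
  have hJn' : (J : ℝ) ≤ n := by exact_mod_cast hJn
  have h1 : √J ≤ (n : ℝ) ^ (1 / 2 : ℝ) := by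
    rw [← Real.sqrt_eq_rpow]
    exact Real.sqrt_le_sqrt hJn'
  have h2 : (J : ℝ) ^ |α| ≤ (n : ℝ) ^ |α| := by gcongr
  have h3 : (√d / (n ^ m : ℕ)) ^ g = √d ^ g * (n : ℝ) ^ (-(m * g)) := by
    rw [Real.div_rpow (Real.sqrt_nonneg _) (by positivity), Real.rpow_neg hn'.le, div_eq_mul_inv,
      Real.rpow_mul hn'.le, Real.rpow_natCast]
    push_cast
    rfl
  rw [div_le_iff₀ hg] at hm
  rw [h3]
  calc √J * (|C| * (J : ℝ) ^ |α| * (√d ^ g * (n : ℝ) ^ (-(m * g))))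
      ≤ (n : ℝ) ^ (1 / 2 : ℝ) * (|C| * (n : ℝ) ^ |α| * (√d ^ g * (n : ℝ) ^ (-(m * g)))) := by
        gcongr
    _ = |C| * √d ^ g * ((n : ℝ) ^ (1 / 2 : ℝ) * (n : ℝ) ^ |α| * (n : ℝ) ^ (-(m * g))) := by ring
    _ = |C| * √d ^ g * (n : ℝ) ^ (1 / 2 + |α| + -(m * g)) := by
        rw [Real.rpow_add hn', Real.rpow_add hn']
    _ ≤ |C| * √d ^ g * 1 := by
        gcongr
        exact Real.rpow_le_one_of_one_le_of_nonpos hn1 (by linarith)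
    _ = _ := mul_one _

/-! ### The tail of the uniform estimation error -/

/-- Bookkeeping for the tilt u = √(log n / (nK)): at deviation n√(K log n / n) the exponent is log
n, the increments satisfy KuM = 1 at truncation level M, and the variance term is log n. -/
theorem sqrt_relations {n K : ℕ} (hn : 0 < n) (hK : 0 < K) (hl : 1 ≤ Real.log n) :
    n * √(Real.log n / (n * K)) * √(K * Real.log n / n) = Real.log n ∧
    K * √(Real.log n / (n * K)) * truncLevel n K = 1 ∧
    √(Real.log n / (n * K)) ^ 2 * n * K = Real.log n ∧
    √(K : ℝ) * √(Real.log n / K) * √(K / n) = √(K * Real.log n / n) ∧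
    √((K : ℝ) / n) ≤ √(K * Real.log n / n) := by
  have hn' : (0 : ℝ) < n := Nat.cast_pos.2 hn
  have hK' : (0 : ℝ) < K := Nat.cast_pos.2 hK
  have hl' : 0 < Real.log n := by linarith
  refine ⟨?_, ?_, ?_, ?_, ?_⟩
  · rw [mul_assoc, ← Real.sqrt_mul (by positivity)]
    have : Real.log n / (n * K) * (K * Real.log n / n) = (Real.log n / n) ^ 2 := by field_simp
    rw [this, Real.sqrt_sq (by positivity)]
    field_simp
  · rw [truncLevel, mul_assoc, ← Real.sqrt_mul (by positivity)]
    have : Real.log n / (n * K) * (n / (K * Real.log n)) = (1 / K : ℝ) ^ 2 := by field_simp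
    rw [this, Real.sqrt_sq (by positivity)]
    field_simp
  · rw [Real.sq_sqrt (by positivity)]
    field_simp
  · rw [← Real.sqrt_mul (by positivity), ← Real.sqrt_mul (by positivity)]
    congr 1
    field_simp
  · refine Real.sqrt_le_sqrt ?_
    gcongr
    nlinarith

section TailBound

variable {Ω : Type*} [MeasurableSpace Ω] {d J K : ℕ} {μ : Measure Ω} [IsProbabilityMeasure μ]
  {ψ : Fin J → Pt d → ℝ} {b : Fin K → Pt d → ℝ}
  {X Y₂ : ℤ → Ω → Pt d} {Y₁ ε : ℤ → Ω → ℝ} {h₀ : Pt d → ℝ} {l c l' c' : ℝ}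

/-- Bernstein-type bound with tilt c₀σu, c₀ = (2 √l⁻¹ c √l'⁻¹ c')⁻¹. Both the variance term and the
linear term of the exponent are multiples of log n, and `hA` takes A large enough for the exponent
to be at most -(md + 1) log n. -/
theorem measure_exists_gridWeight_le {C A : ℝ}
    (hψ : IsGoodBasis μ ψ (Y₂ 0) l (c * √J)) (hb : IsGoodBasis μ b (X 0) l' (c' * √K))
    (hc : 0 < c) (hc' : 0 < c') (hC : 0 ≤ C)
    (hmds : IsMDS μ (fun i : ℕ => past X ε ((i : ℤ) + 1)) (fun i => ε ((i : ℤ) + 1)) C)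
    (hσ : 0 < sigmaJK μ ψ b X Y₂) {n m : ℕ} (hn : 0 < n) (hl : 1 ≤ Real.log n) (hK : 0 < K)
    (hJK : J ≤ K)
    (hA : 2 * (2 * (√l⁻¹ * c * (√l'⁻¹ * c')))⁻¹ ^ 2 * C * (√l⁻¹ * c) ^ 2 + (m * d + 1 : ℕ) ≤
      (2 * (√l⁻¹ * c * (√l'⁻¹ * c')))⁻¹ * A) :
    μ {ω | ∃ k : Fin d → Fin (n ^ m + 1),
        n * (A * rate (sigmaJK μ ψ b X Y₂) K n) < |∑ i ∈ Finset.range n,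
          gridWeight μ ψ b X Y₂ (n ^ m) k i ω *
            ctrunc μ (past X ε ((i : ℤ) + 1)) (ε ((i : ℤ) + 1)) (truncLevel n K) ω| ∧
        ∑ i ∈ Finset.range n, gridWeight μ ψ b X Y₂ (n ^ m) k i ω ^ 2 ≤
          2 * n * ((sigmaJK μ ψ b X Y₂)⁻¹ * (√l⁻¹ * (c * √J))) ^ 2} ≤
      ENNReal.ofReal (2 ^ (d + 1) / n) := by
  set σ := sigmaJK μ ψ b X Y₂ with hσdef
  set c₀ := (2 * (√l⁻¹ * c * (√l'⁻¹ * c')))⁻¹ with hc₀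
  have hlp := hψ.pos
  have hlp' := hb.pos
  have hs1 : 0 < √l⁻¹ := Real.sqrt_pos.2 (inv_pos.2 hlp)
  have hs2 : 0 < √l'⁻¹ := Real.sqrt_pos.2 (inv_pos.2 hlp')
  have hc₀pos : 0 < c₀ := by positivity
  have hc₀eq : c₀ * (2 * (√l⁻¹ * c * (√l'⁻¹ * c'))) = 1 := inv_mul_cancel₀ (by positivity)
  obtain ⟨r1, r2, r3, -, -⟩ := sqrt_relations hn hK hl
  set u := √(Real.log n / (n * K)) with hu
  set M := truncLevel n K with hM
  have hM0 : 0 ≤ M := Real.sqrt_nonneg _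
  have hu0 : 0 ≤ u := Real.sqrt_nonneg _
  have hn' : (0 : ℝ) < n := Nat.cast_pos.2 hn
  have hK' : (0 : ℝ) < K := Nat.cast_pos.2 hK
  have hJK' : (J : ℝ) ≤ K := by exact_mod_cast hJK
  have hsJ : √(J : ℝ) ≤ √(K : ℝ) := Real.sqrt_le_sqrt hJK'
  have hσσ : σ * σ⁻¹ = 1 := mul_inv_cancel₀ hσ.ne'
  -- The constant c₀ is chosen so that tilt times increment is at most √(JK) uM ≤ KuM = 1.
  have hlam : c₀ * σ * u * (σ⁻¹ * (√l⁻¹ * (c * √J)) * (√l'⁻¹ * (c' * √K))) * (2 * M) ≤ 1 := by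
    calc c₀ * σ * u * (σ⁻¹ * (√l⁻¹ * (c * √J)) * (√l'⁻¹ * (c' * √K))) * (2 * M)
        = (σ * σ⁻¹) * (c₀ * (2 * (√l⁻¹ * c * (√l'⁻¹ * c')))) * ((√J * √K) * u * M) := by ring
      _ = (√J * √K) * u * M := by rw [hσσ, hc₀eq]; ring
      _ ≤ (√K * √K) * u * M := by gcongr
      _ = 1 := by rw [Real.mul_self_sqrt hK'.le, r2]
  have hmeas : ∀ (k : Fin d → Fin (n ^ m + 1)) (i : ℕ),
      StronglyMeasurable[past X ε ((i : ℤ) + 1)] (gridWeight μ ψ b X Y₂ (n ^ m) k i) := fun k i =>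
    ((measurable_weight hb.cont _).comp (measurable_past_X le_rfl)).stronglyMeasurable
  have key := (hmds.isBoundedMDS_ctrunc hM0).measure_exists_lt_abs_sum_le hC
    (w := fun k : Fin d → Fin (n ^ m + 1) => gridWeight μ ψ b X Y₂ (n ^ m) k) hmeas
    (fun k i ω => abs_gridWeight_le hψ hb (by positivity) hσ (n ^ m) k i ω)
    (l := c₀ * σ * u) (by positivity) hlam n (n * (A * rate σ K n))
    (2 * n * (σ⁻¹ * (√l⁻¹ * (c * √J))) ^ 2)
  refine key.trans (le_trans ?_ (card_grid_mul_exp_le hn m d))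
  gcongr
  have e1 : (c₀ * σ * u) ^ 2 * C * (2 * n * (σ⁻¹ * (√l⁻¹ * (c * √J))) ^ 2) ≤
      2 * c₀ ^ 2 * C * (√l⁻¹ * c) ^ 2 * Real.log n := by
    calc (c₀ * σ * u) ^ 2 * C * (2 * n * (σ⁻¹ * (√l⁻¹ * (c * √J))) ^ 2)
        = (σ * σ⁻¹) ^ 2 * (2 * c₀ ^ 2 * C * (√l⁻¹ * c) ^ 2) * (u ^ 2 * n * √J ^ 2) := by ring
      _ = (2 * c₀ ^ 2 * C * (√l⁻¹ * c) ^ 2) * (u ^ 2 * n * J) := by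
          rw [hσσ, Real.sq_sqrt J.cast_nonneg]; ring
      _ ≤ (2 * c₀ ^ 2 * C * (√l⁻¹ * c) ^ 2) * (u ^ 2 * n * K) := by gcongr
      _ = _ := by rw [r3]
  have e2 : c₀ * σ * u * (n * (A * rate σ K n)) = c₀ * A * Real.log n := by
    rw [rate]
    calc c₀ * σ * u * (n * (A * (σ⁻¹ * √(K * Real.log n / n))))
        = (σ * σ⁻¹) * (c₀ * A) * (n * u * √(K * Real.log n / n)) := by ring
      _ = _ := by rw [hσσ, r1]; ring
  rw [e2]
  have := mul_le_mul_of_nonneg_right hA (by linarith : 0 ≤ Real.log n)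
  linarith

/-- M₁, M₃, M₄ and A are the multiples of their natural scales at which the matrix error, the score,
the discarded errors and the truncated grid sums are declared too large. -/
theorem measure_lt_supNorm_le {C A δ Q CK Cψ α γ M₁ M₃ M₄ : ℝ}
    (hψ : IsGoodBasis μ ψ (Y₂ 0) l (c * √J)) (hb : IsGoodBasis μ b (X 0) l' (c' * √K))
    (hc : 0 < c) (hc' : 0 < c') (hC : 0 ≤ C) (hδ : 0 < δ) (hγ : 0 < γ)
    (hmds : IsMDS μ (fun i : ℕ => past X ε ((i : ℤ) + 1)) (fun i => ε ((i : ℤ) + 1)) C)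
    (hmom : ∀ i : ℕ, Integrable (fun ω => |ε ((i : ℤ) + 1) ω| ^ (2 + δ)) μ)
    (hQ : ∀ i : ℕ, ∫ ω, |ε ((i : ℤ) + 1) ω| ^ (2 + δ) ∂μ ≤ Q)
    (hae : ∀ᵐ ω ∂μ, (∀ i, X i ω ∈ unitCube d) ∧ ∀ i, Y₁ i ω = h₀ (Y₂ i ω) + ε i ω)
    (hhol : ∀ j, IsHolderWith γ (|Cψ| * (J : ℝ) ^ |α|) (ψ j))
    (hσ : 0 < sigmaJK μ ψ b X Y₂) {n m : ℕ} (hn : 0 < n) (hl : 1 ≤ Real.log n) (hJ : 0 < J)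
    (hK : 0 < K) (hJK : J ≤ K) (hKn : K ≤ n) (hCK : 0 ≤ CK)
    (hKrate : (K : ℝ) ≤ CK * ((n : ℝ) / Real.log n) ^ (δ / (2 + δ)))
    (hm : (1 / 2 + |α|) / min γ 1 ≤ m)
    (hA : 2 * (2 * (√l⁻¹ * c * (√l'⁻¹ * c')))⁻¹ ^ 2 * C * (√l⁻¹ * c) ^ 2 + (m * d + 1 : ℕ) ≤
      (2 * (√l⁻¹ * c * (√l'⁻¹ * c')))⁻¹ * A)
    (hM₁ : 0 < M₁) (hM₃ : 0 < M₃) (hM₄ : 0 < M₄) :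
    μ {ω | (A + √l⁻¹ * c * (√l'⁻¹ * c') * M₄ * CK ^ (1 + δ / 2) + √l⁻¹ * (|Cψ| * √d ^ min γ 1) * M₃
          + 24 * (√l⁻¹ * c) * M₁ * M₃) * rate (sigmaJK μ ψ b X Y₂) K n <
        (supNorm fun y => hHat n ψ b X Y₁ Y₂ ω y - projN μ n ψ b X Y₂ h₀ ω y).toReal} ≤
      μ {ω | M₁ * √(Real.log n / K) < |matrixError μ n ψ b X Y₂ ω|} +
      μ {ω | ENNReal.ofReal (1 / 4) ≤ edist (matrixError μ n ψ b X Y₂ ω) 0} +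
      ENNReal.ofReal (C * (√l'⁻¹ * c') ^ 2 / M₃ ^ 2) +
      ENNReal.ofReal (2 * Q / M₄) + ENNReal.ofReal (2 ^ (d + 1) / n) := by
  set σ := sigmaJK μ ψ b X Y₂ with hσdef
  have hn' : (0 : ℝ) < n := Nat.cast_pos.2 hn
  have hK' : (0 : ℝ) < K := Nat.cast_pos.2 hK
  have hJK' : (J : ℝ) ≤ K := by exact_mod_cast hJK
  have hsJ : √(J : ℝ) ≤ √(K : ℝ) := Real.sqrt_le_sqrt hJK'
  have hlp : 0 < Real.log n := by linarith
  set M := truncLevel n K with hM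
  have hM0 : 0 < M := Real.sqrt_pos.2 (by positivity)
  set q := M₃ * √(K / n) with hq
  have hq0 : 0 < q := by positivity
  set s := M₄ * (n * M ^ (-(1 + δ))) with hs
  have hs0 : 0 < s := by positivity
  set t := n * (A * rate σ K n) with ht
  have hg : 0 < min γ 1 := lt_min hγ one_pos
  have hZ := hb.measure_lt_euc_score_le (by positivity) hC hmds (hae.mono fun ω h => h.1) hn.ne' hq0
  have hZ' : C * (√l'⁻¹ * (c' * √K)) ^ 2 / (n * q ^ 2) = C * (√l'⁻¹ * c') ^ 2 / M₃ ^ 2 := by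
    rw [hq, mul_pow M₃, Real.sq_sqrt (by positivity), ← mul_assoc, mul_pow _ √(K : ℝ),
      Real.sq_sqrt hK'.le]
    field_simp
  rw [hZ'] at hZ
  have hR := hmds.measure_le_sum_abs_sub_ctrunc_le hM0 hδ hmom hQ hs0 n
  have hR' : n * (2 * (M ^ (-(1 + δ)) * Q)) / s = 2 * Q / M₄ := by
    have : 0 < M ^ (-(1 + δ)) := by positivity
    rw [hs]
    field_simp
  rw [hR'] at hR
  have hG := measure_exists_gridWeight_le (m := m) hψ hb hc hc' hC hmds hσ hn hl hK hJK hA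
  rw [← hσdef, ← hM, ← ht] at hG
  -- It suffices to bound the sup-norm off five events: matrix error above its rate, matrix error at
  -- least 1/4, large score, large discarded errors, and a large truncated sum at some grid point.
  refine le_trans (measure_mono_ae ?_) ((measure_union_le _ _).trans (add_le_add
    ((measure_union_le _ _).trans (add_le_add
      ((measure_union_le _ _).trans (add_le_add (measure_union_le _ _) hZ)) hR)) hG))
  filter_upwards [hae] with ω hω hlt
  refine by_contra fun hnot : ω ∉ (_ : Set Ω) => ?_
  simp only [Set.mem_union, Set.mem_ofPred_eq, not_or, not_lt, not_le] at hnot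
  obtain ⟨⟨⟨⟨n1, n2⟩, n3⟩, n4⟩, n5⟩ := hnot
  suffices hle : (supNorm fun y => hHat n ψ b X Y₁ Y₂ ω y - projN μ n ψ b X Y₂ h₀ ω y).toReal ≤
      (A + √l⁻¹ * c * (√l'⁻¹ * c') * M₄ * CK ^ (1 + δ / 2) + √l⁻¹ * (|Cψ| * √d ^ min γ 1) * M₃
          + 24 * (√l⁻¹ * c) * M₁ * M₃) * rate σ K n from absurd hle (not_le.2 hlt)
  have hme : matrixError μ n ψ b X Y₂ ω ≤ 1 / 4 := by
    rw [edist_zero_right, Real.enorm_eq_ofReal_abs, ENNReal.ofReal_lt_ofReal_iff (by norm_num)] at n2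
    exact (le_abs_self _).trans n2.le
  have hr0 : 0 ≤ rate σ K n := mul_nonneg (inv_nonneg.2 hσ.le) (Real.sqrt_nonneg _)
  have hs1 : 0 < √l⁻¹ := Real.sqrt_pos.2 (inv_pos.2 hψ.pos)
  have hs2 : 0 < √l'⁻¹ := Real.sqrt_pos.2 (inv_pos.2 hb.pos)
  have hA0 : 0 ≤ A := by
    have h1 : 0 ≤ (2 * (√l⁻¹ * c * (√l'⁻¹ * c')))⁻¹ * A := le_trans (by positivity) hA
    exact nonneg_of_mul_nonneg_right h1 (by positivity)
  refine ENNReal.toReal_le_of_le_ofReal (by positivity)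
    (supNorm_le_of_forall_abs_le fun y hy => ?_)
  refine (abs_hHat_sub_projN_le_of_grid hψ hb (by positivity) (by positivity) hJ hσ hn.ne' hme
    ((le_abs_self _).trans n1) (by positivity) hω.2 hω.1 hγ hhol (by positivity) n3.le
    (ξ := fun i => ctrunc μ (past X ε ((i : ℤ) + 1)) (ε ((i : ℤ) + 1)) M) n4.le
    (N := n ^ m) (by positivity) (t := t) (fun k hk => ?_) hy).trans ?_
  · by_contra hcon
    exact n5 ⟨k, not_le.1 hcon, hk⟩
  obtain ⟨-, -, -, r4, r5⟩ := sqrt_relations hn hK hl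
  have hσ0 : 0 < σ⁻¹ := inv_pos.2 hσ
  have b1 : (n : ℝ)⁻¹ * (t + σ⁻¹ * (√l⁻¹ * (c * √J)) * (√l'⁻¹ * (c' * √K)) * s) ≤
      A * rate σ K n + √l⁻¹ * c * (√l'⁻¹ * c') * M₄ * CK ^ (1 + δ / 2) * rate σ K n := by
    have h1 := mul_truncLevel_rpow_le hδ hCK hn hK hl hKrate
    calc (n : ℝ)⁻¹ * (t + σ⁻¹ * (√l⁻¹ * (c * √J)) * (√l'⁻¹ * (c' * √K)) * s)
        = A * rate σ K n +
            √l⁻¹ * c * (√l'⁻¹ * c') * M₄ * σ⁻¹ * ((√J * √K) * M ^ (-(1 + δ))) := by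
          rw [ht, hs]
          field_simp
      _ ≤ A * rate σ K n +
            √l⁻¹ * c * (√l'⁻¹ * c') * M₄ * σ⁻¹ * ((√K * √K) * M ^ (-(1 + δ))) := by gcongr
      _ ≤ A * rate σ K n + √l⁻¹ * c * (√l'⁻¹ * c') * M₄ * σ⁻¹ *
            (CK ^ (1 + δ / 2) * √(K * Real.log n / n)) := by
          rw [Real.mul_self_sqrt hK'.le]
          gcongr
      _ = _ := by rw [rate]; ring
  have b2 : √l⁻¹ * (√J * (|Cψ| * (J : ℝ) ^ |α| * (√d / (n ^ m : ℕ)) ^ min γ 1)) * (σ⁻¹ * q) ≤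
      √l⁻¹ * (|Cψ| * √d ^ min γ 1) * M₃ * rate σ K n := by
    have h1 := holder_grid_bound (d := d) (C := Cψ) (α := α) hn hJ (hJK.trans hKn) hg hm
    calc _ ≤ √l⁻¹ * (|Cψ| * √d ^ min γ 1) * (σ⁻¹ * (M₃ * √(K * Real.log n / n))) := by
          rw [hq]; gcongr
      _ = _ := by rw [rate]; ring
  have b3 : √l⁻¹ * (c * √J) * (24 * σ⁻¹ * (M₁ * √(Real.log n / K)) * q) ≤
      24 * (√l⁻¹ * c) * M₁ * M₃ * rate σ K n := by
    calc _ = 24 * (√l⁻¹ * c) * M₁ * M₃ * σ⁻¹ * (√J * √(Real.log n / K) * √(K / n)) := by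
          rw [hq]; ring
      _ ≤ 24 * (√l⁻¹ * c) * M₁ * M₃ * σ⁻¹ * (√K * √(Real.log n / K) * √(K / n)) := by gcongr
      _ = _ := by rw [r4, rate]; ring
  exact (add_le_add (add_le_add b1 b2) b3).trans_eq (by ring)

end TailBound

/-! ### Choice of constants and the main theorem. -/

theorem IsHolderWith.mono {d : ℕ} {γ M M' : ℝ} {f : Pt d → ℝ} (h : IsHolderWith γ M f)
    (hM : M ≤ M') : IsHolderWith γ M' f :=
  ⟨h.contDiffOn, fun j hj y hy => (h.bound j hj y hy).trans hM, fun y hy z hz =>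
    (h.holder y hy z hz).trans (by gcongr)⟩

theorem mul_rpow_le_abs_mul_rpow_abs {J : ℕ} (hJ : 0 < J) (C α : ℝ) :
    C * (J : ℝ) ^ α ≤ |C| * (J : ℝ) ^ |α| := by
  have hJ1 : (1 : ℝ) ≤ J := by exact_mod_cast hJ
  have h1 : (J : ℝ) ^ α ≤ (J : ℝ) ^ |α| := Real.rpow_le_rpow_of_exponent_le hJ1 (le_abs_self α)
  have h2 : C ≤ |C| := le_abs_self C
  gcongr

theorem exists_pos_five_mul_ofReal_le {η : ℝ≥0∞} (hη : 0 < η) :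
    ∃ r : ℝ, 0 < r ∧ ENNReal.ofReal r + ENNReal.ofReal r + ENNReal.ofReal r + ENNReal.ofReal r +
      ENNReal.ofReal r ≤ η := by
  obtain ⟨x, hx0, hx⟩ := ENNReal.lt_iff_exists_real_btwn.1 hη
  have hx1 : 0 < x := ENNReal.ofReal_pos.1 hx.1
  refine ⟨x / 5, by positivity, ?_⟩
  have h5 : 0 ≤ x / 5 := by positivity
  rw [← ENNReal.ofReal_add h5 h5, ← ENNReal.ofReal_add (by positivity) h5,
    ← ENNReal.ofReal_add (by positivity) h5, ← ENNReal.ofReal_add (by positivity) h5]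
  refine le_trans (le_of_eq ?_) hx.2.le
  congr 1
  ring

end NPIV

theorem mainTheorem2 {Ω : Type*} [MeasurableSpace Ω] (μ : Measure Ω) [IsProbabilityMeasure μ]
    {d : ℕ} (X : ℤ → Ω → NPIV.Pt d) (Y₁ : ℤ → Ω → ℝ) (Y₂ : ℤ → Ω → NPIV.Pt d)
    (ε : ℤ → Ω → ℝ) (h₀ : NPIV.Pt d → ℝ) (ψ b : NPIV.SieveBasis d)
    (δ p γ γx : ℝ) (hδ : 0 < δ) (hp : 0 < p) (hγ : p < γ) (hγx : γ ≤ γx)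
    (hModel : NPIV.Model μ X Y₁ Y₂ ε h₀)
    (hData : NPIV.DataAssumption μ X Y₁ Y₂)
    (hResid : NPIV.ResidAssumption μ X ε δ)
    (hψ : NPIV.PsiAssumption μ ψ (Y₂ 0) γ)
    (hb : NPIV.BAssumption μ b (X 0) γx)
    (J K : ℕ → ℕ) (hJ : Tendsto J atTop atTop) (hK : Tendsto K atTop atTop)
    (hσ : ∀ᶠ n in atTop, 0 < NPIV.sigmaJK μ (ψ (J n)) (b (K n)) X Y₂)
    (hJK : ∀ᶠ n in atTop, J n ≤ K n)
    (hKn : (fun n : ℕ => (K n : ℝ)) =O[atTop]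
      fun n : ℕ => ((n : ℝ) / Real.log n) ^ (δ / (2 + δ)))
    (hrate : (fun n : ℕ => NPIV.rate (NPIV.sigmaJK μ (ψ (J n)) (b (K n)) X Y₂) (K n) n)
      =O[atTop] fun _ => (1 : ℝ))
    (hOp : NPIV.IsBigOp μ (fun n => NPIV.matrixError μ n (ψ (J n)) (b (K n)) X Y₂)
      fun n => √(Real.log n / (K n : ℝ)))
    (hop : NPIV.IsLittleOpOne μ (fun n => NPIV.matrixError μ n (ψ (J n)) (b (K n)) X Y₂)) :
    ∃ R : ℕ → Ω → ℝ,
      NPIV.IsBigOp μ R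
        (fun n => NPIV.rate (NPIV.sigmaJK μ (ψ (J n)) (b (K n)) X Y₂) (K n) n) ∧
      ∀ n ω,
        NPIV.supNorm (fun y => h₀ y - NPIV.hHat n (ψ (J n)) (b (K n)) X Y₁ Y₂ ω y) ≤
          NPIV.supNorm (fun y => h₀ y - NPIV.projN μ n (ψ (J n)) (b (K n)) X Y₂ h₀ ω y)
            + ENNReal.ofReal (R n ω) := by
  -- R_n is the sup-norm distance between ĥ and P_n h₀.
  refine ⟨fun n ω => (NPIV.supNorm fun y => NPIV.hHat n (ψ (J n)) (b (K n)) X Y₁ Y₂ ω y -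
    NPIV.projN μ n (ψ (J n)) (b (K n)) X Y₂ h₀ ω y).toReal, ?_, fun n ω => ?_⟩
  swap
  · obtain ⟨C, hC⟩ := hψ.bounds.sup_bound
    rw [ENNReal.ofReal_toReal (NPIV.supNorm_hHat_sub_projN_ne_top (c := C * √(J n : ℝ))
      (fun y hy => (NPIV.euc_eq_sqrt _).trans_le (hC _ y hy)) n ω)]
    exact NPIV.supNorm_sub_le _ _ _
  have hγ0 : 0 < γ := hp.trans hγ
  obtain ⟨Cψ, α, hhol⟩ := hψ.holder
  obtain ⟨C, hC, hmds⟩ := NPIV.exists_isMDS hδ hModel hResid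
  have hmem := hData.ae_mem
  obtain ⟨l, c, hl, hc, hψg⟩ := hψ.bounds.exists_isGoodBasis (hModel.measurable_Y₂ 0)
    (hmem.mono fun ω h => (h 0).2) fun J j => (hhol J j).continuousOn
  obtain ⟨l', c', hl', hc', hbg⟩ := hb.bounds.exists_isGoodBasis (hModel.measurable_X 0)
    (hmem.mono fun ω h => (h 0).1) fun K k => (hb.holder K k).choose_spec.continuousOn
  have hae : ∀ᵐ ω ∂μ, (∀ i, X i ω ∈ NPIV.unitCube d) ∧ ∀ i, Y₁ i ω = h₀ (Y₂ i ω) + ε i ω := by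
    filter_upwards [hmem, ae_all_iff.2 hModel.eq] with ω h1 h2
    exact ⟨fun i => (h1 i).1, h2⟩
  obtain ⟨CK, hCK, hKle⟩ := NPIV.exists_le_rpow_of_isBigO hKn
  have hθ : δ / (2 + δ) < 1 := (div_lt_one (by linarith)).2 (by linarith)
  have hKn' := NPIV.eventually_le_of_le_rpow (by positivity) hθ hKle
  set Q := ∫ ω, |ε 0 ω| ^ (2 + δ) ∂μ with hQ
  have hQ0 : 0 ≤ Q := integral_nonneg fun ω => by positivity
  -- The mesh exponent depends only on the basis, not on the probability level η.
  obtain ⟨m, hm⟩ := exists_nat_ge ((1 / 2 + |α|) / min γ 1)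
  have hs1 : 0 < √l⁻¹ := Real.sqrt_pos.2 (inv_pos.2 hl)
  have hs2 : 0 < √l'⁻¹ := Real.sqrt_pos.2 (inv_pos.2 hl')
  intro η hη
  obtain ⟨r, hr, hrη⟩ := NPIV.exists_pos_five_mul_ofReal_le hη
  obtain ⟨M₁, hM₁, hE₁⟩ := hOp (ENNReal.ofReal r) (ENNReal.ofReal_pos.2 hr)
  have hE₂ := (hop (ENNReal.ofReal (1 / 4)) (by simp)).eventually_le_const
    (ENNReal.ofReal_pos.2 hr)
  -- The added 1 gives M₃ ≤ M₃², so no square root is needed to solve for the level.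
  set M₃ := C * (√l'⁻¹ * c') ^ 2 / r + 1 with hM₃
  have hM₃1 : 1 ≤ M₃ := le_add_of_nonneg_left (by positivity)
  have hE₃ : C * (√l'⁻¹ * c') ^ 2 / M₃ ^ 2 ≤ r := by
    rw [div_le_iff₀ (by positivity), ← div_le_iff₀' hr]
    nlinarith
  set M₄ := 2 * Q / r + 1 with hM₄
  have hM₄pos : 0 < M₄ := by positivity
  have hE₄ : 2 * Q / M₄ ≤ r := by
    rw [div_le_iff₀ hM₄pos, ← div_le_iff₀' hr]
    linarith
  have hE₅ : ∀ᶠ n : ℕ in atTop, (2 ^ (d + 1) / n : ℝ) ≤ r :=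
    (tendsto_const_div_atTop_nhds_zero_nat _).eventually_le_const hr
  set c₀ := (2 * (√l⁻¹ * c * (√l'⁻¹ * c')))⁻¹ with hc₀
  have hc₀pos : 0 < c₀ := by positivity
  -- The smallest A for which the union bound over the grid closes.
  set A := c₀⁻¹ * (2 * c₀ ^ 2 * C * (√l⁻¹ * c) ^ 2 + (m * d + 1 : ℕ)) with hA
  have hA0 : 0 < A := by positivity
  have hcA : 2 * c₀ ^ 2 * C * (√l⁻¹ * c) ^ 2 + (m * d + 1 : ℕ) ≤ c₀ * A := by
    rw [hA, mul_inv_cancel_left₀ hc₀pos.ne']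
  refine ⟨A + √l⁻¹ * c * (√l'⁻¹ * c') * M₄ * CK ^ (1 + δ / 2) +
    √l⁻¹ * (|Cψ| * √d ^ min γ 1) * M₃ + 24 * (√l⁻¹ * c) * M₁ * M₃, by positivity, ?_⟩
  filter_upwards [hσ, hJK, hKle, hKn', hE₁, hE₂, hE₅, hJ.eventually_gt_atTop 0,
    hK.eventually_gt_atTop 0, NPIV.eventually_one_le_log, eventually_gt_atTop 0] with
    n a1 a2 a3 a4 a5 a6 a7 a8 a9 a10 a11
  simp only [abs_of_nonneg ENNReal.toReal_nonneg]
  refine (NPIV.measure_lt_supNorm_le (hψg _ a8) (hbg _ a9) hc hc' hC hδ hγ0 hmds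
    (fun i => hResid.moment _) (fun i => (hResid.integral_moment_eq _).le) hae
    (fun j => (hhol _ j).mono (NPIV.mul_rpow_le_abs_mul_rpow_abs a8 Cψ α)) a1 a11 a10 a8 a9 a2 a4
    hCK.le a3 hm hcA hM₁ (one_pos.trans_le hM₃1) hM₄pos).trans (le_trans ?_ hrη)
  gcongr
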